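/- **Setting.** Let $n,N\in\mathbb N$ and let $\phi_{ij}:[0,1]\to(0,\infty)$, $1\le i,j\le N$, be Lipschitz continuous with $\phi_{ij}=\phi_{ji}$. Consider on $(\mathbb R^n)^N$ the systems $\dot x=f(x)$, $f_i(x)=\sum_{j=1}^N a_{ij}(\|x_i-x_j\|)\,(x_j-x_i)$. The *original model* has $a_{ij}(r)=\phi_{ij}(r)$ for $r\in[0,1)$ and $a_{ij}(r)=0$ for $r\ge 1$; the *variant* has $a_{ij}(r)=\phi_{ij}(r)$ for $r\in[0,1]$ and $a_{ij}(r)=0$ for $r>1$. For $\phi_{ij}\equiv1$ the variant is $a_{ij}=1$ on $[0,1]$, $a_{ij}=0$ on $(1,\infty)$. **Solutions on $[0,T]$, $T>0$.** *Classical*: $\dot x=f(x)$ at every $t\in[0,T]$ (one-sided at the ends). *Caratheodory*: $x$ is absolutely continuous and $\dot x=f(x)$ for a.e. $t$. *Filippov*, *Krasovskii*: $x$ is absolutely continuous and $\dot x\in F(x)$, respectively $\dot x\in K(x)$, for a.e. $t$, where $F(x)=\bigcap_{\delta>0}\bigcap_{\lambda(Z)=0}\overline{co}\,f(B(x,\delta)\setminus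 Z)$ and $K(x)=\bigcap_{\delta>0}\overline{co}\,f(B(x,\delta))$. *CLSS*: $x$ is a uniform limit of continuous $x_\nu$ with $x_\nu(0)=x(0)$ such that, for some $0=t_\nu^0<\dots<t_\nu^{m_\nu}=T$ with $\max_j(t_\nu^{j+1}-t_\nu^j)\to0$, $\dot x_\nu=f(x_\nu(t^j_\nu))$ on $[t_\nu^j,t_\nu^{j+1})$. *Stratified*: a stratification $S$ for $f$ is a countable, locally finite partition of $(\mathbb R^n)^N$ into $C^1$ embedded manifolds (cells) $M_i$ such that $M_i\cap\partial M_j\ne\emptyset$, $i\ne j$, implies $M_i\subset\partial M_j$ and $\dim M_i<\dim M_j$, each cell being of type I or II, with a map $\Sigma$ from type II to type I cells, such that: on type I cells $f$ is tangent and its restriction is smooth; from each point $x$ of a type II cell $M_j$ there is a (locally) unique absolutely continuous curve $\xi$ with $\xi(0)=x$ and, for small $t>0$, $\xi(t)\in M_{\Sigma(j)}$ and $\dot\xi=f(\xi)$. A stratified solution generated by $S$ is a continuous, piecewise smooth $x$ with some $0=t_0<\dots<t_\ell=T$ and cells $M_{i_k}$ such that either $M_{i_k}$ is of type I and $x$ is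 a classical solution in $M_{i_k}$ on $[t_k,t_{k+1})$, or $M_{i_k}$ is of type II, $x(t_k)\in M_{i_k}$ and $x$ is a classical solution in $M_{\Sigma(i_k)}$ on $(t_k,t_{k+1})$. A *global* solution is a curve on $[0,\infty)$ that is a solution on each $[0,T]$. *Uniqueness* for $x_0$: any two solutions on the same $[0,T]$ starting at $x_0$ coincide. Properties: **P1** $\frac1N\sum_i x_i(t)$ is constant along every solution; **P2** every global solution converges as $t\to\infty$ to some $x^\infty$ with $x_i^\infty=x_j^\infty$ or $\|x_i^\infty-x_j^\infty\|\ge1$ for all $i,j$; **P3** $x^\infty$ depends only on $x(0)$. **Theorem 3.** (a) For every $T>0$ the variant and the original model have the same Filippov solutions and the same Krasovskii solutions on $[0,T]$. (b) If $n\ge1$ and $N\ge2$, then for every $T>0$ the set of classical solutions on $[0,T]$ of the variant differs from that of the original model; the same holds for Caratheodory and for CLSS solutions. If $\phi_{ij}\equiv1$, $N=2$ and $n\ge1$, the sets of stratified solutions on $[0,T]$ (over all stratifications) differ. (c) (Existence.) For the variant there is a global Caratheodory, Filippov, Krasovskii and CLSS solution from every initial datum. For every stratification $S$ there is a global stratified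 solution generated by $S$ from every initial datum from which changes of cell do not accumulate, i.e. such that every curve from it on some $[0,\tau)$, $0<\tau<\infty$, that is a stratified solution on $[0,T]$ for all $T<\tau$ stays in one cell on some $(s,\tau)$. Classical solutions need not exist: for $\phi_{ij}\equiv1$ and some $n,N$ there are an initial datum and a $T>0$ without classical solution on $[0,T]$. (d) (Uniqueness.) For the variant, classical solutions, and stratified solutions of a fixed stratification, are unique for every initial datum. For each of Caratheodory, Filippov, Krasovskii and CLSS solutions there are $n,N$ and, with $\phi_{ij}\equiv1$, an initial datum for which uniqueness fails; the same holds for stratified solutions when the stratification is not fixed. For Lebesgue-almost every initial datum, uniqueness holds for every one of the six concepts (for stratified solutions even over all stratifications together). (e) (Properties.) For the variant, P1 and P2 hold for all six concepts. P3 holds for classical solutions and for stratified solutions of any fixed stratification. P3 fails in general (for $\phi_{ij}\equiv1$ and suitable $n,N$) for Caratheodory, Filippov, Krasovskii and CLSS solutions; and there are (with $\phi_{ij}\equiv1$) two stratifications and two global stratified solutions generated by them from the same initial datum with different limits. -/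

import Mathlib

open Set Filter Topology MeasureTheory

namespace BoundedConfidence

section Solutions

/-! Solution concepts for an autonomous equation `x' = f x` on a time interval `[0, T]`.
Curves are functions on `ℝ`; only their values on `[0, T]` matter. -/

/-- Classical solution on `[0, T]`: the equation holds at every time
(one-sided derivatives at the end points). -/
def IsClassicalSolution {E : Type*} [NormedAddCommGroup E] [NormedSpace ℝ E]
    (f : E → E) (T : ℝ) (x : ℝ → E) : Prop :=
  ∀ t ∈ Icc 0 T, HasDerivWithinAt x (f (x t)) (Icc 0 T) t

/-- Caratheodory solution on `[0, T]`. -/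
def IsCaratheodorySolution {E : Type*} [NormedAddCommGroup E] [NormedSpace ℝ E]
    (f : E → E) (T : ℝ) (x : ℝ → E) : Prop :=
  AbsolutelyContinuousOnInterval x 0 T ∧
    ∀ᵐ t ∂(volume.restrict (Icc (0 : ℝ) T)), HasDerivAt x (f (x t)) t

/-- Solution on `[0, T]` of the differential inclusion `x' ∈ V x`. -/
def IsInclusionSolution {E : Type*} [NormedAddCommGroup E] [NormedSpace ℝ E]
    (V : E → Set E) (T : ℝ) (x : ℝ → E) : Prop :=
  AbsolutelyContinuousOnInterval x 0 T ∧
    ∀ᵐ t ∂(volume.restrict (Icc (0 : ℝ) T)), ∃ v ∈ V (x t), HasDerivAt x v t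

/-- The Filippov multifunction of `f`. -/
def filippovMap {E : Type*} [NormedAddCommGroup E] [NormedSpace ℝ E] [MeasureSpace E]
    (f : E → E) (x : E) : Set E :=
  ⋂ (δ : ℝ) (_ : 0 < δ) (Z : Set E) (_ : volume Z = 0),
    closure (convexHull ℝ (f '' (Metric.ball x δ \ Z)))

/-- The Krasovskii multifunction of `f`. -/
def krasovskiiMap {E : Type*} [NormedAddCommGroup E] [NormedSpace ℝ E]
    (f : E → E) (x : E) : Set E :=
  ⋂ (δ : ℝ) (_ : 0 < δ), closure (convexHull ℝ (f '' Metric.ball x δ))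

/-- Filippov solution on `[0, T]`. -/
def IsFilippovSolution {E : Type*} [NormedAddCommGroup E] [NormedSpace ℝ E] [MeasureSpace E]
    (f : E → E) (T : ℝ) (x : ℝ → E) : Prop :=
  IsInclusionSolution (filippovMap f) T x

/-- Krasovskii solution on `[0, T]`. -/
def IsKrasovskiiSolution {E : Type*} [NormedAddCommGroup E] [NormedSpace ℝ E]
    (f : E → E) (T : ℝ) (x : ℝ → E) : Prop :=
  IsInclusionSolution (krasovskiiMap f) T x

/-- Sample-and-hold curve on `[0, T]` whose sampling steps are at most `h`: there are
`0 = τ 0 < ⋯ < τ m = T` such that on `[τ j, τ (j+1))` the derivative of `y` is the constant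
`f (y (τ j))` (a right derivative at `τ j`). -/
def IsSampleAndHold {E : Type*} [NormedAddCommGroup E] [NormedSpace ℝ E]
    (f : E → E) (T h : ℝ) (y : ℝ → E) : Prop :=
  ContinuousOn y (Icc 0 T) ∧
    ∃ (m : ℕ) (τ : Fin (m + 1) → ℝ), StrictMono τ ∧ τ 0 = 0 ∧ τ (Fin.last m) = T ∧
      ∀ j : Fin m, τ j.succ - τ j.castSucc ≤ h ∧
        ∀ t ∈ Ico (τ j.castSucc) (τ j.succ),
          HasDerivWithinAt y (f (y (τ j.castSucc))) (Ico (τ j.castSucc) (τ j.succ)) t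

/-- Clarke-Ledyaev-Sontag-Subbotin solution on `[0, T]`: a uniform limit of sample-and-hold
curves with the same initial point, the sampling steps tending to zero. -/
def IsCLSSSolution {E : Type*} [NormedAddCommGroup E] [NormedSpace ℝ E]
    (f : E → E) (T : ℝ) (x : ℝ → E) : Prop :=
  ContinuousOn x (Icc 0 T) ∧
    ∃ (h : ℕ → ℝ) (y : ℕ → ℝ → E), Tendsto h atTop (𝓝 0) ∧
      (∀ k, y k 0 = x 0 ∧ IsSampleAndHold f T (h k) (y k)) ∧
      TendstoUniformlyOn y x atTop (Icc 0 T)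

end Solutions

section Stratifications

/-- `M` is an embedded `C¹` submanifold of dimension `d` of the finite-dimensional space `E`:
locally a regular level set of a `C¹` map into `ℝ^k`, where `d + k = dim E`. -/
def IsC1Submanifold {E : Type*} [NormedAddCommGroup E] [NormedSpace ℝ E]
    (M : Set E) (d : ℕ) : Prop :=
  ∃ k : ℕ, d + k = Module.finrank ℝ E ∧
    ∀ x ∈ M, ∃ (U : Set E) (g : E → Fin k → ℝ), IsOpen U ∧ x ∈ U ∧ ContDiffOn ℝ 1 g U ∧
      (∀ y ∈ U, Function.Surjective (fderiv ℝ g y)) ∧ M ∩ U = {y ∈ U | g y = 0}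

/-- Tangent vectors to `M` at `x`: velocities of `C¹` curves in `M` through `x`. -/
def tangentVectors {E : Type*} [NormedAddCommGroup E] [NormedSpace ℝ E]
    (M : Set E) (x : E) : Set E :=
  {v | ∃ γ : ℝ → E, γ 0 = x ∧ (∀ᶠ t in 𝓝 0, γ t ∈ M) ∧ ContDiffAt ℝ 1 γ 0 ∧ deriv γ 0 = v}

/-- The restriction of `f` to `M` is smooth: locally on `M` it agrees with a smooth map
defined on an open set of the ambient space. -/
def IsSmoothOnSubset {E : Type*} [NormedAddCommGroup E] [NormedSpace ℝ E]
    (f : E → E) (M : Set E) : Prop :=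
  ∀ x ∈ M, ∃ (U : Set E) (g : E → E), IsOpen U ∧ x ∈ U ∧ ContDiffOn ℝ (⊤ : ℕ∞) g U ∧
    EqOn f g (M ∩ U)

/-- `ξ` is an absolutely continuous curve on `[0, ε)` that starts at `x`, lies in `M` and
satisfies `ξ' = f ξ` on `(0, ε)`. -/
def IsEnteringCurve {E : Type*} [NormedAddCommGroup E] [NormedSpace ℝ E]
    (f : E → E) (M : Set E) (x : E) (ε : ℝ) (ξ : ℝ → E) : Prop :=
  ξ 0 = x ∧ (∀ b ∈ Ioo 0 ε, AbsolutelyContinuousOnInterval ξ 0 b) ∧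
    ∀ t ∈ Ioo 0 ε, ξ t ∈ M ∧ HasDerivAt ξ (f (ξ t)) t

/-- A stratification for `x' = f x`: a locally finite partition of the whole space into
(countably many) embedded `C¹` manifolds with the frontier condition, split into cells of
type I and of type II, together with a map `next` from the type II cells to the type I cells
(its values on type I cells are irrelevant). -/
structure Stratification {E : Type*} [NormedAddCommGroup E] [NormedSpace ℝ E]
    (f : E → E) where
  ι : Type
  countable_index : Countable ι
  cell : ι → Set E
  dim : ι → ℕ
  isC1Submanifold : ∀ i, IsC1Submanifold (cell i) (dim i)
  iUnion_cell : ⋃ i, cell i = univ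
  locallyFinite : ∀ K : Set E, IsCompact K → {i | (K ∩ cell i).Nonempty}.Finite
  disjoint_cell : ∀ i j, i ≠ j → Disjoint (cell i) (cell j)
  frontier_condition : ∀ i j, i ≠ j → (cell i ∩ frontier (cell j)).Nonempty →
    cell i ⊆ frontier (cell j) ∧ dim i < dim j
  typeI : Set ι
  next : ι → ι
  next_mem : ∀ j, j ∉ typeI → next j ∈ typeI
  tangent : ∀ i ∈ typeI, ∀ x ∈ cell i, f x ∈ tangentVectors (cell i) x
  smooth : ∀ i ∈ typeI, IsSmoothOnSubset f (cell i)
  /-- From each point of a type II cell there is a locally unique curve entering the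
  assigned type I cell. -/
  entering : ∀ j, j ∉ typeI → ∀ x ∈ cell j, ∃ (ε : ℝ) (ξ : ℝ → E), 0 < ε ∧
    IsEnteringCurve f (cell (next j)) x ε ξ ∧
    ∀ (δ : ℝ) (η : ℝ → E), 0 < δ → δ ≤ ε → IsEnteringCurve f (cell (next j)) x δ η →
      EqOn η ξ (Ico 0 δ)

/-- Stratified solution on `[0, T]` generated by the stratification `S`. -/
def IsStratifiedSolution {E : Type*} [NormedAddCommGroup E] [NormedSpace ℝ E]
    {f : E → E} (S : Stratification f) (T : ℝ) (x : ℝ → E) : Prop :=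
  ContinuousOn x (Icc 0 T) ∧
    ∃ (l : ℕ) (τ : Fin (l + 1) → ℝ) (c : Fin l → S.ι),
      StrictMono τ ∧ τ 0 = 0 ∧ τ (Fin.last l) = T ∧
      ∀ k : Fin l,
        ContDiffOn ℝ (⊤ : ℕ∞) x (Ioo (τ k.castSucc) (τ k.succ)) ∧
        ((c k ∈ S.typeI ∧ ∀ t ∈ Ico (τ k.castSucc) (τ k.succ), x t ∈ S.cell (c k) ∧
            HasDerivWithinAt x (f (x t)) (Ico (τ k.castSucc) (τ k.succ)) t) ∨
         (c k ∉ S.typeI ∧ x (τ k.castSucc) ∈ S.cell (c k) ∧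
            ∀ t ∈ Ioo (τ k.castSucc) (τ k.succ), x t ∈ S.cell (S.next (c k)) ∧
              HasDerivAt x (f (x t)) t))

/-- Solutions generated by some stratification for `f`. -/
def IsSomeStratifiedSolution {E : Type*} [NormedAddCommGroup E] [NormedSpace ℝ E]
    (f : E → E) (T : ℝ) (x : ℝ → E) : Prop :=
  ∃ S : Stratification f, IsStratifiedSolution S T x

/-- The stratified solutions from `x₀` do not change cell infinitely often in finite time:
a curve from `x₀` on `[0, τ)` that is a stratified solution on `[0, T]` for every `T < τ`
stays in one cell on some interval `(s, τ)`. -/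
def NoAccumulationFrom {E : Type*} [NormedAddCommGroup E] [NormedSpace ℝ E]
    {f : E → E} (S : Stratification f) (x₀ : E) : Prop :=
  ∀ (τ : ℝ) (x : ℝ → E), 0 < τ → x 0 = x₀ →
    (∀ T, 0 < T → T < τ → IsStratifiedSolution S T x) →
    ∃ s ∈ Ico 0 τ, ∃ i : S.ι, ∀ t ∈ Ioo s τ, x t ∈ S.cell i

end Stratifications

section Model

/-- States of `N` agents with opinions in `ℝⁿ` (with the Euclidean norm on `ℝⁿ`). -/
abbrev Config (n N : ℕ) : Type := Fin N → EuclideanSpace ℝ (Fin n)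

/-- The vector field `f_i(x) = ∑_j a_ij(‖x_i - x_j‖) (x_j - x_i)`. -/
noncomputable def hkField {n N : ℕ} (a : Fin N → Fin N → ℝ → ℝ) (x : Config n N) : Config n N :=
  fun i => ∑ j, a i j ‖x i - x j‖ • (x j - x i)

/-- `a_ij = φ_ij` on `[0,1)` and `0` on `[1,∞)`. -/
noncomputable def openCutoff {N : ℕ} (φ : Fin N → Fin N → ℝ → ℝ) : Fin N → Fin N → ℝ → ℝ :=
  fun i j r => if r < 1 then φ i j r else 0

/-- `a_ij = φ_ij` on `[0,1]` and `0` on `(1,∞)`. -/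
noncomputable def closedCutoff {N : ℕ} (φ : Fin N → Fin N → ℝ → ℝ) : Fin N → Fin N → ℝ → ℝ :=
  fun i j r => if r ≤ 1 then φ i j r else 0

/-- The original model: no interaction at distance exactly `1`. -/
noncomputable def hkOpen (n : ℕ) {N : ℕ} (φ : Fin N → Fin N → ℝ → ℝ) : Config n N → Config n N :=
  hkField (openCutoff φ)

/-- The variant: interaction also at distance exactly `1`. -/
noncomputable def hkClosed (n : ℕ) {N : ℕ} (φ : Fin N → Fin N → ℝ → ℝ) :
    Config n N → Config n N :=
  hkField (closedCutoff φ)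

/-- The coupling `φ_ij ≡ 1`. -/
def unitCoupling (N : ℕ) : Fin N → Fin N → ℝ → ℝ := fun _ _ _ => 1

/-- Couplings `φ_ij : [0,1] → (0,∞)` that are symmetric and Lipschitz continuous. -/
structure IsCoupling {N : ℕ} (φ : Fin N → Fin N → ℝ → ℝ) : Prop where
  symm : ∀ i j, ∀ r ∈ Icc (0 : ℝ) 1, φ i j r = φ j i r
  pos : ∀ i j, ∀ r ∈ Icc (0 : ℝ) 1, 0 < φ i j r
  lipschitz : ∀ i j, ∃ K, LipschitzOnWith K (φ i j) (Icc 0 1)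

/-- The barycenter of the agents. -/
noncomputable def barycenter {n N : ℕ} (x : Config n N) : EuclideanSpace ℝ (Fin n) :=
  (N : ℝ)⁻¹ • ∑ i, x i

end Model

section Properties

/-! In this section `Sol T x` stands for "`x` is a solution on `[0, T]`" in one of the senses
above. -/

/-- Solution on `[0, ∞)`. -/
def IsGlobal {E : Type*} (Sol : ℝ → (ℝ → E) → Prop) (x : ℝ → E) : Prop :=
  ∀ T, 0 < T → Sol T x

/-- There is a global solution from `x₀`. -/
def ExistsFrom {E : Type*} (Sol : ℝ → (ℝ → E) → Prop) (x₀ : E) : Prop :=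
  ∃ x : ℝ → E, x 0 = x₀ ∧ IsGlobal Sol x

/-- Any two solutions from `x₀` on a common time interval coincide. -/
def UniqueFrom {E : Type*} (Sol : ℝ → (ℝ → E) → Prop) (x₀ : E) : Prop :=
  ∀ (T : ℝ) (x y : ℝ → E), 0 < T → Sol T x → Sol T y → x 0 = x₀ → y 0 = x₀ →
    EqOn x y (Icc 0 T)

/-- P1: the barycenter is constant along solutions. -/
def BarycenterInvariant {n N : ℕ} (Sol : ℝ → (ℝ → Config n N) → Prop) : Prop :=
  ∀ (T : ℝ) (x : ℝ → Config n N), 0 < T → Sol T x →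
    ∀ t ∈ Icc 0 T, barycenter (x t) = barycenter (x 0)

/-- P2: every global solution converges, and in the limit two agents either coincide or are at
distance at least `1`. -/
def Clustering {n N : ℕ} (Sol : ℝ → (ℝ → Config n N) → Prop) : Prop :=
  ∀ x : ℝ → Config n N, IsGlobal Sol x →
    ∃ l : Config n N, Tendsto x atTop (𝓝 l) ∧ ∀ i j, l i = l j ∨ 1 ≤ ‖l i - l j‖

/-- P3: the limit of a global solution depends on its initial point only. -/
def LimitDeterminedByInitial {E : Type*} [TopologicalSpace E]
    (Sol : ℝ → (ℝ → E) → Prop) : Prop :=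
  ∀ (x y : ℝ → E) (l l' : E), IsGlobal Sol x → IsGlobal Sol y → x 0 = y 0 →
    Tendsto x atTop (𝓝 l) → Tendsto y atTop (𝓝 l') → l = l'

end Properties

end BoundedConfidence

open BoundedConfidence

/-! Both fields are a bounded Lipschitz kernel multiplied by scalar weights that jump at distance
one. Each of their values is a limit of values off the jump set: shrinking a configuration slightly
keeps its pairs at distance one linked, as in the variant, and dilating it slightly unlinks them, as
in the original model. Hence the Filippov and Krasovskii multifunctions of both models all coincide.
A configuration with one isolated pair at distance one, and no closer pair, is an equilibrium of the
original model but not of the variant; this separates the other concepts.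

Every solution of the variant, in any of the six senses, is a Krasovskii solution, so P1, P2 and
uniqueness for almost every datum are proved only for these. P1 is the antisymmetry of the forces.
For P2 (`clustering_krasovskii`) the squared Euclidean norm is an energy. Distances strictly between
0 and 1 cost energy, so in the long run agents merge or are at least nearly one apart, and the
momentum entering a merging cluster is bounded by the dissipation, which is integrable.

Uniqueness for almost every datum rests on a one-sided Lipschitz estimate for reversed time
(`exists_one_sided`): cutting a link can separate trajectories only in forward time. Thus the state
at time `t` determines the initial state through a Lipschitz map `B` (`exists_backward_map`), a
uniform limit of backward flows of Lipschitz fields, hence of homeomorphisms. A point where `B` is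
not injective is then never isolated in its fibre (`frequently_eq_of_tendsto_homeo`), so `B` has no
invertible derivative there. By the theorems of Rademacher and Sard the values at such points form a
null set.

Classical solutions are unique because the energy rate is a derivative and has the Darboux property,
whereas losing a link would make it jump (`eventually_linkGraph_eq`). For a fixed stratification the
cell of the current state determines the solution to the right.

Caratheodory solutions start along a graph that maximises the speed among those compatible with the
state (`exists_strict_graph`): its links at distance one contract strictly and its non-links expand
strictly. CLSS solutions are limits of Euler polygons. Stratified solutions are continued piece by
piece.

The counterexamples are five agents on a line whose critical link breaks at once (no classical
solution), agents at -1, 0, 1 where the middle one may join either neighbour, and a planar triple in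
which the Euler scheme hits or misses a momentary contact depending on its step size. -/

namespace BoundedConfidence

/-! ### Absolutely continuous curves, one-sided derivatives and the continuation principle. -/

section Calculus

variable {E : Type*} [NormedAddCommGroup E] [NormedSpace ℝ E]

/-- An absolutely continuous function with almost everywhere nonpositive derivative does not
increase. -/
theorem le_of_absolutelyContinuous_of_ae_deriv_nonpos {g : ℝ → ℝ} {a b : ℝ} (hab : a ≤ b)
    (hg : AbsolutelyContinuousOnInterval g a b)
    (h : ∀ᵐ t, t ∈ Icc a b → ∃ d, d ≤ 0 ∧ HasDerivAt g d t) : g b ≤ g a := by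
  have h1 := hg.integral_deriv_eq_sub
  have h2 : ∫ t in a..b, deriv g t ≤ 0 := by
    rw [intervalIntegral.integral_of_le hab]
    apply integral_nonpos_of_ae
    rw [EventuallyLE, ae_restrict_iff' measurableSet_Ioc]
    filter_upwards [h] with t ht hmem
    obtain ⟨d, hd, hder⟩ := ht (Ioc_subset_Icc_self hmem)
    rw [hder.deriv]; exact hd
  linarith

theorem absolutelyContinuous_clm_comp {F : Type*} [NormedAddCommGroup F] [NormedSpace ℝ F]
    {x : ℝ → E} {a b : ℝ}
    (hx : AbsolutelyContinuousOnInterval x a b) (l : E →L[ℝ] F) :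
    AbsolutelyContinuousOnInterval (fun t => l (x t)) a b := by
  have h : Tendsto _ _ _ := Tendsto.const_mul ‖l‖ hx
  rw [mul_zero] at h
  refine squeeze_zero (fun t => Finset.sum_nonneg fun i _ => dist_nonneg) (fun t => ?_)
    h
  rw [Finset.mul_sum]
  refine Finset.sum_le_sum fun i _ => ?_
  simp only [dist_eq_norm, ← map_sub]
  exact l.le_opNorm _

/-- A norming functional `l` reduces the estimate to the scalar function `l (x t) - M * t`, which
does not increase. No integral of a vector-valued derivative is needed. -/
theorem norm_sub_le_of_absolutelyContinuous {x : ℝ → E} {a b M : ℝ} (hab : a ≤ b)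
    (hx : AbsolutelyContinuousOnInterval x a b)
    (h : ∀ᵐ t, t ∈ Icc a b → ∃ v, ‖v‖ ≤ M ∧ HasDerivAt x v t) :
    ‖x b - x a‖ ≤ M * (b - a) := by
  obtain ⟨l, hl, hl'⟩ := exists_dual_vector'' ℝ (x b - x a)
  have h1 : (fun t => l (x t) - M * t) b ≤ (fun t => l (x t) - M * t) a := by
    apply le_of_absolutelyContinuous_of_ae_deriv_nonpos hab
    · refine (absolutelyContinuous_clm_comp hx l).sub (f := fun t => l (x t)) ?_
      refine LipschitzOnWith.absolutelyContinuousOnInterval (K := ‖M‖₊) ?_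
      refine LipschitzWith.lipschitzOnWith (LipschitzWith.of_dist_le_mul fun s t => ?_)
      simp [Real.dist_eq, ← mul_sub, abs_mul]
    · filter_upwards [h] with t ht hmem
      obtain ⟨v, hv, hder⟩ := ht hmem
      refine ⟨l v - M * 1, ?_, (l.hasFDerivAt.comp_hasDerivAt t hder).sub
        ((hasDerivAt_id t).const_mul M)⟩
      have : l v ≤ ‖l‖ * ‖v‖ := (le_abs_self _).trans (l.le_opNorm v)
      nlinarith [norm_nonneg v]
  have h2 : l (x b) - l (x a) = ‖x b - x a‖ := by rw [← map_sub]; simpa using hl'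
  simp only at h1
  linarith

theorem lipschitzOnWith_of_absolutelyContinuous {x : ℝ → E} {a b M : ℝ} (hM : 0 ≤ M)
    (hx : AbsolutelyContinuousOnInterval x a b) (hab : a ≤ b)
    (h : ∀ᵐ t, t ∈ Icc a b → ∃ v, ‖v‖ ≤ M ∧ HasDerivAt x v t) :
    LipschitzOnWith M.toNNReal x (Icc a b) := by
  have key : ∀ s ∈ Icc a b, ∀ t ∈ Icc a b, s ≤ t → ‖x t - x s‖ ≤ M * (t - s) := by
    intro s hs t ht hst
    refine norm_sub_le_of_absolutelyContinuous hst (hx.mono ?_) ?_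
    · rw [uIcc_of_le hst, uIcc_of_le hab]; exact Icc_subset_Icc hs.1 ht.2
    · filter_upwards [h] with r hr hm
      exact hr ⟨hs.1.trans hm.1, hm.2.trans ht.2⟩
  refine LipschitzOnWith.of_dist_le_mul fun s hs t ht => ?_
  rw [Real.coe_toNNReal _ hM, dist_eq_norm, Real.dist_eq]
  rcases le_total s t with hst | hst
  · rw [norm_sub_rev, abs_sub_comm, abs_of_nonneg (sub_nonneg.2 hst)]; exact key s hs t ht hst
  · rw [abs_of_nonneg (sub_nonneg.2 hst)]; exact key t ht s hs hst

theorem absolutelyContinuous_comp_of_contDiff [FiniteDimensional ℝ E] {x : ℝ → E} {a b : ℝ}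
    {K : NNReal} (hab : a ≤ b) (hx : LipschitzOnWith K x (Icc a b)) {g : E → ℝ}
    (hg : ContDiff ℝ 1 g) : AbsolutelyContinuousOnInterval (fun t => g (x t)) a b := by
  obtain ⟨R, hR⟩ := (isCompact_Icc.image_of_continuousOn hx.continuousOn).isBounded.subset_closedBall 0
  have : ProperSpace E := FiniteDimensional.proper ℝ E
  obtain ⟨K', hK'⟩ := (hg.contDiffOn (s := Metric.closedBall 0 R)).exists_lipschitzOnWith
    (by decide) (convex_closedBall _ _) (isCompact_closedBall _ _)
  refine LipschitzOnWith.absolutelyContinuousOnInterval (K := K' * K) ?_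
  rw [uIcc_of_le hab]
  exact hK'.comp hx (fun t ht => hR (mem_image_of_mem _ ht))

theorem ae_restrict_Icc_iff {a b : ℝ} {p : ℝ → Prop} :
    (∀ᵐ t ∂(volume.restrict (Icc a b)), p t) ↔ ∀ᵐ t, t ∈ Icc a b → p t :=
  ae_restrict_iff' measurableSet_Icc

theorem ae_ne_real (a : ℝ) : ∀ᵐ t : ℝ, t ≠ a := by
  simp [ae_iff]

/-- A curve that is continuous on `[a, b]` with derivative bounded by `M` off a countable set is
Lipschitz. -/
theorem lipschitzOnWith_of_hasDerivAt_off_countable {x : ℝ → E} {a b M : ℝ} {s : Set ℝ}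
    (hs : s.Countable) (hx : ContinuousOn x (Icc a b))
    (h : ∀ t ∈ Ioo a b \ s, ∃ v, ‖v‖ ≤ M ∧ HasDerivAt x v t) (hM : 0 ≤ M) [CompleteSpace E] :
    LipschitzOnWith M.toNNReal x (Icc a b) := by
  have key : ∀ u ∈ Icc a b, ∀ t ∈ Icc a b, u ≤ t → ‖x t - x u‖ ≤ M * (t - u) := by
    intro u hu t ht hut
    obtain ⟨l, hl, hl'⟩ := exists_dual_vector'' ℝ (x t - x u)
    have hsub : Icc u t ⊆ Icc a b := Icc_subset_Icc hu.1 ht.2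
    have hcont : ContinuousOn (fun r => M * r - l (x r)) (Icc u t) :=
      (continuousOn_const.mul continuousOn_id).sub (l.continuous.comp_continuousOn (hx.mono hsub))
    have hmono : MonotoneOn (fun r => M * r - l (x r)) (Icc u t) := by
      have hder : ∀ r ∈ Ioo u t \ s, ∃ d, 0 ≤ d ∧ HasDerivAt (fun r => M * r - l (x r)) d r := by
        intro r hr
        obtain ⟨v, hv, hd⟩ := h r ⟨⟨hu.1.trans_lt hr.1.1, hr.1.2.trans_le ht.2⟩, hr.2⟩
        refine ⟨M * 1 - l v, ?_, ((hasDerivAt_id r).const_mul M).sub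
          (l.hasFDerivAt.comp_hasDerivAt r hd)⟩
        have : l v ≤ ‖l‖ * ‖v‖ := (le_abs_self _).trans (l.le_opNorm v)
        nlinarith [norm_nonneg v]
      intro p hp q hq hpq
      have hsub2 : Icc p q ⊆ Icc u t := Icc_subset_Icc hp.1 hq.2
      have hbd : ∀ r ∈ Ioo p q \ s, ∃ d, 0 ≤ d ∧ d ≤ M + M ∧
          HasDerivAt (fun r => M * r - l (x r)) d r := by
        intro r hr
        obtain ⟨v, hv, hd⟩ := h r ⟨⟨hu.1.trans_lt (hp.1.trans_lt hr.1.1),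
          (hr.1.2.trans_le hq.2).trans_le ht.2⟩, hr.2⟩
        have h1 : |l v| ≤ ‖l‖ * ‖v‖ := l.le_opNorm v
        have h2 := abs_le.1 h1
        refine ⟨M * 1 - l v, ?_, ?_, ((hasDerivAt_id r).const_mul M).sub
          (l.hasFDerivAt.comp_hasDerivAt r hd)⟩ <;> nlinarith [norm_nonneg v]
      -- The fundamental theorem off a countable set asks for an integrable derivative; the bound `M
      -- + M` supplies this.
      have hint : IntervalIntegrable (deriv fun r => M * r - l (x r)) volume p q := by
        rw [intervalIntegrable_iff_integrableOn_Ioo_of_le hpq]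
        refine Measure.integrableOn_of_bounded (M := M + M) (by simp)
          (stronglyMeasurable_deriv _).aestronglyMeasurable ?_
        rw [ae_restrict_iff' measurableSet_Ioo]
        filter_upwards [hs.ae_notMem volume] with r hr hr'
        obtain ⟨d, h0, h1, h2⟩ := hbd r ⟨hr', hr⟩
        rw [h2.deriv, Real.norm_of_nonneg h0]; exact h1
      have := integral_eq_of_hasDerivAt_off_countable_of_le _ _ hpq hs
        (hcont.mono hsub2) (fun r hr => by
          obtain ⟨d, -, -, hd⟩ := hbd r hr
          exact hd.differentiableAt.hasDerivAt) hint
      have hnn : 0 ≤ ∫ r in p..q, deriv (fun r => M * r - l (x r)) r := by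
        rw [intervalIntegral.integral_of_le hpq, integral_Ioc_eq_integral_Ioo]
        apply integral_nonneg_of_ae
        rw [EventuallyLE, ae_restrict_iff' measurableSet_Ioo]
        filter_upwards [hs.ae_notMem volume] with r hr hr'
        obtain ⟨d, h0, h1, h2⟩ := hbd r ⟨hr', hr⟩
        rw [h2.deriv]; exact h0
      simp only at *
      linarith
    have h3 := hmono (left_mem_Icc.2 hut) (right_mem_Icc.2 hut) hut
    have h2 : l (x t) - l (x u) = ‖x t - x u‖ := by rw [← map_sub]; simpa using hl'
    simp only at h3
    linarith
  refine LipschitzOnWith.of_dist_le_mul fun u hu t ht => ?_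
  rw [Real.coe_toNNReal _ hM, dist_eq_norm, Real.dist_eq]
  rcases le_total u t with hst | hst
  · rw [norm_sub_rev, abs_sub_comm, abs_of_nonneg (sub_nonneg.2 hst)]; exact key u hu t ht hst
  · rw [abs_of_nonneg (sub_nonneg.2 hst)]; exact key t ht u hu hst

/-- Solutions of an equation with bounded Lipschitz right-hand side exist on every interval. -/
theorem exists_solution_of_lipschitz_of_bounded [CompleteSpace E] {F : E → E} {K : NNReal} {M : ℝ}
    (hK : LipschitzWith K F) (hM : ∀ x, ‖F x‖ ≤ M) (x₀ : E) {T : ℝ} (hT : 0 < T) :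
    ∃ ξ : ℝ → E, ξ 0 = x₀ ∧ ∀ t ∈ Ioo (-T) T, HasDerivAt ξ (F (ξ t)) t := by
  have hM0 : 0 ≤ M := (norm_nonneg _).trans (hM 0)
  -- At speed at most `M` the ball of radius `M * T` is not left before time `T`, so one Picard step
  -- covers the whole interval.
  have hpl : IsPicardLindelof (fun _ => F) (tmin := -T) (tmax := T) ⟨0, by simp [hT.le]⟩ x₀
      (M.toNNReal * T.toNNReal) 0 M.toNNReal K :=
    { lipschitzOnWith := fun t _ => hK.lipschitzOnWith
      continuousOn := fun x _ => continuousOn_const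
      norm_le := fun t _ x _ => by rw [Real.coe_toNNReal _ hM0]; exact hM x
      mul_max_le := by simp [hT.le] }
  obtain ⟨ξ, h0, hξ⟩ := hpl.exists_eq_forall_mem_Icc_hasDerivWithinAt₀
  exact ⟨ξ, h0, fun t ht => (hξ t (Ioo_subset_Icc_self ht)).hasDerivAt (Icc_mem_nhds ht.1 ht.2)⟩

theorem hasDerivWithinAt_Ici_of_hasDerivAt_Ioo {η : ℝ → E} {g : ℝ → E} {a b : ℝ} (hab : a < b)
    (hc : ContinuousWithinAt η (Ico a b) a)
    (hd : ∀ t ∈ Ioo a b, HasDerivAt η (g t) t) (hg : Tendsto g (𝓝[>] a) (𝓝 (g a))) :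
    HasDerivWithinAt η (g a) (Ici a) a := by
  refine hasDerivWithinAt_Ici_of_tendsto_deriv (s := Ioo a b)
    (fun t ht => (hd t ht).differentiableAt.differentiableWithinAt)
    (hc.mono Ioo_subset_Ico_self) (Ioo_mem_nhdsGT hab) ?_
  refine hg.congr' ?_
  filter_upwards [Ioo_mem_nhdsGT hab] with t ht
  exact (hd t ht).deriv.symm

/-- Two continuous curves that agree on the right of each point where they meet coincide. -/
theorem eqOn_Icc_of_forall_eventuallyEq {X : Type*} [TopologicalSpace X] [T2Space X]
    {x y : ℝ → X} {a b : ℝ} (hx : ContinuousOn x (Icc a b)) (hy : ContinuousOn y (Icc a b))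
    (h0 : x a = y a)
    (h : ∀ t ∈ Ico a b, x t = y t → ∀ᶠ s in 𝓝[>] t, x s = y s) : EqOn x y (Icc a b) := by
  have hcl : IsClosed ({t | x t = y t} ∩ Icc a b) := by
    have h1 := (hx.prodMk hy).preimage_isClosed_of_isClosed isClosed_Icc isClosed_diagonal
    convert h1 using 1
    ext t; simp [and_comm]
  exact fun t ht => hcl.Icc_subset_of_forall_mem_nhdsWithin h0 (fun s hs => h s hs.2 hs.1) ht

end Calculus

/-- Continuation principle: if solutions can be started, continued past every end point, and
closed up at a finite end of their interval of existence, then there is a global one. -/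
theorem exists_global_of_extension {E : Type*} (P : ℝ → (ℝ → E) → Prop)
    (hcongr : ∀ T x y, P T x → EqOn x y (Icc 0 T) → P T y)
    (hmono : ∀ S T x, 0 < S → S ≤ T → P T x → P S x)
    (hstart : ∃ T x, 0 < T ∧ P T x)
    (hext : ∀ T x, 0 < T → P T x → ∃ T' y, T < T' ∧ EqOn x y (Icc 0 T) ∧ P T' y)
    (hclosure : ∀ τ x, 0 < τ → (∀ T, 0 < T → T < τ → P T x) → ∃ y, EqOn x y (Ico 0 τ) ∧ P τ y) :
    ∃ x, ∀ T, 0 < T → P T x := by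
  classical
  -- Greedy extension: each step covers at least half of the way to any attainable end point within
  -- the next unit of time.
  have step : ∀ p : {p : ℝ × (ℝ → E) // 0 < p.1 ∧ P p.1 p.2},
      ∃ r : {p : ℝ × (ℝ → E) // 0 < p.1 ∧ P p.1 p.2},
        EqOn p.1.2 r.1.2 (Icc 0 p.1.1) ∧ p.1.1 < r.1.1 ∧
        ∀ S y, S ≤ p.1.1 + 1 → EqOn p.1.2 y (Icc 0 p.1.1) → P S y → (p.1.1 + S) / 2 ≤ r.1.1 := by
    rintro ⟨⟨T, x⟩, hT, hP⟩
    simp only at hT hP ⊢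
    set A : Set ℝ := {S | S ≤ T + 1 ∧ ∃ y, EqOn x y (Icc 0 T) ∧ P S y} with hA
    have hbdd : BddAbove A := ⟨T + 1, fun S hS => hS.1⟩
    obtain ⟨T', y, hTT', hxy, hy⟩ := hext T x hT hP
    have hmem : min T' (T + 1) ∈ A :=
      ⟨min_le_right _ _, y, hxy, hmono _ _ _ (lt_min (hT.trans hTT') (by linarith))
        (min_le_left _ _) hy⟩
    have hlt : T < sSup A := (lt_min hTT' (by linarith)).trans_le (le_csSup hbdd hmem)
    obtain ⟨S, ⟨hS1, z, hxz, hz⟩, hS2⟩ := exists_lt_of_lt_csSup ⟨_, hmem⟩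
      (show (T + sSup A) / 2 < sSup A by linarith)
    refine ⟨⟨(S, z), by simp only; linarith, hz⟩, hxz, by simp only; linarith, ?_⟩
    intro S' y' h1 h2 h3
    have := le_csSup hbdd (show S' ∈ A from ⟨h1, y', h2, h3⟩)
    simp only; linarith
  choose next hn1 hn2 hn3 using step
  obtain ⟨T0, x0, hT0, hP0⟩ := hstart
  let s : ℕ → {p : ℝ × (ℝ → E) // 0 < p.1 ∧ P p.1 p.2} :=
    fun k => Nat.rec ⟨(T0, x0), hT0, hP0⟩ (fun _ p => next p) k
  have hs : ∀ k, s (k + 1) = next (s k) := fun k => rfl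
  set T : ℕ → ℝ := fun k => (s k).1.1 with hTdef
  set x : ℕ → ℝ → E := fun k => (s k).1.2 with hxdef
  have hPk : ∀ k, P (T k) (x k) := fun k => (s k).2.2
  have hTpos : ∀ k, 0 < T k := fun k => (s k).2.1
  have hTmono : StrictMono T := strictMono_nat_of_lt_succ fun k => by
    simp only [hTdef, hs]; exact hn2 _
  have hagree : ∀ k m, k ≤ m → EqOn (x k) (x m) (Icc 0 (T k)) := by
    intro k m hkm
    induction m, hkm using Nat.le_induction with
    | base => exact eqOn_refl _ _
    | succ m hkm ih =>
      refine ih.trans ?_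
      have := hn1 (s m)
      rw [← hs] at this
      exact this.mono (Icc_subset_Icc_right (hTmono.monotone hkm))
  let X : ℝ → E := fun t => if h : ∃ k, t ≤ T k then x (Nat.find h) t else x 0 0
  have hX : ∀ k, EqOn X (x k) (Icc 0 (T k)) := by
    intro k t ht
    have h : ∃ k, t ≤ T k := ⟨k, ht.2⟩
    simp only [X, dif_pos h]
    exact hagree _ _ (Nat.find_min' h ht.2) ⟨ht.1, Nat.find_spec h⟩
  have hPX : ∀ k, P (T k) X := fun k => hcongr _ _ _ (hPk k) (hX k).symm
  by_cases hb : BddAbove (range T)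
  -- If the end points stayed below a finite `τ`, the union could be closed up at `τ` and extended
  -- to some `S > τ`. For `T k` close to `τ` the halfway rule would give `T (k + 1) ≥ (T k + S) / 2
  -- > τ`.
  · exfalso
    set τ := sSup (range T) with hτ
    have hle : ∀ k, T k ≤ τ := fun k => le_csSup hb ⟨k, rfl⟩
    have hlt : ∀ k, T k < τ := fun k => (hTmono (Nat.lt_succ_self k)).trans_le (hle (k + 1))
    obtain ⟨y, hXy, hy⟩ := hclosure τ X ((hTpos 0).trans (hlt 0)) fun S hS0 hS => by
      obtain ⟨_, ⟨k, rfl⟩, hk⟩ := exists_lt_of_lt_csSup (range_nonempty T) hS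
      exact hmono _ _ _ hS0 hk.le (hPX k)
    obtain ⟨T', z, hT', hyz, hz⟩ := hext τ y ((hTpos 0).trans (hlt 0)) hy
    set S := min T' (τ + 1 / 2) with hS
    have hSτ : τ < S := lt_min hT' (by linarith)
    have hPS : P S z := hmono _ _ _ (((hTpos 0).trans (hlt 0)).trans hSτ) (min_le_left _ _) hz
    have hS2 : S ≤ τ + 1 / 2 := min_le_right _ _
    obtain ⟨_, ⟨k, rfl⟩, hk⟩ := exists_lt_of_lt_csSup (range_nonempty T)
      (show τ - min (1 / 2) ((S - τ) / 2) < τ by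
        have : 0 < min (1 / 2) ((S - τ) / 2) := lt_min (by norm_num) (by linarith)
        linarith)
    have h1 : min (1 / 2) ((S - τ) / 2) ≤ 1 / 2 := min_le_left _ _
    have h2 : min (1 / 2) ((S - τ) / 2) ≤ (S - τ) / 2 := min_le_right _ _
    have h3 : (T k + S) / 2 ≤ T (k + 1) := by
      have := hn3 (s k) S z (by change S ≤ T k + 1; linarith) ?_ hPS
      · rw [← hs] at this; exact this
      · intro t ht
        have ht' : t ∈ Icc 0 (T k) := ht
        change x k t = z t
        rw [← hX k ht', hXy ⟨ht'.1, ht'.2.trans_lt (hlt k)⟩]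
        exact hyz ⟨ht'.1, ht'.2.trans (hle k)⟩
    have := hlt (k + 1)
    linarith
  · refine ⟨X, fun S hS => ?_⟩
    obtain ⟨_, ⟨k, rfl⟩, hk⟩ := not_bddAbove_iff.1 hb S
    exact hmono _ _ _ hS hk.le (hPX k)

/-! ### The interaction kernel, continued beyond distance one. -/

section Kernel

variable {n N : ℕ}

/-- Uniform bounds for a coupling: `c ≤ φ ≤ C` and Lipschitz constant `L` on `[0, 1]`. -/
structure CouplingBounds (φ : Fin N → Fin N → ℝ → ℝ) (c C L : ℝ) : Prop where
  symm : ∀ i j, ∀ r ∈ Icc (0 : ℝ) 1, φ i j r = φ j i r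
  pos : 0 < c
  lower : ∀ i j, ∀ r ∈ Icc (0 : ℝ) 1, c ≤ φ i j r
  upper : ∀ i j, ∀ r ∈ Icc (0 : ℝ) 1, φ i j r ≤ C
  one_le : 1 ≤ C
  lip_nonneg : 0 ≤ L
  lip : ∀ i j, ∀ r ∈ Icc (0 : ℝ) 1, ∀ s ∈ Icc (0 : ℝ) 1, |φ i j r - φ i j s| ≤ L * |r - s|

theorem IsCoupling.exists_bounds {φ : Fin N → Fin N → ℝ → ℝ} (h : IsCoupling φ) :
    ∃ c C L, CouplingBounds φ c C L := by
  have hne : (Icc (0 : ℝ) 1).Nonempty := ⟨0, by simp⟩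
  have hcont : ∀ i j, ContinuousOn (φ i j) (Icc 0 1) := fun i j => by
    obtain ⟨K, hK⟩ := h.lipschitz i j
    exact hK.continuousOn
  choose rm hrm hrm' using fun i j => isCompact_Icc.exists_isMinOn hne (hcont i j)
  choose rM hrM hrM' using fun i j => isCompact_Icc.exists_isMaxOn hne (hcont i j)
  choose K hK using h.lipschitz
  obtain ⟨a, ha⟩ := (finite_range fun p : Fin N × Fin N => (φ p.1 p.2 (rm p.1 p.2))⁻¹).bddAbove
  obtain ⟨b, hb⟩ := (finite_range fun p : Fin N × Fin N => φ p.1 p.2 (rM p.1 p.2)).bddAbove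
  obtain ⟨l, hl⟩ := (finite_range fun p : Fin N × Fin N => (K p.1 p.2 : ℝ)).bddAbove
  refine ⟨(max a 1)⁻¹, max b 1, max l 0, h.symm, by positivity, ?_, ?_, le_max_right _ _,
    le_max_right _ _, ?_⟩
  · intro i j r hr
    have h1 : (φ i j (rm i j))⁻¹ ≤ max a 1 := (ha ⟨(i, j), rfl⟩).trans (le_max_left _ _)
    have h2 := h.pos i j _ (hrm i j)
    exact (inv_le_of_inv_le₀ h2 h1).trans (hrm' i j hr)
  · intro i j r hr
    exact (hrM' i j hr).trans ((hb ⟨(i, j), rfl⟩).trans (le_max_left _ _))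
  · intro i j r hr s hs
    have := (hK i j).dist_le_mul r hr s hs
    rw [Real.dist_eq, Real.dist_eq] at this
    refine this.trans (mul_le_mul_of_nonneg_right ?_ (abs_nonneg _))
    exact (hl ⟨(i, j), rfl⟩).trans (le_max_left _ _)

theorem isCoupling_unitCoupling : IsCoupling (unitCoupling N) :=
  ⟨fun _ _ _ _ => rfl, fun _ _ _ _ => one_pos, fun _ _ => ⟨0, by
    simp [unitCoupling, LipschitzOnWith]⟩⟩

/-- The coefficient of the bounded interaction kernel. -/
noncomputable def kernelCoeff (φ : Fin N → Fin N → ℝ → ℝ) (i j : Fin N) (r : ℝ) : ℝ :=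
  φ i j (min r 1) / max 1 r

/-- The interaction `φ_ij(‖D‖) D`, continued beyond distance `1` as a bounded Lipschitz map. -/
noncomputable def kernel (φ : Fin N → Fin N → ℝ → ℝ) (i j : Fin N)
    (D : EuclideanSpace ℝ (Fin n)) : EuclideanSpace ℝ (Fin n) :=
  kernelCoeff φ i j ‖D‖ • D

/-- The field with interactions weighted by `θ`. -/
noncomputable def weightedField (φ : Fin N → Fin N → ℝ → ℝ) (θ : Fin N → Fin N → ℝ → ℝ)
    (x : Config n N) : Config n N :=
  fun i => ∑ j, θ i j ‖x i - x j‖ • kernel φ i j (x j - x i)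

/-- Indicator of `[0, 1]`. -/
noncomputable def closedIndicator (r : ℝ) : ℝ := if r ≤ 1 then 1 else 0

/-- Indicator of `[0, 1)`. -/
noncomputable def openIndicator (r : ℝ) : ℝ := if r < 1 then 1 else 0

variable {φ : Fin N → Fin N → ℝ → ℝ} {c C L : ℝ}

theorem kernel_of_norm_le_one {i j : Fin N} {D : EuclideanSpace ℝ (Fin n)} (h : ‖D‖ ≤ 1) :
    kernel φ i j D = φ i j ‖D‖ • D := by
  simp [kernel, kernelCoeff, min_eq_left h, max_eq_left h]

/-- All discontinuity is now in the scalar weight. The continuation of the kernel does not matter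
here, because the weight vanishes beyond distance one. -/
theorem hkClosed_eq_weightedField :
    hkClosed n φ = weightedField φ (fun _ _ => closedIndicator) := by
  funext x i
  simp only [hkClosed, hkField, weightedField, closedCutoff, closedIndicator]
  refine Finset.sum_congr rfl fun j _ => ?_
  split_ifs with h
  · rw [kernel_of_norm_le_one (by rwa [norm_sub_rev]), one_smul, norm_sub_rev]
  · simp

theorem hkOpen_eq_weightedField :
    hkOpen n φ = weightedField φ (fun _ _ => openIndicator) := by
  funext x i
  simp only [hkOpen, hkField, weightedField, openCutoff, openIndicator]
  refine Finset.sum_congr rfl fun j _ => ?_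
  split_ifs with h
  · rw [kernel_of_norm_le_one (by rw [norm_sub_rev]; exact h.le), one_smul, norm_sub_rev]
  · simp

theorem kernel_neg (i j : Fin N) (D : EuclideanSpace ℝ (Fin n)) :
    kernel φ i j (-D) = -kernel φ i j D := by simp [kernel]

theorem min_norm_mem (D : EuclideanSpace ℝ (Fin n)) : min ‖D‖ 1 ∈ Icc (0 : ℝ) 1 :=
  ⟨le_min (norm_nonneg _) zero_le_one, min_le_right _ _⟩

namespace CouplingBounds

variable (hb : CouplingBounds φ c C L)
include hb

theorem C_pos : 0 < C := zero_lt_one.trans_le hb.one_le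

theorem kernelCoeff_symm (i j : Fin N) (D : EuclideanSpace ℝ (Fin n)) :
    kernelCoeff φ i j ‖D‖ = kernelCoeff φ j i ‖D‖ := by
  rw [kernelCoeff, kernelCoeff, hb.symm i j _ (min_norm_mem D)]

theorem kernel_symm (i j : Fin N) (D : EuclideanSpace ℝ (Fin n)) :
    kernel φ i j D = kernel φ j i D := by
  rw [kernel, kernel, hb.kernelCoeff_symm]

theorem kernelCoeff_pos (i j : Fin N) (D : EuclideanSpace ℝ (Fin n)) :
    0 < kernelCoeff φ i j ‖D‖ :=
  div_pos (hb.pos.trans_le (hb.lower i j _ (min_norm_mem D))) (by positivity)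

theorem kernelCoeff_le (i j : Fin N) (D : EuclideanSpace ℝ (Fin n)) :
    kernelCoeff φ i j ‖D‖ ≤ C :=
  (div_le_self (hb.pos.le.trans (hb.lower i j _ (min_norm_mem D))) (le_max_left _ _)).trans
    (hb.upper i j _ (min_norm_mem D))

theorem le_kernelCoeff (i j : Fin N) {D : EuclideanSpace ℝ (Fin n)} (h : ‖D‖ ≤ 1) :
    c ≤ kernelCoeff φ i j ‖D‖ := by
  rw [kernelCoeff, max_eq_left h, div_one]; exact hb.lower i j _ (min_norm_mem D)

theorem norm_kernel_le (i j : Fin N) (D : EuclideanSpace ℝ (Fin n)) : ‖kernel φ i j D‖ ≤ C := by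
  have h := hb.kernelCoeff_pos i j D
  rw [kernel, norm_smul, Real.norm_of_nonneg h.le, kernelCoeff, div_mul_eq_mul_div]
  rw [div_le_iff₀ (by positivity)]
  refine mul_le_mul (hb.upper i j _ (min_norm_mem D)) (le_max_right _ _) (norm_nonneg _) hb.C_pos.le

/-- The difference splits into the change of `D`, of the normalisation `max 1 ‖D‖` and of `φ`; these
contribute `C`, `C` and `L`. -/
theorem kernel_lipschitz (i j : Fin N) (D D' : EuclideanSpace ℝ (Fin n)) :
    ‖kernel φ i j D - kernel φ i j D'‖ ≤ (2 * C + L) * ‖D - D'‖ := by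
  set a := φ i j (min ‖D‖ 1)
  set a' := φ i j (min ‖D'‖ 1)
  set m := max 1 ‖D‖
  set m' := max 1 ‖D'‖
  have hm : 1 ≤ m := le_max_left _ _
  have hm' : 1 ≤ m' := le_max_left _ _
  have ha0 : 0 ≤ a := hb.pos.le.trans (hb.lower i j _ (min_norm_mem D))
  have haC : a ≤ C := hb.upper i j _ (min_norm_mem D)
  have hnn : |‖D‖ - ‖D'‖| ≤ ‖D - D'‖ := abs_norm_sub_norm_le _ _
  have haa : |a - a'| ≤ L * ‖D - D'‖ := by
    refine (hb.lip i j _ (min_norm_mem D) _ (min_norm_mem D')).trans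
      (mul_le_mul_of_nonneg_left ?_ hb.lip_nonneg)
    exact (abs_min_sub_min_le_max ‖D‖ 1 ‖D'‖ 1).trans (by simpa using hnn)
  have hmm : |m' - m| ≤ ‖D - D'‖ := by
    rw [abs_sub_comm]
    exact (abs_max_sub_max_le_max 1 ‖D‖ 1 ‖D'‖).trans (by simpa using hnn)
  have hD' : ‖D'‖ ≤ m' := le_max_right _ _
  have hdec : kernel φ i j D - kernel φ i j D' =
      (a / m) • (D - D') + (a * ((m' - m) / (m * m'))) • D' + ((a - a') / m') • D' := by
    simp only [kernel, kernelCoeff]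
    change (a / m) • D - (a' / m') • D' = _
    have : a' / m' = a / m - a * ((m' - m) / (m * m')) - (a - a') / m' := by
      field_simp; ring
    rw [this]; module
  have t1 : ‖(a / m) • (D - D')‖ ≤ C * ‖D - D'‖ := by
    rw [norm_smul, Real.norm_of_nonneg (by positivity)]
    exact mul_le_mul_of_nonneg_right ((div_le_self ha0 hm).trans haC) (norm_nonneg _)
  have t2 : ‖(a * ((m' - m) / (m * m'))) • D'‖ ≤ C * ‖D - D'‖ := by
    rw [norm_smul, norm_mul, norm_div, Real.norm_of_nonneg ha0, Real.norm_eq_abs,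
      Real.norm_of_nonneg (by positivity), mul_assoc]
    refine mul_le_mul haC ?_ (by positivity) hb.C_pos.le
    rw [div_mul_eq_mul_div, div_le_iff₀ (by positivity)]
    have h1 : m' ≤ m * m' := le_mul_of_one_le_left (by positivity) hm
    exact mul_le_mul hmm (hD'.trans h1) (norm_nonneg _) (norm_nonneg _)
  have t3 : ‖((a - a') / m') • D'‖ ≤ L * ‖D - D'‖ := by
    rw [norm_smul, norm_div, Real.norm_eq_abs, Real.norm_of_nonneg (by positivity : 0 ≤ m'),
      div_mul_eq_mul_div, div_le_iff₀ (by positivity)]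
    exact mul_le_mul haa hD' (norm_nonneg _) (mul_nonneg hb.lip_nonneg (norm_nonneg _))
  rw [hdec]
  refine (norm_add₃_le).trans ?_
  linarith

theorem norm_weightedField_le {θ : Fin N → Fin N → ℝ → ℝ} (hθ : ∀ i j r, |θ i j r| ≤ 1)
    (x : Config n N) : ‖weightedField φ θ x‖ ≤ N * C := by
  refine (pi_norm_le_iff_of_nonneg (mul_nonneg (Nat.cast_nonneg _) hb.C_pos.le)).2 fun i => ?_
  refine (norm_sum_le_of_le (f := fun j => θ i j ‖x i - x j‖ • kernel φ i j (x j - x i))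
    Finset.univ (n := fun _ => C) fun j _ => ?_).trans (by simp)
  rw [norm_smul]
  calc |θ i j ‖x i - x j‖| * ‖kernel φ i j (x j - x i)‖ ≤ 1 * C :=
        mul_le_mul (hθ _ _ _) (hb.norm_kernel_le _ _ _) (norm_nonneg _) zero_le_one
    _ = C := one_mul _

theorem weightedField_lipschitz {θ : Fin N → Fin N → ℝ → ℝ} (hθ : ∀ i j r, |θ i j r| ≤ 1)
    {l : ℝ} (hl : ∀ i j r s, |θ i j r - θ i j s| ≤ l * |r - s|) :
    ∃ K, LipschitzWith K (weightedField φ θ : Config n N → Config n N) := by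
  refine ⟨(N * ((2 * (2 * C + L)) + 2 * C * max l 0)).toNNReal, LipschitzWith.of_dist_le_mul
    fun x y => ?_⟩
  have hL := hb.lip_nonneg
  have hC := hb.C_pos
  rw [Real.coe_toNNReal _ (by positivity), dist_eq_norm, dist_eq_norm]
  refine (pi_norm_le_iff_of_nonneg (by positivity)).2 fun i => ?_
  have hterm : ∀ j, ‖θ i j ‖x i - x j‖ • kernel φ i j (x j - x i) -
      θ i j ‖y i - y j‖ • kernel φ i j (y j - y i)‖ ≤
      ((2 * (2 * C + L)) + 2 * C * max l 0) * ‖x - y‖ := by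
    intro j
    have hxy : ‖(x j - x i) - (y j - y i)‖ ≤ 2 * ‖x - y‖ := by
      have h1 : ‖x j - y j‖ ≤ ‖x - y‖ := norm_le_pi_norm (x - y) j
      have h2 : ‖x i - y i‖ ≤ ‖x - y‖ := norm_le_pi_norm (x - y) i
      calc ‖(x j - x i) - (y j - y i)‖ = ‖(x j - y j) - (x i - y i)‖ := by congr 1; abel
        _ ≤ _ := norm_sub_le _ _
        _ ≤ _ := by linarith
    have hdec : θ i j ‖x i - x j‖ • kernel φ i j (x j - x i) -
        θ i j ‖y i - y j‖ • kernel φ i j (y j - y i) =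
        θ i j ‖x i - x j‖ • (kernel φ i j (x j - x i) - kernel φ i j (y j - y i)) +
        (θ i j ‖x i - x j‖ - θ i j ‖y i - y j‖) • kernel φ i j (y j - y i) := by module
    rw [hdec]
    refine (norm_add_le _ _).trans ?_
    rw [norm_smul, norm_smul, Real.norm_eq_abs, Real.norm_eq_abs]
    have t1 : |θ i j ‖x i - x j‖| * ‖kernel φ i j (x j - x i) - kernel φ i j (y j - y i)‖ ≤
        1 * ((2 * C + L) * (2 * ‖x - y‖)) :=
      mul_le_mul (hθ _ _ _) ((hb.kernel_lipschitz _ _ _ _).trans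
        (mul_le_mul_of_nonneg_left hxy (by positivity))) (norm_nonneg _) zero_le_one
    have t2 : |θ i j ‖x i - x j‖ - θ i j ‖y i - y j‖| * ‖kernel φ i j (y j - y i)‖ ≤
        (max l 0 * (2 * ‖x - y‖)) * C := by
      refine mul_le_mul ?_ (hb.norm_kernel_le _ _ _) (norm_nonneg _) (by positivity)
      refine (hl _ _ _ _).trans ?_
      refine mul_le_mul (le_max_left _ _) ?_ (abs_nonneg _) (le_max_right _ _)
      refine (abs_norm_sub_norm_le _ _).trans ?_
      rw [← norm_neg]
      refine le_trans (le_of_eq ?_) hxy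
      congr 1; abel
    nlinarith
  have : (weightedField φ θ x - weightedField φ θ y) i =
      ∑ j, (θ i j ‖x i - x j‖ • kernel φ i j (x j - x i) -
      θ i j ‖y i - y j‖ • kernel φ i j (y j - y i)) := by
    simp [weightedField, Finset.sum_sub_distrib]
  rw [this]
  refine (norm_sum_le_of_le Finset.univ fun j _ => hterm j).trans (le_of_eq ?_)
  simp; ring

end CouplingBounds

theorem abs_closedIndicator_le (r : ℝ) : |closedIndicator r| ≤ 1 := by
  unfold closedIndicator; split_ifs <;> simp

theorem CouplingBounds.norm_hkClosed_le (hb : CouplingBounds φ c C L) (x : Config n N) :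
    ‖hkClosed n φ x‖ ≤ N * C := by
  rw [hkClosed_eq_weightedField]
  exact hb.norm_weightedField_le (fun _ _ => abs_closedIndicator_le) x

end Kernel

/-! ### The Euclidean scalar product of configurations and the antisymmetry of the forces. -/

section Inner

variable {n N : ℕ}

/-- The Euclidean scalar product of configurations. -/
noncomputable def ip (x y : Config n N) : ℝ := ∑ i, inner ℝ (x i) (y i)

theorem ip_comm (x y : Config n N) : ip x y = ip y x :=
  Finset.sum_congr rfl fun _ _ => real_inner_comm _ _

theorem ip_add_left (x y z : Config n N) : ip (x + y) z = ip x z + ip y z := by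
  simp [ip, inner_add_left, Finset.sum_add_distrib]

theorem ip_smul_left (a : ℝ) (x z : Config n N) : ip (a • x) z = a * ip x z := by
  simp [ip, real_inner_smul_left, Finset.mul_sum]

theorem ip_sub_left (x y z : Config n N) : ip (x - y) z = ip x z - ip y z := by
  simp [ip, inner_sub_left, Finset.sum_sub_distrib]

theorem ip_add_right (x y z : Config n N) : ip x (y + z) = ip x y + ip x z := by
  simp [ip, inner_add_right, Finset.sum_add_distrib]

theorem ip_sub_right (x y z : Config n N) : ip x (y - z) = ip x y - ip x z := by
  simp [ip, inner_sub_right, Finset.sum_sub_distrib]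

theorem ip_self_nonneg (x : Config n N) : 0 ≤ ip x x :=
  Finset.sum_nonneg fun _ _ => real_inner_self_nonneg

/-- The norm of `Config` is the maximum over the agents; with `ip_le_sq_norm` this transfers
estimates between it and `ip`. -/
theorem sq_norm_le_ip (x : Config n N) : ‖x‖ ^ 2 ≤ ip x x := by
  have : ‖x‖ ≤ √(ip x x) := by
    refine (pi_norm_le_iff_of_nonneg (Real.sqrt_nonneg _)).2 fun i => ?_
    apply Real.le_sqrt_of_sq_le
    rw [← real_inner_self_eq_norm_sq]
    exact Finset.single_le_sum (f := fun i => inner ℝ (x i) (x i))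
      (fun _ _ => real_inner_self_nonneg) (Finset.mem_univ i)
  calc ‖x‖ ^ 2 ≤ √(ip x x) ^ 2 := by gcongr
    _ = _ := Real.sq_sqrt (ip_self_nonneg x)

theorem ip_le_sq_norm (x : Config n N) : ip x x ≤ N * ‖x‖ ^ 2 := by
  refine (Finset.sum_le_card_nsmul _ _ (‖x‖ ^ 2) fun i _ => ?_).trans (by simp)
  rw [real_inner_self_eq_norm_sq]
  gcongr; exact norm_le_pi_norm x i

theorem abs_ip_le (x y : Config n N) : |ip x y| ≤ N * (‖x‖ * ‖y‖) := by
  refine (Finset.abs_sum_le_sum_abs _ _).trans ?_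
  refine (Finset.sum_le_card_nsmul _ _ (‖x‖ * ‖y‖) fun i _ => ?_).trans (by simp)
  exact (abs_real_inner_le_norm _ _).trans
    (mul_le_mul (norm_le_pi_norm x i) (norm_le_pi_norm y i) (norm_nonneg _) (norm_nonneg _))

/-- `ip · z` as a continuous linear functional. -/
noncomputable def ipL (z : Config n N) : Config n N →L[ℝ] ℝ :=
  ∑ i, (innerSL ℝ (z i)).comp (ContinuousLinearMap.proj i)

@[simp] theorem ipL_apply (z v : Config n N) : ipL z v = ip v z := by
  simp [ipL, ip, real_inner_comm]

theorem hasDerivAt_ip {x y : ℝ → Config n N} {x' y' : Config n N} {t : ℝ}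
    (hx : HasDerivAt x x' t) (hy : HasDerivAt y y' t) :
    HasDerivAt (fun s => ip (x s) (y s)) (ip (x t) y' + ip x' (y t)) t := by
  have := HasDerivAt.fun_sum (u := Finset.univ) fun i _ =>
    HasDerivAt.inner ℝ (hasDerivAt_pi.1 hx i) (hasDerivAt_pi.1 hy i)
  refine this.congr_deriv ?_
  simp [ip, Finset.sum_add_distrib]

theorem hasDerivWithinAt_ip {x y : ℝ → Config n N} {x' y' : Config n N} {t : ℝ} {s : Set ℝ}
    (hx : HasDerivWithinAt x x' s t) (hy : HasDerivWithinAt y y' s t) :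
    HasDerivWithinAt (fun s => ip (x s) (y s)) (ip (x t) y' + ip x' (y t)) s t := by
  have := HasDerivWithinAt.fun_sum (u := Finset.univ) fun i _ =>
    HasDerivWithinAt.inner ℝ (hasDerivWithinAt_pi.1 hx i) (hasDerivWithinAt_pi.1 hy i)
  refine this.congr_deriv ?_
  simp [ip, Finset.sum_add_distrib]

theorem contDiff_ip_self : ContDiff ℝ 1 fun x : Config n N => ip x x := by
  refine ContDiff.sum fun i _ => ContDiff.inner ℝ ?_ ?_ <;> exact contDiff_apply ℝ _ i

/-- Exchanging `i` and `j` in the double sum replaces `z i` by half the difference `z i - z j`. All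
energy identities below therefore involve relative positions only. -/
theorem ip_sum_of_antisymm (A : Fin N → Fin N → EuclideanSpace ℝ (Fin n))
    (hA : ∀ i j, A j i = -A i j) (z : Config n N) :
    ip (fun i => ∑ j, A i j) z = (1 / 2) * ∑ i, ∑ j, inner ℝ (A i j) (z i - z j) := by
  have h1 : ip (fun i => ∑ j, A i j) z = ∑ i, ∑ j, inner ℝ (A i j) (z i) := by
    simp [ip, sum_inner]
  have h2 : ∑ i, ∑ j, inner ℝ (A i j) (z i) = -∑ i, ∑ j, inner ℝ (A i j) (z j) := by
    rw [Finset.sum_comm, ← Finset.sum_neg_distrib]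
    refine Finset.sum_congr rfl fun i _ => ?_
    rw [← Finset.sum_neg_distrib]
    refine Finset.sum_congr rfl fun j _ => ?_
    rw [hA i j, inner_neg_left]
  have h3 : ∑ i, ∑ j, inner ℝ (A i j) (z i - z j) =
      ∑ i, ∑ j, inner ℝ (A i j) (z i) - ∑ i, ∑ j, inner ℝ (A i j) (z j) := by
    simp [inner_sub_right, Finset.sum_sub_distrib]
  rw [h1, h3]; linarith

variable {φ : Fin N → Fin N → ℝ → ℝ} {c C L : ℝ}

theorem CouplingBounds.ip_weightedField (hb : CouplingBounds φ c C L)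
    {θ : Fin N → Fin N → ℝ → ℝ} (hθ : ∀ i j r, θ i j r = θ j i r) (x z : Config n N) :
    ip (weightedField φ θ x) z = -(1 / 2) * ∑ i, ∑ j,
      θ i j ‖x i - x j‖ * inner ℝ (kernel φ i j (x i - x j)) (z i - z j) := by
  have h := ip_sum_of_antisymm (fun i j => θ i j ‖x i - x j‖ • kernel φ i j (x j - x i))
    (fun i j => by
      rw [hθ j i, norm_sub_rev, ← neg_sub (x j) (x i), kernel_neg, hb.kernel_symm j i, smul_neg]) z
  refine h.trans ?_
  rw [neg_mul, ← mul_neg, ← Finset.sum_neg_distrib]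
  congr 1
  refine Finset.sum_congr rfl fun i _ => ?_
  rw [← Finset.sum_neg_distrib]
  refine Finset.sum_congr rfl fun j _ => ?_
  rw [← neg_sub (x i) (x j), kernel_neg, real_inner_smul_left, inner_neg_left]; ring

/-- Testing `ip_weightedField` with all agents at the same `u` makes every difference vanish. -/
theorem CouplingBounds.sum_weightedField (hb : CouplingBounds φ c C L)
    {θ : Fin N → Fin N → ℝ → ℝ} (hθ : ∀ i j r, θ i j r = θ j i r) (x : Config n N) :
    ∑ i, weightedField φ θ x i = 0 := by
  refine ext_inner_right ℝ fun u => ?_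
  have h := hb.ip_weightedField hθ x (fun _ => u)
  simpa [ip, ← sum_inner] using h

end Inner
attribute [irreducible] ip

/-! ### Filippov and Krasovskii inclusions, and the other concepts as Krasovskii solutions. -/

section Inclusions

variable {E : Type*} [NormedAddCommGroup E] [NormedSpace ℝ E] {f g : E → E} {M T : ℝ}

theorem mem_krasovskiiMap (f : E → E) (x : E) : f x ∈ krasovskiiMap f x := by
  simp only [krasovskiiMap, mem_iInter]
  exact fun δ hδ => subset_closure (subset_convexHull ℝ _ ⟨x, Metric.mem_ball_self hδ, rfl⟩)

/-- A closed convex set absorbs the hull already at one small radius. Bounds on `f` pass to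
Krasovskii velocities in this way. -/
theorem krasovskiiMap_subset_of_eventually {x : E} {S : Set E} (hS : Convex ℝ S) (hS' : IsClosed S)
    (h : ∀ᶠ y in 𝓝 x, f y ∈ S) : krasovskiiMap f x ⊆ S := by
  obtain ⟨δ, hδ, hball⟩ := Metric.eventually_nhds_iff_ball.1 h
  intro v hv
  simp only [krasovskiiMap, mem_iInter] at hv
  refine closure_minimal (convexHull_min ?_ hS) hS' (hv δ hδ)
  rintro _ ⟨y, hy, rfl⟩
  exact hball y hy

theorem le_of_mem_krasovskiiMap {x v : E} (l : E →L[ℝ] ℝ) {c : ℝ}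
    (h : ∀ ε, 0 < ε → ∀ᶠ y in 𝓝 x, l (f y) ≤ c + ε) (hv : v ∈ krasovskiiMap f x) : l v ≤ c := by
  refine le_of_forall_pos_le_add fun ε hε => ?_
  exact krasovskiiMap_subset_of_eventually (S := {w | l w ≤ c + ε})
    (convex_halfSpace_le l.isLinear _) (isClosed_le l.continuous continuous_const) (h ε hε) hv

theorem norm_le_of_mem_krasovskiiMap (hM : ∀ y, ‖f y‖ ≤ M) {x v : E}
    (hv : v ∈ krasovskiiMap f x) : ‖v‖ ≤ M := by
  have := krasovskiiMap_subset_of_eventually (f := f) (x := x) (S := Metric.closedBall 0 M)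
    (convex_closedBall _ _) Metric.isClosed_closedBall (Eventually.of_forall fun y => by simpa using hM y)
  simpa using this hv

/-- If the values of `f` are limits of values of `f` on a set where `f = g`, then the Krasovskii
multifunction of `f` is contained in the one of `g`. -/
theorem krasovskiiMap_subset {G : Set E} (hfg : EqOn f g G)
    (h : ∀ y r, 0 < r → f y ∈ closure (f '' (Metric.ball y r ∩ G))) (x : E) :
    krasovskiiMap f x ⊆ krasovskiiMap g x := by
  simp only [krasovskiiMap]
  refine iInter₂_mono fun δ _ => closure_minimal (convexHull_min ?_ ?_) isClosed_closure
  · rintro _ ⟨y, hy, rfl⟩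
    obtain ⟨r, hr, hsub⟩ := Metric.isOpen_ball.mem_nhds hy |> Metric.mem_nhds_iff.1
    refine closure_mono ?_ (h y r hr)
    rw [(hfg.mono inter_subset_right).image_eq]
    exact (image_mono (inter_subset_left.trans hsub)).trans (subset_convexHull ℝ _)
  · exact (convex_convexHull ℝ _).closure

/-- Every value of `f` is a limit of values at continuity points. Near a continuity point the value
is almost attained on a whole neighbourhood, which no null set covers, so deleting null sets does
not shrink the closed hulls. -/
theorem filippovMap_eq_krasovskiiMap [MeasureSpace E] [(volume : Measure E).IsOpenPosMeasure]
    {G : Set E} (hG : ∀ z ∈ G, ContinuousAt f z)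
    (h : ∀ y r, 0 < r → f y ∈ closure (f '' (Metric.ball y r ∩ G))) :
    filippovMap f = krasovskiiMap f := by
  funext x
  simp only [filippovMap, krasovskiiMap]
  refine Subset.antisymm (iInter₂_mono fun δ _ => ?_) (iInter₂_mono fun δ _ => ?_)
  · exact (iInter₂_subset ∅ (by simp)).trans (by simp)
  · refine subset_iInter₂ fun Z hZ => closure_minimal (convexHull_min ?_ ?_) isClosed_closure
    · rintro _ ⟨y, hy, rfl⟩
      obtain ⟨r, hr, hsub⟩ := Metric.isOpen_ball.mem_nhds hy |> Metric.mem_nhds_iff.1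
      suffices h1 : f '' (Metric.ball y r ∩ G) ⊆ closure (f '' (Metric.ball x δ \ Z)) from
        closure_mono (subset_convexHull ℝ _) (closure_minimal h1 isClosed_closure (h y r hr))
      rintro _ ⟨z, ⟨hz, hzG⟩, rfl⟩
      rw [mem_closure_iff_nhds]
      intro U hU
      have h1 : f ⁻¹' U ∩ Metric.ball x δ ∈ 𝓝 z :=
        inter_mem (hG z hzG hU) (Metric.isOpen_ball.mem_nhds (hsub hz))
      have h2 : 0 < volume (f ⁻¹' U ∩ Metric.ball x δ) := Measure.measure_pos_of_mem_nhds _ h1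
      have h3 : ¬ (f ⁻¹' U ∩ Metric.ball x δ ⊆ Z) := fun hh => by
        have := measure_mono_null hh hZ
        rw [this] at h2; exact lt_irrefl _ h2
      obtain ⟨w, hw, hwZ⟩ := not_subset.1 h3
      exact ⟨f w, hw.1, w, ⟨hw.2, hwZ⟩, rfl⟩
    · exact (convex_convexHull ℝ _).closure

theorem IsCaratheodorySolution.isKrasovskiiSolution {x : ℝ → E}
    (h : IsCaratheodorySolution f T x) : IsKrasovskiiSolution f T x :=
  ⟨h.1, h.2.mono fun t ht => ⟨_, mem_krasovskiiMap f (x t), ht⟩⟩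

theorem IsKrasovskiiSolution.lipschitzOnWith {x : ℝ → E} (hT : 0 ≤ T) (hM : ∀ y, ‖f y‖ ≤ M)
    (h : IsKrasovskiiSolution f T x) : LipschitzOnWith M.toNNReal x (Icc 0 T) := by
  refine lipschitzOnWith_of_absolutelyContinuous ((norm_nonneg _).trans (hM 0)) h.1 hT ?_
  have := ae_restrict_Icc_iff.1 h.2
  filter_upwards [this] with t ht hmem
  obtain ⟨v, hv, hd⟩ := ht hmem
  exact ⟨v, norm_le_of_mem_krasovskiiMap hM hv, hd⟩

theorem isCaratheodorySolution_of_off_countable [CompleteSpace E] {x : ℝ → E} {s : Set ℝ}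
    (hs : s.Countable) (hT : 0 ≤ T)
    (hM : ∀ y, ‖f y‖ ≤ M) (hx : ContinuousOn x (Icc 0 T))
    (h : ∀ t ∈ Ioo 0 T \ s, HasDerivAt x (f (x t)) t) : IsCaratheodorySolution f T x := by
  refine ⟨?_, ?_⟩
  · refine LipschitzOnWith.absolutelyContinuousOnInterval (K := M.toNNReal) ?_
    rw [uIcc_of_le hT]
    exact lipschitzOnWith_of_hasDerivAt_off_countable hs hx (fun t ht => ⟨_, hM _, h t ht⟩)
      ((norm_nonneg _).trans (hM 0))
  · rw [ae_restrict_Icc_iff]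
    filter_upwards [hs.ae_notMem volume, ae_ne_real 0, ae_ne_real T] with t h1 h2 h3 h4
    exact h t ⟨⟨lt_of_le_of_ne h4.1 (Ne.symm h2), lt_of_le_of_ne h4.2 h3⟩, h1⟩

theorem IsClassicalSolution.continuousOn {x : ℝ → E} (h : IsClassicalSolution f T x) :
    ContinuousOn x (Icc 0 T) := fun t ht => (h t ht).continuousWithinAt

theorem IsClassicalSolution.isCaratheodorySolution [CompleteSpace E] {x : ℝ → E} (hT : 0 ≤ T)
    (hM : ∀ y, ‖f y‖ ≤ M) (h : IsClassicalSolution f T x) : IsCaratheodorySolution f T x :=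
  isCaratheodorySolution_of_off_countable countable_empty hT hM h.continuousOn fun t ht =>
    (h t (Ioo_subset_Icc_self ht.1)).hasDerivAt (Icc_mem_nhds ht.1.1 ht.1.2)

theorem exists_mem_Ico_of_partition {m : ℕ} {τ : Fin (m + 1) → ℝ} {a b t : ℝ} (h0 : τ 0 = a)
    (hl : τ (Fin.last m) = b) (ht : t ∈ Ico a b) :
    ∃ j : Fin m, t ∈ Ico (τ j.castSucc) (τ j.succ) := by
  by_contra! hcon
  have : ∀ j : Fin (m + 1), τ j ≤ t := by
    intro j
    induction j using Fin.induction with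
    | zero => rw [h0]; exact ht.1
    | succ j ih =>
      by_contra! h
      exact hcon j ⟨ih, h⟩
  exact absurd (this (Fin.last m)) (by rw [hl]; exact not_le.2 ht.2)

theorem IsStratifiedSolution.isCaratheodorySolution [CompleteSpace E] {S : Stratification f}
    {x : ℝ → E} (hT : 0 ≤ T) (hM : ∀ y, ‖f y‖ ≤ M) (h : IsStratifiedSolution S T x) :
    IsCaratheodorySolution f T x := by
  obtain ⟨hc, l, τ, cl, hτ, h0, hl, hp⟩ := h
  refine isCaratheodorySolution_of_off_countable (s := range τ) (countable_range τ) hT hM hc ?_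
  rintro t ⟨ht, hts⟩
  obtain ⟨k, hk⟩ := exists_mem_Ico_of_partition h0 hl (Ioo_subset_Ico_self ht)
  have hk' : t ∈ Ioo (τ k.castSucc) (τ k.succ) :=
    ⟨lt_of_le_of_ne hk.1 fun h => hts ⟨_, h⟩, hk.2⟩
  rcases (hp k).2 with ⟨-, h⟩ | ⟨-, -, h⟩
  · exact (h t hk).2.hasDerivAt (Ico_mem_nhds hk'.1 hk'.2)
  · exact (h t hk').2

/-! ### Sample-and-hold limits -/

theorem IsSampleAndHold.exists_right_deriv {h : ℝ} {y : ℝ → E} (hy : IsSampleAndHold f T h y)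
    {t : ℝ} (ht : t ∈ Ico 0 T) :
    ∃ s ∈ Icc 0 t, t - s ≤ h ∧ HasDerivWithinAt y (f (y s)) (Ici t) t := by
  obtain ⟨-, m, τ, hτ, h0, hl, hp⟩ := hy
  obtain ⟨j, hj⟩ := exists_mem_Ico_of_partition h0 hl ht
  refine ⟨τ j.castSucc, ⟨?_, hj.1⟩, ?_, ?_⟩
  · rw [← h0]; exact hτ.monotone (Fin.zero_le _)
  · have := (hp j).1; linarith [hj.2]
  · refine ((hp j).2 t hj).mono_of_mem_nhdsWithin ?_
    exact mem_of_superset (Ico_mem_nhdsGE hj.2) (Ico_subset_Ico_left hj.1)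

/-- A difference quotient is an average of velocities. A functional separating it from `S` would
contradict the scalar mean value inequality. -/
theorem smul_sub_mem_of_right_deriv_mem {S : Set E} (hS : Convex ℝ S) (hS' : IsClosed S)
    {y y' : ℝ → E} {a b : ℝ} (hab : a < b) (hy : ContinuousOn y (Icc a b))
    (hd : ∀ t ∈ Ico a b, HasDerivWithinAt y (y' t) (Ici t) t) (hmem : ∀ t ∈ Ico a b, y' t ∈ S) :
    (b - a)⁻¹ • (y b - y a) ∈ S := by
  by_contra hcon
  obtain ⟨l, u, hl, hu⟩ := geometric_hahn_banach_closed_point hS hS' hcon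
  have h1 := image_le_of_deriv_right_le_deriv_boundary (f := fun t => l (y t))
    (f' := fun t => l (y' t)) (B := fun t => l (y a) + u * (t - a)) (B' := fun _ => u) (a := a)
    (b := b) (l.continuous.comp_continuousOn hy)
    (fun t ht => l.hasFDerivAt.comp_hasDerivWithinAt t (hd t ht)) (by simp) (by fun_prop)
    (fun t _ => by
      have := (((hasDerivAt_id t).sub_const a).const_mul u).const_add (l (y a))
      simpa using this.hasDerivWithinAt)
    (fun t ht => (hl _ (hmem t ht)).le) (right_mem_Icc.2 hab.le)
  rw [map_smul, map_sub, smul_eq_mul, lt_inv_mul_iff₀ (sub_pos.2 hab)] at hu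
  linarith

theorem IsSampleAndHold.lipschitzOnWith {h : ℝ} {y : ℝ → E} (hM : ∀ y, ‖f y‖ ≤ M)
    (hy : IsSampleAndHold f T h y) : LipschitzOnWith M.toNNReal y (Icc 0 T) := by
  have key : ∀ u ∈ Icc 0 T, ∀ t ∈ Icc 0 T, u ≤ t → ‖y t - y u‖ ≤ M * (t - u) := by
    intro u hu t ht hut
    choose! s hs1 hs2 hs3 using fun r (hr : r ∈ Ico 0 T) => hy.exists_right_deriv hr
    refine norm_image_sub_le_of_norm_deriv_right_le_segment (f' := fun r => f (y (s r)))
      (hy.1.mono (Icc_subset_Icc hu.1 ht.2))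
      (fun r hr => hs3 r ⟨hu.1.trans hr.1, hr.2.trans_le ht.2⟩) (fun r _ => hM _) t ⟨hut, le_rfl⟩
  refine LipschitzOnWith.of_dist_le_mul fun u hu t ht => ?_
  rw [Real.coe_toNNReal _ ((norm_nonneg _).trans (hM 0)), dist_eq_norm, Real.dist_eq]
  rcases le_total u t with hst | hst
  · rw [norm_sub_rev, abs_sub_comm, abs_of_nonneg (sub_nonneg.2 hst)]; exact key u hu t ht hst
  · rw [abs_of_nonneg (sub_nonneg.2 hst)]; exact key t ht u hu hst

/-- Shortly after `t` the sample points of all late sample-and-hold curves lie in a given ball about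
`x t`, so their difference quotients lie in the closed hull of `f` on that ball. This survives the
limit of the curves and then the limit of the quotients. -/
theorem IsCLSSSolution.isKrasovskiiSolution [FiniteDimensional ℝ E] {x : ℝ → E} (hT : 0 ≤ T)
    (hM : ∀ y, ‖f y‖ ≤ M) (hx : IsCLSSSolution f T x) : IsKrasovskiiSolution f T x := by
  obtain ⟨hxc, h, y, hh, hy, hyx⟩ := hx
  have hpt : ∀ t ∈ Icc 0 T, Tendsto (fun k => y k t) atTop (𝓝 (x t)) := fun t ht =>
    hyx.tendsto_at ht
  have hlip : LipschitzOnWith M.toNNReal x (Icc 0 T) := by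
    refine LipschitzOnWith.of_dist_le_mul fun s hs t ht => ?_
    exact le_of_tendsto ((hpt s hs).dist (hpt t ht))
      (Eventually.of_forall fun k => ((hy k).2.lipschitzOnWith hM).dist_le_mul s hs t ht)
  refine ⟨LipschitzOnWith.absolutelyContinuousOnInterval (K := M.toNNReal)
    (by rwa [uIcc_of_le hT]), ?_⟩
  rw [ae_restrict_Icc_iff]
  filter_upwards [hlip.ae_differentiableWithinAt_of_mem_real, ae_ne_real 0, ae_ne_real T]
    with t h1 h2 h3 h4
  have h5 : t ∈ Ioo 0 T := ⟨lt_of_le_of_ne h4.1 (Ne.symm h2), lt_of_le_of_ne h4.2 h3⟩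
  have hder := ((h1 h4).differentiableAt (Icc_mem_nhds h5.1 h5.2)).hasDerivAt
  refine ⟨_, ?_, hder⟩
  simp only [krasovskiiMap, mem_iInter]
  intro δ hδ
  set S := closure (convexHull ℝ (f '' Metric.ball (x t) δ)) with hS
  have hSc : Convex ℝ S := (convex_convexHull ℝ _).closure
  have hcont : ContinuousWithinAt x (Icc 0 T) t := hxc t h4
  obtain ⟨η, hη, hη'⟩ := Metric.continuousWithinAt_iff.1 hcont (δ / 2) (by positivity)
  have hslope : ∀ᶠ s in 𝓝[>] t, (s - t)⁻¹ • (x s - x t) ∈ S := by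
    have : Ioo t (min T (t + η)) ∈ 𝓝[>] t := Ioo_mem_nhdsGT (lt_min h5.2 (by linarith))
    filter_upwards [this] with s hs
    have hsT : s < T := hs.2.trans_le (min_le_left _ _)
    have hsη : s < t + η := hs.2.trans_le (min_le_right _ _)
    refine isClosed_closure.mem_of_tendsto (((hpt s ⟨h5.1.le.trans hs.1.le, hsT.le⟩).sub
      (hpt t h4)).const_smul _) ?_
    have e1 : ∀ᶠ k in atTop, h k < min t η :=
      hh.eventually_lt_const (lt_min h5.1 hη)
    have e2 := Metric.tendstoUniformlyOn_iff.1 hyx (δ / 2) (by positivity)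
    filter_upwards [e1, e2] with k hk1 hk2
    choose! σ hs1 hs2 hs3 using fun r (hr : r ∈ Ico 0 T) => (hy k).2.exists_right_deriv hr
    have hI : ∀ r ∈ Ico t s, r ∈ Ico 0 T := fun r hr => ⟨h5.1.le.trans hr.1, hr.2.trans hsT⟩
    refine smul_sub_mem_of_right_deriv_mem hSc isClosed_closure (y' := fun r => f (y k (σ r))) hs.1
      ((hy k).2.1.mono (Icc_subset_Icc h4.1 hsT.le)) (fun r hr => hs3 r (hI r hr)) ?_
    intro r hr
    refine subset_closure (subset_convexHull ℝ _ ⟨_, ?_, rfl⟩)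
    have hσ := hs1 r (hI r hr)
    have hσ2 := hs2 r (hI r hr)
    have hσm : σ r ∈ Icc 0 T := ⟨hσ.1, hσ.2.trans (hI r hr).2.le⟩
    have d1 := hk2 (σ r) hσm
    have d2 : dist (x (σ r)) (x t) < δ / 2 := by
      apply hη' hσm
      rw [Real.dist_eq, abs_lt]
      have := hk1.trans_le (min_le_right _ _)
      constructor <;> linarith [hr.1, hr.2, hσ.2]
    rw [Metric.mem_ball]
    rw [dist_comm] at d1
    linarith [dist_triangle (y k (σ r)) (x (σ r)) (x t)]
  have hlim : Tendsto (fun s => (s - t)⁻¹ • (x s - x t)) (𝓝[>] t) (𝓝 (deriv x t)) := by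
    have := hasDerivAt_iff_tendsto_slope.1 hder
    exact (this.mono_left (nhdsWithin_mono _ fun s hs => ne_of_gt hs))
  exact isClosed_closure.mem_of_tendsto hlim hslope

end Inclusions

/-! ### Equality of the Filippov and Krasovskii multifunctions of both models. -/

section Regularity

variable {n N : ℕ} {φ : Fin N → Fin N → ℝ → ℝ} {c C L : ℝ}

/-- Configurations without agents at distance exactly `1`. -/
def regularSet (n N : ℕ) : Set (Config n N) := {z | ∀ i j, ‖z i - z j‖ ≠ 1}

theorem continuousAt_closedIndicator {r : ℝ} (hr : r ≠ 1) : ContinuousAt closedIndicator r := by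
  rcases lt_or_gt_of_ne hr with h | h
  · exact continuousAt_const.congr ((eventually_lt_nhds h).mono fun s hs => by
      simp [closedIndicator, le_of_lt hs] : (fun _ => (1 : ℝ)) =ᶠ[𝓝 r] closedIndicator)
  · exact continuousAt_const.congr ((eventually_gt_nhds h).mono fun s hs => by
      simp [closedIndicator, not_le.2 hs] : (fun _ => (0 : ℝ)) =ᶠ[𝓝 r] closedIndicator)

theorem openIndicator_eq_closedIndicator {r : ℝ} (hr : r ≠ 1) :
    openIndicator r = closedIndicator r := by
  simp [openIndicator, closedIndicator, hr.le_iff_lt]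

theorem eqOn_hkClosed_hkOpen : EqOn (hkClosed n φ) (hkOpen n φ) (regularSet n N) := by
  intro z hz
  rw [hkClosed_eq_weightedField, hkOpen_eq_weightedField]
  funext i
  refine Finset.sum_congr rfl fun j _ => ?_
  beta_reduce
  rw [openIndicator_eq_closedIndicator (hz i j)]

theorem isOpen_regularSet : IsOpen (regularSet n N) := by
  simp only [regularSet, ofPred_forall]
  refine isOpen_iInter_of_finite fun i => isOpen_iInter_of_finite fun j => ?_
  exact isOpen_ne_fun (by fun_prop) continuous_const

namespace CouplingBounds

variable (hb : CouplingBounds φ c C L)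
include hb

theorem continuous_kernel (i j : Fin N) :
    Continuous (kernel φ i j : EuclideanSpace ℝ (Fin n) → _) :=
  (LipschitzWith.of_dist_le_mul (K := (2 * C + L).toNNReal) fun x y => by
    rw [Real.coe_toNNReal _ (by linarith [hb.C_pos, hb.lip_nonneg]), dist_eq_norm, dist_eq_norm]
    exact hb.kernel_lipschitz i j x y).continuous

theorem continuousAt_hkClosed {z : Config n N} (hz : z ∈ regularSet n N) :
    ContinuousAt (hkClosed n φ) z := by
  rw [hkClosed_eq_weightedField]
  refine continuousAt_pi.2 fun i => ?_
  refine tendsto_finsetSum _ fun j _ => ?_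
  refine Tendsto.smul (f := fun x : Config n N => closedIndicator ‖x i - x j‖) ?_ ?_
  · exact ContinuousAt.comp (f := fun x : Config n N => ‖x i - x j‖)
      (continuousAt_closedIndicator (hz i j)) (by fun_prop)
  · exact ((hb.continuous_kernel i j).comp ((continuous_apply j).sub (continuous_apply i))).continuousAt

theorem continuousAt_hkOpen {z : Config n N} (hz : z ∈ regularSet n N) :
    ContinuousAt (hkOpen n φ) z :=
  (hb.continuousAt_hkClosed hz).congr
    (eqOn_hkClosed_hkOpen.eventuallyEq_of_mem (isOpen_regularSet.mem_nhds hz))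

/-- Along a scaling filter on which the weights are eventually constant the field converges. -/
theorem weightedField_mem_closure {θ : ℝ → ℝ} {l : Filter ℝ} [l.NeBot] (hl : l ≤ 𝓝 1)
    (h : ∀ r, 0 ≤ r → ∀ᶠ s in l, θ (s * r) = θ r ∧ s * r ≠ 1) (hl0 : ∀ᶠ s in l, 0 ≤ s)
    (y : Config n N) {r : ℝ} (hr : 0 < r) :
    weightedField φ (fun _ _ => θ) y ∈
      closure (weightedField φ (fun _ _ => θ) '' (Metric.ball y r ∩ regularSet n N)) := by
  have hs : Tendsto (fun s : ℝ => s • y) l (𝓝 y) := by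
    have : Continuous fun s : ℝ => s • y := by fun_prop
    have h1 := this.tendsto 1
    rw [one_smul] at h1
    exact h1.mono_left hl
  have hall : ∀ᶠ s in l, ∀ i j, θ (s * ‖y i - y j‖) = θ ‖y i - y j‖ ∧ s * ‖y i - y j‖ ≠ 1 :=
    eventually_all.2 fun i => eventually_all.2 fun j => h _ (norm_nonneg _)
  have hnorm : ∀ s : ℝ, 0 ≤ s → ∀ i j, ‖(s • y) i - (s • y) j‖ = s * ‖y i - y j‖ := by
    intro s hs i j
    simp only [Pi.smul_apply, ← smul_sub, norm_smul, Real.norm_of_nonneg hs]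
  refine mem_closure_of_tendsto (f := fun s : ℝ => weightedField φ (fun _ _ => θ) (s • y)) (b := l)
    ?_ ?_
  · have hcont : Continuous fun x : Config n N =>
        (fun i => ∑ j, θ ‖y i - y j‖ • kernel φ i j (x j - x i) : Config n N) := by
      refine continuous_pi fun i => continuous_finsetSum Finset.univ
        (f := fun j (x : Config n N) => θ ‖y i - y j‖ • kernel φ i j (x j - x i)) fun j _ => ?_
      exact ((hb.continuous_kernel i j).comp
        (by fun_prop : Continuous fun x : Config n N => x j - x i)).const_smul (θ ‖y i - y j‖)
    refine ((hcont.tendsto y).comp hs).congr' ?_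
    filter_upwards [hall, hl0] with s h1 h2
    funext i
    refine Finset.sum_congr rfl fun j _ => ?_
    beta_reduce
    rw [hnorm s h2, (h1 i j).1]
  · filter_upwards [hall, hl0, hs.eventually (Metric.ball_mem_nhds y hr)] with s h1 h2 h3
    exact ⟨_, ⟨h3, fun i j => by rw [hnorm s h2]; exact (h1 i j).2⟩, rfl⟩

/-- Scaling by `s ↑ 1` moves pairs at distance one inside, where the variant still links them; no
other pair changes side. -/
theorem hkClosed_mem_closure (y : Config n N) {r : ℝ} (hr : 0 < r) :
    hkClosed n φ y ∈ closure (hkClosed n φ '' (Metric.ball y r ∩ regularSet n N)) := by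
  rw [hkClosed_eq_weightedField]
  refine hb.weightedField_mem_closure (l := 𝓝[<] 1) nhdsWithin_le_nhds ?_ ?_ y hr
  · intro r hr
    rcases le_or_gt r 1 with h | h
    · filter_upwards [Ioo_mem_nhdsLT (zero_lt_one' ℝ)] with s hs
      have : s * r < 1 := by nlinarith [hs.1, hs.2]
      simp [closedIndicator, h, this.le, this.ne]
    · have : ∀ᶠ s in 𝓝[<] (1 : ℝ), 1 < s * r := by
        have h1 : Tendsto (fun s : ℝ => s * r) (𝓝[<] 1) (𝓝 (1 * r)) :=
          ((continuous_mul_const r).tendsto 1).mono_left nhdsWithin_le_nhds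
        rw [one_mul] at h1
        exact h1.eventually_const_lt h
      filter_upwards [this] with s hs
      simp [closedIndicator, not_le.2 h, not_le.2 hs, hs.ne']
  · filter_upwards [Ioo_mem_nhdsLT (zero_lt_one' ℝ)] with s hs using hs.1.le

/-- Scaling by `s ↓ 1` moves pairs at distance one outside, where they remain without interaction.
-/
theorem hkOpen_mem_closure (y : Config n N) {r : ℝ} (hr : 0 < r) :
    hkOpen n φ y ∈ closure (hkOpen n φ '' (Metric.ball y r ∩ regularSet n N)) := by
  rw [hkOpen_eq_weightedField]
  refine hb.weightedField_mem_closure (l := 𝓝[>] 1) nhdsWithin_le_nhds ?_ ?_ y hr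
  · intro r hr
    rcases lt_or_ge r 1 with h | h
    · have : ∀ᶠ s in 𝓝[>] (1 : ℝ), s * r < 1 := by
        have h1 : Tendsto (fun s : ℝ => s * r) (𝓝[>] 1) (𝓝 (1 * r)) :=
          ((continuous_mul_const r).tendsto 1).mono_left nhdsWithin_le_nhds
        rw [one_mul] at h1
        exact h1.eventually_lt_const h
      filter_upwards [this] with s hs
      simp [openIndicator, h, hs, hs.ne]
    · filter_upwards [self_mem_nhdsWithin] with s hs
      have hs' : (1 : ℝ) < s := hs
      have : 1 < s * r := by nlinarith
      simp [openIndicator, not_lt.2 h, not_lt.2 this.le, this.ne']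
  · filter_upwards [self_mem_nhdsWithin] with s hs using zero_le_one.trans (le_of_lt hs)

theorem filippovMap_hkClosed : filippovMap (hkClosed n φ) = krasovskiiMap (hkClosed n φ) :=
  filippovMap_eq_krasovskiiMap (fun _ => hb.continuousAt_hkClosed)
    fun y _ hr => hb.hkClosed_mem_closure y hr

theorem filippovMap_hkOpen : filippovMap (hkOpen n φ) = krasovskiiMap (hkOpen n φ) :=
  filippovMap_eq_krasovskiiMap (fun _ => hb.continuousAt_hkOpen)
    fun y _ hr => hb.hkOpen_mem_closure y hr

theorem krasovskiiMap_hkClosed_eq_hkOpen :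
    krasovskiiMap (hkClosed n φ) = krasovskiiMap (hkOpen n φ) := by
  funext x
  exact Subset.antisymm
    (krasovskiiMap_subset eqOn_hkClosed_hkOpen (fun y _ hr => hb.hkClosed_mem_closure y hr) x)
    (krasovskiiMap_subset eqOn_hkClosed_hkOpen.symm (fun y _ hr => hb.hkOpen_mem_closure y hr) x)

theorem isFilippovSolution_iff {T : ℝ} {x : ℝ → Config n N} :
    IsFilippovSolution (hkClosed n φ) T x ↔ IsKrasovskiiSolution (hkClosed n φ) T x := by
  rw [IsFilippovSolution, IsKrasovskiiSolution, hb.filippovMap_hkClosed]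

end CouplingBounds

end Regularity

/-! ### Conservation of the barycenter and convergence to clusters. -/

section Asymptotics

variable {n N : ℕ} {φ : Fin N → Fin N → ℝ → ℝ} {c C L : ℝ}

/-- The energy rate `ip (f z) z` is not a fixed functional of the velocity, since `z` varies too. As
`f` is bounded, replacing `z` by `y` costs a multiple of `‖y - z‖`, which vanishes in the limit. -/
theorem le_of_mem_krasovskiiMap_ip {f : Config n N → Config n N} {M : ℝ} (hM : ∀ y, ‖f y‖ ≤ M)
    {y v : Config n N} (l : Config n N →L[ℝ] ℝ) (a : ℝ) {b : Config n N → ℝ}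
    (hb : ContinuousAt b y) (h : ∀ᶠ z in 𝓝 y, l (f z) + a * ip (f z) z ≤ b z)
    (hv : v ∈ krasovskiiMap f y) : l v + a * ip v y ≤ b y := by
  have key : ∀ ε, 0 < ε → ∀ᶠ z in 𝓝 y, (l + a • ipL y) (f z) ≤ b y + ε := by
    intro ε hε
    have h1 : ∀ᶠ z in 𝓝 y, b z < b y + ε / 2 := hb.eventually_lt_const (by linarith)
    have h2 : ∀ᶠ z in 𝓝 y, |a| * (N * (M * ‖y - z‖)) < ε / 2 := by
      have hc : Continuous fun z : Config n N => |a| * (N * (M * ‖y - z‖)) := by fun_prop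
      refine hc.continuousAt.eventually_lt_const ?_
      simp only [sub_self, norm_zero, mul_zero]; positivity
    filter_upwards [h, h1, h2] with z hz h1 h2
    have h3 : |a * ip (f z) (y - z)| ≤ |a| * (N * (M * ‖y - z‖)) := by
      rw [abs_mul]
      refine mul_le_mul_of_nonneg_left ((abs_ip_le _ _).trans ?_) (abs_nonneg _)
      gcongr
      exact hM z
    have h4 : a * ip (f z) y = a * ip (f z) z + a * ip (f z) (y - z) := by
      rw [ip_sub_right]; ring
    have h5 := (abs_le.1 h3).2
    simp only [add_apply, smul_apply, ipL_apply,
      smul_eq_mul]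
    linarith
  simpa using le_of_mem_krasovskiiMap (l + a • ipL y) key hv

theorem IsKrasovskiiSolution.image_le {E : Type*} [NormedAddCommGroup E] [NormedSpace ℝ E]
    {f : E → E} {T : ℝ} {x : ℝ → E} (hx : IsKrasovskiiSolution f T x)
    {g : ℝ → ℝ} {s t : ℝ} (hs : 0 ≤ s) (hst : s ≤ t) (ht : t ≤ T)
    (hg : AbsolutelyContinuousOnInterval g s t)
    (h : ∀ r ∈ Icc s t, ∀ v ∈ krasovskiiMap f (x r), HasDerivAt x v r →
      ∃ d, d ≤ 0 ∧ HasDerivAt g d r) : g t ≤ g s := by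
  refine le_of_absolutelyContinuous_of_ae_deriv_nonpos hst hg ?_
  filter_upwards [ae_restrict_Icc_iff.1 hx.2] with r hr hmem
  obtain ⟨v, hv, hd⟩ := hr ⟨hs.trans hmem.1, hmem.2.trans ht⟩
  exact h r hmem v hv hd

/-- Sum of all agents. -/
noncomputable def sumL (s : Finset (Fin N)) : Config n N →L[ℝ] EuclideanSpace ℝ (Fin n) :=
  ∑ i ∈ s, ContinuousLinearMap.proj i

@[simp] theorem sumL_apply (s : Finset (Fin N)) (v : Config n N) : sumL s v = ∑ i ∈ s, v i := by
  simp [sumL]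

/-- The dissipation of the pair `i, j`. -/
theorem inner_kernel_self (i j : Fin N) (D : EuclideanSpace ℝ (Fin n)) :
    inner ℝ (kernel φ i j D) D = kernelCoeff φ i j ‖D‖ * ‖D‖ ^ 2 := by
  rw [kernel, real_inner_smul_left, real_inner_self_eq_norm_sq]

namespace CouplingBounds

variable (hb : CouplingBounds φ c C L)
include hb

theorem sum_krasovskiiMap {y v : Config n N} (hv : v ∈ krasovskiiMap (hkClosed n φ) y) :
    ∑ i, v i = 0 := by
  have := krasovskiiMap_subset_of_eventually (f := hkClosed n φ) (x := y)
    (S := {w | sumL Finset.univ w = 0}) ?_ ?_ (Eventually.of_forall fun z => ?_) hv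
  · simpa using this
  · exact (LinearMap.ker (sumL (n := n) (Finset.univ : Finset (Fin N))).toLinearMap).convex
  · exact isClosed_eq (sumL Finset.univ).continuous continuous_const
  · rw [mem_ofPred_eq, hkClosed_eq_weightedField, sumL_apply]
    exact hb.sum_weightedField (fun _ _ _ => rfl) z

theorem barycenterInvariant_krasovskii :
    BarycenterInvariant (IsKrasovskiiSolution (hkClosed n φ)) := by
  intro T x hT hx t ht
  have h1 : ‖sumL Finset.univ (x t) - sumL Finset.univ (x 0)‖ ≤ 0 * (t - 0) := by
    refine norm_sub_le_of_absolutelyContinuous (x := fun s => sumL Finset.univ (x s)) ht.1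
      (absolutelyContinuous_clm_comp (hx.1.mono ?_) _) ?_
    · rw [uIcc_of_le ht.1, uIcc_of_le hT.le]; exact Icc_subset_Icc_right ht.2
    · filter_upwards [ae_restrict_Icc_iff.1 hx.2] with r hr hmem
      obtain ⟨v, hv, hd⟩ := hr ⟨hmem.1, hmem.2.trans ht.2⟩
      refine ⟨sumL Finset.univ v, ?_, (sumL Finset.univ).hasFDerivAt.comp_hasDerivAt r hd⟩
      simp [hb.sum_krasovskiiMap hv]
  rw [zero_mul] at h1
  have h2 := sub_eq_zero.1 (norm_le_zero_iff.1 h1)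
  simp only [sumL_apply] at h2
  rw [barycenter, barycenter, h2]

theorem ip_hkClosed_self (z : Config n N) :
    ip (hkClosed n φ z) z = -(1 / 2) * ∑ i, ∑ j, closedIndicator ‖z i - z j‖ *
      (kernelCoeff φ i j ‖z i - z j‖ * ‖z i - z j‖ ^ 2) := by
  rw [hkClosed_eq_weightedField, hb.ip_weightedField (fun _ _ _ => rfl)]
  simp only [inner_kernel_self]

theorem dissipation_nonneg (z : Config n N) (i j : Fin N) :
    0 ≤ closedIndicator ‖z i - z j‖ *
      (kernelCoeff φ i j ‖z i - z j‖ * ‖z i - z j‖ ^ 2) := by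
  have := hb.kernelCoeff_pos i j (z i - z j)
  unfold closedIndicator
  split_ifs <;> positivity

theorem ip_hkClosed_self_nonpos (z : Config n N) : ip (hkClosed n φ z) z ≤ 0 := by
  rw [hb.ip_hkClosed_self]
  have := Finset.sum_nonneg fun i (_ : i ∈ Finset.univ) =>
    Finset.sum_nonneg fun j (_ : j ∈ Finset.univ) => hb.dissipation_nonneg z i j
  linarith

theorem ip_krasovskii_nonpos {y v : Config n N} (hv : v ∈ krasovskiiMap (hkClosed n φ) y) :
    ip v y ≤ 0 := by
  simpa using le_of_mem_krasovskiiMap_ip hb.norm_hkClosed_le (b := fun _ => 0) 0 1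
    continuousAt_const (Eventually.of_forall fun z => by
      simpa using hb.ip_hkClosed_self_nonpos z) hv

/-- Only the ordered pair `(i, j)` of the double sum is kept; near `y` it is linked, because the
inequality `hij` is strict. -/
theorem ip_krasovskii_le {y v : Config n N} (hv : v ∈ krasovskiiMap (hkClosed n φ) y)
    {i j : Fin N} (hij : ‖y i - y j‖ < 1) : ip v y ≤ -(1 / 2) * c * ‖y i - y j‖ ^ 2 := by
  have hc : Continuous fun z : Config n N => ‖z i - z j‖ := by fun_prop
  have := le_of_mem_krasovskiiMap_ip hb.norm_hkClosed_le
    (b := fun z => -(1 / 2) * c * ‖z i - z j‖ ^ 2) 0 1 (by fun_prop)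
    ((hc.continuousAt.eventually_lt_const hij).mono fun z hz => by
      have h1 := Finset.single_le_sum (f := fun p => ∑ q, closedIndicator ‖z p - z q‖ *
        (kernelCoeff φ p q ‖z p - z q‖ * ‖z p - z q‖ ^ 2)) (fun p _ =>
        Finset.sum_nonneg fun q _ => hb.dissipation_nonneg z p q) (Finset.mem_univ i)
      have h2 := Finset.single_le_sum (f := fun q => closedIndicator ‖z i - z q‖ *
        (kernelCoeff φ i q ‖z i - z q‖ * ‖z i - z q‖ ^ 2)) (fun q _ =>
        hb.dissipation_nonneg z i q) (Finset.mem_univ j)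
      have h3 := hb.le_kernelCoeff i j hz.le
      rw [closedIndicator, if_pos hz.le, one_mul] at h2
      have h4 : c * ‖z i - z j‖ ^ 2 ≤ kernelCoeff φ i j ‖z i - z j‖ * ‖z i - z j‖ ^ 2 := by gcongr
      simp only [zero_apply, zero_add, one_mul]
      rw [hb.ip_hkClosed_self]
      linarith) hv
  simpa only [zero_apply, zero_add, one_mul] using this

/-- Forces inside `s` cancel in pairs. Across the boundary of `s` distances exceed `1 / 2`, so `r ≤
2 * r ^ 2` and the force is at most twice the dissipation of the pair. The total dissipation over
ordered pairs is `-2` times the energy rate, whence the factor `4`. -/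
theorem norm_sum_hkClosed_le {z : Config n N} {s : Finset (Fin N)}
    (hs : ∀ i ∈ s, ∀ j ∉ s, 1 / 2 < ‖z i - z j‖) :
    ‖∑ i ∈ s, hkClosed n φ z i‖ ≤ -4 * ip (hkClosed n φ z) z := by
  classical
  set A : Fin N → Fin N → EuclideanSpace ℝ (Fin n) := fun i j =>
    closedIndicator ‖z i - z j‖ • kernel φ i j (z j - z i) with hA
  have hanti : ∀ i j, A j i = -A i j := fun i j => by
    simp only [hA]
    rw [norm_sub_rev, ← neg_sub (z j) (z i), kernel_neg, hb.kernel_symm j i, smul_neg]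
  have h0 : ∑ i ∈ s, ∑ j ∈ s, A i j = 0 := by
    have h1 : ∑ i ∈ s, ∑ j ∈ s, A i j = -∑ i ∈ s, ∑ j ∈ s, A i j := by
      conv_lhs => rw [Finset.sum_comm]
      rw [← Finset.sum_neg_distrib]
      refine Finset.sum_congr rfl fun i _ => ?_
      rw [← Finset.sum_neg_distrib]
      exact Finset.sum_congr rfl fun j _ => hanti i j
    have h2 : (2 : ℝ) • ∑ i ∈ s, ∑ j ∈ s, A i j = 0 := by
      rw [two_smul]
      nth_rewrite 2 [h1]
      simp
    simpa using h2
  have h1 : ∑ i ∈ s, hkClosed n φ z i = ∑ i ∈ s, ∑ j ∈ sᶜ, A i j := by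
    have : ∀ i, hkClosed n φ z i = ∑ j ∈ s, A i j + ∑ j ∈ sᶜ, A i j := fun i => by
      rw [hkClosed_eq_weightedField, Finset.sum_add_sum_compl]; rfl
    simp only [this, Finset.sum_add_distrib, h0, zero_add]
  have hterm : ∀ i ∈ s, ∀ j ∈ sᶜ, ‖A i j‖ ≤ 2 * (closedIndicator ‖z i - z j‖ *
      (kernelCoeff φ i j ‖z i - z j‖ * ‖z i - z j‖ ^ 2)) := by
    intro i hi j hj
    have hd := hs i hi j (by simpa using hj)
    have hk := hb.kernelCoeff_pos i j (z i - z j)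
    have hci : 0 ≤ closedIndicator ‖z i - z j‖ := by
      unfold closedIndicator; split_ifs <;> norm_num
    simp only [hA]
    rw [norm_smul, kernel, norm_smul, norm_sub_rev (z j) (z i), Real.norm_of_nonneg hci,
      Real.norm_of_nonneg hk.le]
    have : ‖z i - z j‖ ≤ 2 * ‖z i - z j‖ ^ 2 := by nlinarith
    calc closedIndicator ‖z i - z j‖ * (kernelCoeff φ i j ‖z i - z j‖ * ‖z i - z j‖)
        ≤ closedIndicator ‖z i - z j‖ * (kernelCoeff φ i j ‖z i - z j‖ * (2 * ‖z i - z j‖ ^ 2)) := by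
          gcongr
      _ = _ := by ring
  rw [h1, hb.ip_hkClosed_self]
  calc ‖∑ i ∈ s, ∑ j ∈ sᶜ, A i j‖ ≤ ∑ i ∈ s, ∑ j ∈ sᶜ, 2 * (closedIndicator ‖z i - z j‖ *
      (kernelCoeff φ i j ‖z i - z j‖ * ‖z i - z j‖ ^ 2)) :=
        norm_sum_le_of_le _ fun i hi => norm_sum_le_of_le _ fun j hj => hterm i hi j hj
    _ ≤ ∑ i, ∑ j, 2 * (closedIndicator ‖z i - z j‖ *
      (kernelCoeff φ i j ‖z i - z j‖ * ‖z i - z j‖ ^ 2)) := by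
        refine (Finset.sum_le_sum fun i _ => Finset.sum_le_univ_sum_of_nonneg fun j =>
          mul_nonneg zero_le_two (hb.dissipation_nonneg z i j)).trans ?_
        exact Finset.sum_le_univ_sum_of_nonneg fun i => Finset.sum_nonneg fun j _ =>
          mul_nonneg zero_le_two (hb.dissipation_nonneg z i j)
    _ = _ := by simp only [← Finset.mul_sum]; ring

theorem inner_sum_krasovskii_le {y v : Config n N} (hv : v ∈ krasovskiiMap (hkClosed n φ) y)
    {s : Finset (Fin N)} (hs : ∀ i ∈ s, ∀ j ∉ s, 1 / 2 < ‖y i - y j‖)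
    {u : EuclideanSpace ℝ (Fin n)} (hu : ‖u‖ ≤ 1) :
    inner ℝ u (∑ i ∈ s, v i) + 4 * ip v y ≤ 0 := by
  have hev : ∀ᶠ z in 𝓝 y, ∀ i ∈ s, ∀ j ∉ s, 1 / 2 < ‖z i - z j‖ := by
    refine eventually_all.2 fun i => ?_
    by_cases hi : i ∈ s
    · refine (eventually_all.2 fun j => ?_ : ∀ᶠ z in 𝓝 y, ∀ j, j ∉ s → 1 / 2 < ‖z i - z j‖).mono
        fun z hz _ => hz
      by_cases hj : j ∈ s
      · exact Eventually.of_forall fun z h => absurd hj h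
      · have hc : Continuous fun z : Config n N => ‖z i - z j‖ := by fun_prop
        exact (hc.continuousAt.eventually_const_lt (hs i hi j hj)).mono fun z hz _ => hz
    · exact Eventually.of_forall fun z h => absurd h hi
  have := le_of_mem_krasovskiiMap_ip hb.norm_hkClosed_le (b := fun _ => 0)
    ((innerSL ℝ u).comp (sumL s)) 4 continuousAt_const (hev.mono fun z hz => ?_) hv
  · simpa only [ContinuousLinearMap.comp_apply, sumL_apply, innerSL_apply_apply] using this
  · have h1 := hb.norm_sum_hkClosed_le hz
    have h2 : inner ℝ u (∑ i ∈ s, hkClosed n φ z i) ≤ ‖u‖ * ‖∑ i ∈ s, hkClosed n φ z i‖ :=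
      real_inner_le_norm _ _
    simp only [ContinuousLinearMap.comp_apply, sumL_apply, innerSL_apply_apply]
    nlinarith [norm_nonneg (∑ i ∈ s, hkClosed n φ z i)]

theorem antitone_energy {T : ℝ} {x : ℝ → Config n N}
    (hx : IsKrasovskiiSolution (hkClosed n φ) T x) {s t : ℝ} (hs : 0 ≤ s) (hst : s ≤ t)
    (ht : t ≤ T) {κ : ℝ} (hκ : ∀ r ∈ Icc s t, ∀ v ∈ krasovskiiMap (hkClosed n φ) (x r),
      ip v (x r) ≤ -κ) :
    ip (x t) (x t) + 2 * κ * (t - s) ≤ ip (x s) (x s) := by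
  have hlip := (hx.lipschitzOnWith (hs.trans (hst.trans ht)) hb.norm_hkClosed_le).mono
    (Icc_subset_Icc hs ht)
  have h2 : AbsolutelyContinuousOnInterval (fun r : ℝ => 2 * κ * (r - s)) s t :=
    ContDiffOn.absolutelyContinuousOnInterval (by fun_prop)
  have := hx.image_le hs hst ht (g := fun r => ip (x r) (x r) + 2 * κ * (r - s))
    ((absolutelyContinuous_comp_of_contDiff hst hlip contDiff_ip_self).add h2)
    (fun r hr v hv hd => ⟨_, ?_, (hasDerivAt_ip hd hd).add
      (((hasDerivAt_id r).sub_const s).const_mul (2 * κ))⟩)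
  · simpa using this
  · have := hκ r hr v hv
    rw [ip_comm (x r) v]; linarith

/-- The energy decreases to a limit, so distances cannot return again and again to values well
inside `(0, 1)`; each distance tends to 0 or is eventually above any number below 1. Tending to 0 is
an equivalence relation. The sum over a class moves by at most a multiple of the energy lost, so it
converges, and each member of the class converges to its mean. -/
theorem clustering_krasovskii : Clustering (IsKrasovskiiSolution (hkClosed n φ)) := by
  classical
  intro x hx
  set M : ℝ := N * C with hM
  have hM0 : 0 ≤ M := (norm_nonneg _).trans (hb.norm_hkClosed_le (0 : Config n N))
  have hlip : ∀ s t, 0 ≤ s → s ≤ t → ‖x t - x s‖ ≤ M * (t - s) := by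
    intro s t hs hst
    have hT : 0 < t + 1 := by linarith
    have := ((hx (t + 1) hT).lipschitzOnWith hT.le hb.norm_hkClosed_le).dist_le_mul t
      ⟨by linarith, by linarith⟩ s ⟨hs, by linarith⟩
    rwa [Real.coe_toNNReal _ hM0, dist_eq_norm, Real.dist_eq,
      abs_of_nonneg (sub_nonneg.2 hst)] at this
  have hcont : ContinuousOn x (Ici 0) := by
    intro t ht
    have hT : 0 < t + 1 := by linarith [mem_Ici.1 ht]
    have h1 := ((hx (t + 1) hT).lipschitzOnWith hT.le hb.norm_hkClosed_le).continuousOn t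
      ⟨ht, by linarith⟩
    refine h1.mono_of_mem_nhdsWithin ?_
    rw [← Ici_inter_Iic]
    exact inter_mem_nhdsWithin _ (Iic_mem_nhds (by linarith))
  set e : ℝ → ℝ := fun t => ip (x t) (x t) with he
  have hdec : ∀ s t κ, 0 ≤ s → s ≤ t → (∀ r ∈ Icc s t, ∀ v ∈ krasovskiiMap (hkClosed n φ) (x r),
      ip v (x r) ≤ -κ) → e t + 2 * κ * (t - s) ≤ e s := fun s t κ hs hst h =>
    hb.antitone_energy (hx (t + 1) (by linarith)) hs hst (by linarith) h
  have hanti : ∀ s t, 0 ≤ s → s ≤ t → e t ≤ e s := fun s t hs hst => by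
    simpa using hdec s t 0 hs hst fun r _ v hv => by simpa using hb.ip_krasovskii_nonpos hv
  -- the limit of the energy
  obtain ⟨e0, he0⟩ : ∃ e0, Tendsto e atTop (𝓝 e0) := by
    have hA : Antitone fun t => e (max t 0) := fun s t hst =>
      hanti _ _ (le_max_right _ _) (max_le_max_right _ hst)
    have hB : BddBelow (range fun t => e (max t 0)) := ⟨0, by
      rintro _ ⟨t, rfl⟩; exact ip_self_nonneg _⟩
    refine ⟨_, (tendsto_atTop_ciInf hA hB).congr' ?_⟩
    filter_upwards [eventually_ge_atTop 0] with t ht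
    rw [max_eq_left ht]
  have he0le : ∀ t, 0 ≤ t → e0 ≤ e t := fun t ht =>
    le_of_tendsto he0 ((eventually_ge_atTop t).mono fun s hs => hanti t s ht hs)
  set d : Fin N → Fin N → ℝ → ℝ := fun i j t => ‖x t i - x t j‖ with hd
  have hdlip : ∀ i j s t, 0 ≤ s → s ≤ t → |d i j t - d i j s| ≤ 2 * M * (t - s) := by
    intro i j s t hs hst
    have h1 := hlip s t hs hst
    have h2 : ‖x t i - x s i‖ ≤ ‖x t - x s‖ := norm_le_pi_norm (x t - x s) i
    have h3 : ‖x t j - x s j‖ ≤ ‖x t - x s‖ := norm_le_pi_norm (x t - x s) j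
    refine (abs_norm_sub_norm_le _ _).trans ?_
    calc ‖x t i - x t j - (x s i - x s j)‖ = ‖(x t i - x s i) - (x t j - x s j)‖ := by
          congr 1; abel
      _ ≤ _ := norm_sub_le _ _
      _ ≤ _ := by linarith
  -- intermediate distances cost energy
  have hgap : ∀ i j δ, 0 < δ → ∃ T0, 0 ≤ T0 ∧ ∀ t, T0 ≤ t → d i j t < δ ∨ 1 - δ < d i j t := by
    intro i j δ hδ
    -- During a time `τ` a distance changes by at most `2 * M * τ ≤ δ / 2`, so a distance in `[δ, 1
    -- - δ]` dissipates at rate at least `κ` all along.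
    set τ := δ / (4 * (M + 1)) with hτ
    have hτ0 : 0 < τ := by positivity
    have hMτ : 2 * M * τ ≤ δ / 2 := by
      rw [hτ, mul_div_assoc', div_le_div_iff₀ (by positivity) (by norm_num)]; nlinarith
    set κ := (1 / 2) * c * (δ / 2) ^ 2 with hκ
    have hκ0 : 0 < κ := by have := hb.pos; positivity
    have h1 : ∀ᶠ t in atTop, e t < e0 + 2 * κ * τ :=
      he0.eventually_lt_const (by have : 0 < κ * τ := by positivity
                                  linarith)
    obtain ⟨T0, hT0⟩ := (h1.and (eventually_ge_atTop 0)).exists_forall_of_atTop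
    refine ⟨T0, (hT0 T0 le_rfl).2, fun t ht => ?_⟩
    by_contra! hcon
    have ht0 := (hT0 t ht).2
    have h2 := hdec t (t + τ) κ ht0 (by linarith) ?_
    · have := (hT0 t ht).1
      have := he0le (t + τ) (by linarith)
      rw [add_sub_cancel_left] at h2
      linarith
    · intro r hr v hv
      have h3 := abs_le.1 (hdlip i j t r ht0 hr.1)
      have h4 : 2 * M * (r - t) ≤ 2 * M * τ := by
        have := hr.2; gcongr; linarith
      have h5 : δ / 2 ≤ ‖x r i - x r j‖ := by change δ / 2 ≤ d i j r; linarith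
      have h6 := hb.ip_krasovskii_le hv (i := i) (j := j) (by
        change d i j r < 1
        linarith)
      have h7 : (δ / 2) ^ 2 ≤ ‖x r i - x r j‖ ^ 2 := by gcongr
      have := hb.pos
      nlinarith
  have hdcont : ∀ i j, ContinuousOn (d i j) (Ici 0) := fun i j => by
    have hc : Continuous fun z : Config n N => ‖z i - z j‖ := by fun_prop
    exact hc.comp_continuousOn hcont
  have hdich : ∀ i j, Tendsto (d i j) atTop (𝓝 0) ∨
      ∀ δ, 0 < δ → ∀ᶠ t in atTop, 1 - δ < d i j t := by
    intro i j
    obtain ⟨T0, hT0, h0⟩ := hgap i j (1 / 4) (by norm_num)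
    -- A continuous distance that avoids `[1 / 4, 3 / 4]` from `T0` on stays on one side.
    have hcases : (∀ t, T0 ≤ t → d i j t < 1 / 4) ∨ ∀ t, T0 ≤ t → 1 - 1 / 4 < d i j t := by
      by_contra! hcon
      obtain ⟨⟨s, hs, hs'⟩, t, ht, ht'⟩ := hcon
      have hs2 := (h0 s hs).resolve_left (not_lt.2 hs')
      have ht2 := (h0 t ht).resolve_right (not_lt.2 ht')
      have hp : IsPreconnected (Ici T0) := isPreconnected_Ici
      obtain ⟨r, hr, hr'⟩ := hp.intermediate_value (mem_Ici.2 ht) (mem_Ici.2 hs)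
        ((hdcont i j).mono (Ici_subset_Ici.2 hT0)) (show (1 / 2 : ℝ) ∈ Icc _ _ from
          ⟨by linarith, by linarith⟩)
      rcases h0 r hr with h | h <;> rw [hr'] at h <;> norm_num at h
    rcases hcases with h | h
    · left
      rw [Metric.tendsto_atTop]
      intro ε hε
      obtain ⟨T1, hT1, h1⟩ := hgap i j (min ε (1 / 4)) (by positivity)
      refine ⟨max T0 T1, fun t ht => ?_⟩
      have h2 := h t ((le_max_left _ _).trans ht)
      have h3 := (h1 t ((le_max_right _ _).trans ht)).resolve_right (by
        have := min_le_right ε (1 / 4); linarith)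
      rw [Real.dist_eq, sub_zero, abs_of_nonneg (norm_nonneg _)]
      exact h3.trans_le (min_le_left _ _)
    · right
      intro δ hδ
      obtain ⟨T1, hT1, h1⟩ := hgap i j (min δ (1 / 4)) (by positivity)
      filter_upwards [eventually_ge_atTop (max T0 T1)] with t ht
      have h2 := h t ((le_max_left _ _).trans ht)
      have h3 := (h1 t ((le_max_right _ _).trans ht)).resolve_left (by
        have := min_le_right δ (1 / 4); linarith)
      have := min_le_left δ (1 / 4)
      linarith
  set near : Fin N → Fin N → Prop := fun i j => Tendsto (d i j) atTop (𝓝 0) with hnear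
  have hfar : ∀ i j, ¬ near i j → ∀ δ, 0 < δ → ∀ᶠ t in atTop, 1 - δ < d i j t := fun i j h =>
    (hdich i j).resolve_left h
  have hrefl : ∀ i, near i i := fun i => by simp [hnear, hd]
  have htrans : ∀ i j k, near i j → near i k → near j k := by
    intro i j k hij hik
    refine squeeze_zero (fun t => norm_nonneg _) (fun t => ?_) (by simpa using hij.add hik)
    calc d j k t = ‖-(x t i - x t j) + (x t i - x t k)‖ := by simp only [hd]; congr 1; abel
      _ ≤ _ := (norm_add_le _ _).trans (by rw [norm_neg])
  -- cluster sums converge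
  have hlim : ∀ i, ∃ l, Tendsto (fun t => x t i) atTop (𝓝 l) := by
    intro i
    set s : Finset (Fin N) := Finset.univ.filter (near i) with hs
    have hev : ∀ᶠ t in atTop, ∀ p ∈ s, ∀ q ∉ s, 1 / 2 < ‖x t p - x t q‖ := by
      refine eventually_all.2 fun p => ?_
      by_cases hp : p ∈ s
      · refine (eventually_all.2 fun q => ?_ :
          ∀ᶠ t in atTop, ∀ q, q ∉ s → 1 / 2 < ‖x t p - x t q‖).mono fun z hz _ => hz
        by_cases hq : q ∈ s
        · exact Eventually.of_forall fun z h => absurd hq h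
        · have hpq : ¬ near p q := fun h => by
            simp only [hs, Finset.mem_filter_univ] at hp hq
            refine hq (htrans p i q ?_ h)
            have : d p i = d i p := by funext t; exact norm_sub_rev _ _
            simp only [hnear, this]; exact hp
          exact (hfar p q hpq (1 / 2) (by norm_num)).mono fun t ht _ => by
            have : 1 - 1 / 2 < ‖x t p - x t q‖ := ht
            linarith
      · exact Eventually.of_forall fun z h => absurd h hp
    obtain ⟨T0, hT0⟩ := (hev.and (eventually_ge_atTop 0)).exists_forall_of_atTop
    have hT0' := (hT0 T0 le_rfl).2
    have hCauchy : ∀ a b, T0 ≤ a → a ≤ b → ‖sumL s (x b) - sumL s (x a)‖ ≤ 2 * (e a - e b) := by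
      intro a b ha hab
      have ha0 := hT0'.trans ha
      set w := sumL s (x b) - sumL s (x a) with hw
      set u := (‖w‖)⁻¹ • w with hu
      have hu1 : ‖u‖ ≤ 1 := by
        rw [hu, norm_smul, norm_inv, norm_norm]
        exact inv_mul_le_one
      have huw : inner ℝ u w = ‖w‖ := by
        rw [hu, real_inner_smul_left, real_inner_self_eq_norm_sq]
        rcases eq_or_ne ‖w‖ 0 with h | h
        · simp [h]
        · field_simp
      have hxb := hx (b + 1) (by linarith)
      have hlipb := (hxb.lipschitzOnWith (by linarith) hb.norm_hkClosed_le).mono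
        (Icc_subset_Icc ha0 (by linarith : b ≤ b + 1))
      have hg := hxb.image_le ha0 hab (by linarith)
        (g := fun r => (innerSL ℝ u).comp (sumL s) (x r) + 2 * ip (x r) (x r))
        ((absolutelyContinuous_clm_comp (LipschitzOnWith.absolutelyContinuousOnInterval (by
          rwa [uIcc_of_le hab])) ((innerSL ℝ u).comp (sumL s))).add
          ((absolutelyContinuous_comp_of_contDiff hab hlipb contDiff_ip_self).const_mul 2))
        (fun r hr v hv hd => ⟨_, ?_, (((innerSL ℝ u).comp (sumL s)).hasFDerivAt.comp_hasDerivAt r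
          hd).add ((hasDerivAt_ip hd hd).const_mul 2)⟩)
      · simp only [ContinuousLinearMap.comp_apply, innerSL_apply_apply] at hg
        rw [← huw, hw, inner_sub_right]
        simp only [he]; linarith
      · have := hb.inner_sum_krasovskii_le hv (hT0 r (ha.trans hr.1)).1 hu1
        simp only [ContinuousLinearMap.comp_apply, innerSL_apply_apply, sumL_apply]
        rw [ip_comm (x r) v]; linarith
    obtain ⟨m, hm⟩ : ∃ m, Tendsto (fun t => sumL s (x t)) atTop (𝓝 m) := by
      have hcs : CauchySeq fun t => sumL s (x (max t T0)) := by
        refine cauchySeq_of_le_tendsto_0 (fun t => 2 * (e (max t T0) - e0)) ?_ ?_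
        · intro p q r hp hq
          rw [dist_eq_norm]
          have key : ∀ p q, r ≤ p → p ≤ q → ‖sumL s (x (max q T0)) - sumL s (x (max p T0))‖ ≤
              2 * (e (max r T0) - e0) := by
            intro p q hp hpq
            have h1 := hCauchy (max p T0) (max q T0) (le_max_right _ _) (max_le_max_right _ hpq)
            have h2 := hanti (max r T0) (max p T0) (hT0'.trans (le_max_right _ _))
              (max_le_max_right _ hp)
            have h3 := he0le (max q T0) (hT0'.trans (le_max_right _ _))
            linarith
          rcases le_total p q with h | h
          · rw [norm_sub_rev]; exact key p q hp h
          · exact key q p hq h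
        · have h1 : Tendsto (fun t => e (max t T0)) atTop (𝓝 e0) :=
            he0.congr' ((eventually_ge_atTop T0).mono fun t ht => by beta_reduce; rw [max_eq_left ht])
          simpa using (h1.sub_const e0).const_mul 2
      obtain ⟨m, hm⟩ := cauchySeq_tendsto_of_complete hcs
      exact ⟨m, hm.congr' ((eventually_ge_atTop T0).mono fun t ht => by rw [max_eq_left ht])⟩
    have hcard : (s.card : ℝ) ≠ 0 := by
      have : i ∈ s := by simp [hs, hrefl]
      exact_mod_cast (Finset.card_pos.2 ⟨i, this⟩).ne'
    have hsmall : Tendsto (fun t => ∑ j ∈ s, (x t i - x t j)) atTop (𝓝 0) := by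
      rw [← Finset.sum_const_zero (s := s)]
      refine tendsto_finsetSum _ fun j hj => ?_
      rw [tendsto_zero_iff_norm_tendsto_zero]
      simp only [hs, Finset.mem_filter_univ] at hj
      exact hj
    refine ⟨(s.card : ℝ)⁻¹ • (m + 0), ((hm.add hsmall).const_smul _).congr fun t => ?_⟩
    simp only [sumL_apply, Finset.sum_sub_distrib, Finset.sum_const, add_sub_cancel]
    rw [← Nat.cast_smul_eq_nsmul ℝ, smul_smul, inv_mul_cancel₀ hcard, one_smul]
  choose l hl using hlim
  refine ⟨l, tendsto_pi_nhds.2 hl, fun i j => ?_⟩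
  have hdl : Tendsto (d i j) atTop (𝓝 ‖l i - l j‖) := ((hl i).sub (hl j)).norm
  rcases hdich i j with h | h
  · left
    exact sub_eq_zero.1 (norm_eq_zero.1 (tendsto_nhds_unique hdl h))
  · right
    refine le_of_forall_pos_lt_add fun δ hδ => ?_
    have := ge_of_tendsto hdl ((h (δ / 2) (by positivity)).mono fun t ht => ht.le)
    linarith

end CouplingBounds
end Asymptotics

/-! ### The one-sided Lipschitz estimate and stability backward in time. -/

section Cutoffs

variable {n N : ℕ} {φ : Fin N → Fin N → ℝ → ℝ} {c C L : ℝ}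

/-- Weights between the indicators of `[0, 1]` and `[0, 1 + ε]`. -/
structure IsCutoff (ε : ℝ) (θ : ℝ → ℝ) : Prop where
  nonneg : ∀ r, 0 ≤ θ r
  le_one : ∀ r, θ r ≤ 1
  one_le : ∀ r, θ r < 1 → 1 ≤ r
  le_add : ∀ r, 0 < θ r → r ≤ 1 + ε

theorem IsCutoff.mono {ε ε' : ℝ} {θ : ℝ → ℝ} (h : IsCutoff ε θ) (hε : ε ≤ ε') : IsCutoff ε' θ :=
  ⟨h.nonneg, h.le_one, h.one_le, fun r hr => (h.le_add r hr).trans (by linarith)⟩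

theorem isCutoff_closedIndicator {ε : ℝ} (hε : 0 ≤ ε) : IsCutoff ε closedIndicator := by
  constructor <;> intro r <;> unfold closedIndicator <;> split_ifs with h <;> intros <;> linarith

/-- The piecewise linear cutoff. -/
noncomputable def rampCutoff (ε r : ℝ) : ℝ := max 0 (min 1 (1 - (r - 1) / ε))

theorem isCutoff_rampCutoff {ε : ℝ} (hε : 0 < ε) : IsCutoff ε (rampCutoff ε) where
  nonneg r := le_max_left _ _
  le_one r := max_le zero_le_one (min_le_left _ _)
  one_le r h := by
    by_contra! hr
    have h1 : (r - 1) / ε ≤ 0 := div_nonpos_of_nonpos_of_nonneg (by linarith) hε.le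
    rw [rampCutoff, min_eq_left (by linarith), max_eq_right zero_le_one] at h
    exact lt_irrefl _ h
  le_add r h := by
    by_contra! hr
    have h1 : 1 ≤ (r - 1) / ε := by rw [le_div_iff₀ hε]; linarith
    rw [rampCutoff, max_eq_left ((min_le_right _ _).trans (by linarith))] at h
    exact lt_irrefl _ h

theorem abs_rampCutoff_sub_le {ε : ℝ} (hε : 0 < ε) (r s : ℝ) :
    |rampCutoff ε r - rampCutoff ε s| ≤ ε⁻¹ * |r - s| := by
  refine (abs_max_sub_max_le_max _ _ _ _).trans ?_
  refine max_le (by simp; positivity) ((abs_min_sub_min_le_max _ _ _ _).trans ?_)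
  refine max_le (by simp; positivity) (le_of_eq ?_)
  rw [show 1 - (r - 1) / ε - (1 - (s - 1) / ε) = -(ε⁻¹ * (r - s)) by field_simp; ring, abs_neg,
    abs_mul, abs_of_pos (inv_pos.2 hε)]

theorem continuous_ip {X : Type*} [TopologicalSpace X] {f g : X → Config n N}
    (hf : Continuous f) (hg : Continuous g) : Continuous fun z => ip (f z) (g z) := by
  unfold ip
  exact continuous_finsetSum _ fun i _ =>
    ((continuous_apply i).comp hf).inner ((continuous_apply i).comp hg)


namespace CouplingBounds

variable (hb : CouplingBounds φ c C L)
include hb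

/-- The weights differ only if the separation with the smaller weight is at least one and the other
at most `1 + ε`. Since `2 * ⟪D', D - D'⟫ = ‖D‖ ^ 2 - ‖D'‖ ^ 2 - ‖D - D'‖ ^ 2`, the term with the
difference of the weights then has the favourable sign up to `ε` and `‖D - D'‖ ^ 2`. The constant
does not involve the steepness of the weights. -/
theorem inner_cutoff_le {ε : ℝ} (hε0 : 0 ≤ ε) (hε : ε ≤ 1) {θ θ' : ℝ → ℝ} (hθ : IsCutoff ε θ)
    (hθ' : IsCutoff ε θ') (i j : Fin N) (D D' : EuclideanSpace ℝ (Fin n)) :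
    inner ℝ (θ ‖D‖ • kernel φ i j D - θ' ‖D'‖ • kernel φ i j D') (D - D') ≤
      (3 * C + L) * ‖D - D'‖ ^ 2 + 2 * C * ε := by
  set a := θ ‖D‖
  set a' := θ' ‖D'‖
  have ha0 := hθ.nonneg ‖D‖
  have ha1 := hθ.le_one ‖D‖
  have ha0' := hθ'.nonneg ‖D'‖
  have ha1' := hθ'.le_one ‖D'‖
  have hk0 := hb.kernelCoeff_pos i j D'
  have hk1 := hb.kernelCoeff_le i j D'
  have hdec : inner ℝ (a • kernel φ i j D - a' • kernel φ i j D') (D - D') =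
      a * inner ℝ (kernel φ i j D - kernel φ i j D') (D - D') +
      (a - a') * (kernelCoeff φ i j ‖D'‖ * inner ℝ D' (D - D')) := by
    rw [show a • kernel φ i j D - a' • kernel φ i j D' =
      a • (kernel φ i j D - kernel φ i j D') + (a - a') • kernel φ i j D' by module,
      inner_add_left, real_inner_smul_left, real_inner_smul_left]
    rw [show inner ℝ (kernel φ i j D') (D - D') = kernelCoeff φ i j ‖D'‖ * inner ℝ D' (D - D') by
      rw [kernel, real_inner_smul_left]]
  have h1 : a * inner ℝ (kernel φ i j D - kernel φ i j D') (D - D') ≤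
      (2 * C + L) * ‖D - D'‖ ^ 2 := by
    have h2 : inner ℝ (kernel φ i j D - kernel φ i j D') (D - D') ≤
        (2 * C + L) * ‖D - D'‖ * ‖D - D'‖ :=
      (real_inner_le_norm _ _).trans (mul_le_mul_of_nonneg_right (hb.kernel_lipschitz i j D D')
        (norm_nonneg _))
    have h3 : 0 ≤ (2 * C + L) * ‖D - D'‖ * ‖D - D'‖ := by
      have := hb.C_pos; have := hb.lip_nonneg; positivity
    nlinarith
  have hin : inner ℝ D' (D - D') = (‖D‖ ^ 2 - ‖D'‖ ^ 2 - ‖D - D'‖ ^ 2) / 2 := by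
    rw [inner_sub_right, real_inner_self_eq_norm_sq, norm_sub_sq_real, real_inner_comm]; ring
  have hn := norm_nonneg D
  have hn' := norm_nonneg D'
  have hnd := sq_nonneg ‖D - D'‖
  -- For `ε ≤ 1` one has `(1 + ε) ^ 2 - 1 ≤ 3 * ε`.
  have hpos : ∀ s r : ℝ, 0 ≤ s → 0 ≤ r → s ≤ 1 + ε → 1 ≤ r → s ^ 2 - r ^ 2 ≤ 4 * ε := by
    intro s r hs hr h1 h2
    rcases le_total s r with h | h
    · have h3 : s ^ 2 ≤ r ^ 2 := by gcongr
      linarith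
    · nlinarith
  have h2 : (a - a') * (kernelCoeff φ i j ‖D'‖ * inner ℝ D' (D - D')) ≤
      C * ‖D - D'‖ ^ 2 + 2 * C * ε := by
    rcases lt_trichotomy a a' with h | h | h
    · have e1 := hθ.one_le _ (h.trans_le ha1')
      have e2 := hθ'.le_add _ (ha0.trans_lt h)
      have e3 := hpos _ _ hn' hn e2 e1
      have e4 : -(inner ℝ D' (D - D')) ≤ ‖D - D'‖ ^ 2 + 2 * ε := by rw [hin]; linarith
      have e5 : 0 ≤ ‖D - D'‖ ^ 2 + 2 * ε := by linarith
      have e6 : kernelCoeff φ i j ‖D'‖ * -(inner ℝ D' (D - D')) ≤ C * (‖D - D'‖ ^ 2 + 2 * ε) :=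
        (mul_le_mul_of_nonneg_left e4 hk0.le).trans (mul_le_mul_of_nonneg_right hk1 e5)
      have e7 : 0 ≤ C * (‖D - D'‖ ^ 2 + 2 * ε) := mul_nonneg hb.C_pos.le e5
      have e8 : (a' - a) * (kernelCoeff φ i j ‖D'‖ * -(inner ℝ D' (D - D'))) ≤
          1 * (C * (‖D - D'‖ ^ 2 + 2 * ε)) :=
        (mul_le_mul_of_nonneg_left e6 (by linarith)).trans
          (mul_le_mul_of_nonneg_right (by linarith) e7)
      linarith
    · rw [h, sub_self, zero_mul]
      have := hb.C_pos; positivity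
    · have e1 := hθ'.one_le _ (h.trans_le ha1)
      have e2 := hθ.le_add _ (ha0'.trans_lt h)
      have e3 := hpos _ _ hn hn' e2 e1
      have e4 : inner ℝ D' (D - D') ≤ ‖D - D'‖ ^ 2 + 2 * ε := by rw [hin]; linarith
      have e5 : 0 ≤ ‖D - D'‖ ^ 2 + 2 * ε := by positivity
      have e6 : kernelCoeff φ i j ‖D'‖ * inner ℝ D' (D - D') ≤ C * (‖D - D'‖ ^ 2 + 2 * ε) :=
        (mul_le_mul_of_nonneg_left e4 hk0.le).trans (mul_le_mul_of_nonneg_right hk1 e5)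
      have e7 : 0 ≤ C * (‖D - D'‖ ^ 2 + 2 * ε) := mul_nonneg hb.C_pos.le e5
      have e8 : (a - a') * (kernelCoeff φ i j ‖D'‖ * inner ℝ D' (D - D')) ≤
          1 * (C * (‖D - D'‖ ^ 2 + 2 * ε)) :=
        (mul_le_mul_of_nonneg_left e6 (by linarith)).trans
          (mul_le_mul_of_nonneg_right (by linarith) e7)
      linarith
  rw [hdec]; linarith

/-- One-sided Lipschitz estimate, uniform in the cutoff. -/
theorem exists_one_sided : ∃ Λ : ℝ, 0 ≤ Λ ∧ ∀ ε, 0 ≤ ε → ε ≤ 1 → ∀ θ θ', IsCutoff ε θ →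
    IsCutoff ε θ' → ∀ x y : Config n N, -(Λ * (ip (x - y) (x - y) + ε)) ≤
      ip (weightedField φ (fun _ _ => θ) x - weightedField φ (fun _ _ => θ') y) (x - y) := by
  have hC := hb.C_pos
  have hL := hb.lip_nonneg
  refine ⟨2 * N * (3 * C + L) + N ^ 2 * C, by positivity, ?_⟩
  intro ε hε hε1 θ θ' hθ hθ' x y
  rw [ip_sub_left (weightedField φ (fun _ _ => θ) x), hb.ip_weightedField (fun _ _ _ => rfl), hb.ip_weightedField (fun _ _ _ => rfl)]
  have hterm : ∀ i j, θ ‖x i - x j‖ * inner ℝ (kernel φ i j (x i - x j)) ((x - y) i - (x - y) j) -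
      θ' ‖y i - y j‖ * inner ℝ (kernel φ i j (y i - y j)) ((x - y) i - (x - y) j) ≤
      (3 * C + L) * (2 * inner ℝ ((x - y) i) ((x - y) i) + 2 * inner ℝ ((x - y) j) ((x - y) j)) +
        2 * C * ε := by
    intro i j
    have h1 := hb.inner_cutoff_le hε hε1 hθ hθ' i j (x i - x j) (y i - y j)
    have e1 : (x - y) i - (x - y) j = x i - x j - (y i - y j) := by
      simp only [Pi.sub_apply]; abel
    rw [e1, ← real_inner_smul_left, ← real_inner_smul_left, ← inner_sub_left]
    refine h1.trans ?_
    rw [← e1, real_inner_self_eq_norm_sq, real_inner_self_eq_norm_sq]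
    have h2 : ‖(x - y) i - (x - y) j‖ ^ 2 ≤ 2 * ‖(x - y) i‖ ^ 2 + 2 * ‖(x - y) j‖ ^ 2 := by
      have := parallelogram_law_with_norm ℝ ((x - y) i) ((x - y) j)
      nlinarith [mul_self_nonneg ‖(x - y) i + (x - y) j‖]
    have h3 : 0 ≤ 3 * C + L := by positivity
    nlinarith
  have hsum := Finset.sum_le_sum fun i (_ : i ∈ Finset.univ) =>
    Finset.sum_le_sum fun j (_ : j ∈ Finset.univ) => hterm i j
  simp only [Finset.sum_sub_distrib] at hsum
  have hR : ∑ i : Fin N, ∑ j : Fin N, ((3 * C + L) * (2 * inner ℝ ((x - y) i) ((x - y) i) +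
      2 * inner ℝ ((x - y) j) ((x - y) j)) + 2 * C * ε) =
      4 * N * (3 * C + L) * ip (x - y) (x - y) + 2 * N ^ 2 * C * ε := by
    simp only [ip, Finset.sum_add_distrib, ← Finset.mul_sum, Finset.sum_const, Finset.card_univ,
      Fintype.card_fin, nsmul_eq_mul]
    ring
  rw [hR] at hsum
  have hq := ip_self_nonneg (x - y)
  have h4 : 0 ≤ (N : ℝ) ^ 2 * C * ip (x - y) (x - y) := by positivity
  have h5 : 0 ≤ 2 * N * (3 * C + L) * ε := by positivity
  nlinarith

/-- For fixed `x` the inequality is linear in the velocity at `z`, up to terms continuous in `z`, so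
it passes to the convexified field. -/
theorem one_sided_krasovskii {Λ ε : ℝ} {θ : ℝ → ℝ}
    (h : ∀ x y : Config n N, -(Λ * (ip (x - y) (x - y) + ε)) ≤
      ip (weightedField φ (fun _ _ => θ) x - hkClosed n φ y) (x - y))
    {x y v : Config n N} (hv : v ∈ krasovskiiMap (hkClosed n φ) y) :
    -(Λ * (ip (x - y) (x - y) + ε)) ≤
      ip (weightedField φ (fun _ _ => θ) x - v) (x - y) := by
  set w := weightedField φ (fun _ _ => θ) x with hw
  have h1 : Continuous fun z : Config n N => ip w (x - z) :=
    continuous_ip continuous_const (continuous_const.sub continuous_id)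
  have h2 : Continuous fun z : Config n N => ip (x - z) (x - z) :=
    continuous_ip (continuous_const.sub continuous_id)
      (continuous_const.sub continuous_id)
  have hcont : Continuous fun z : Config n N => ip w (x - z) + Λ * (ip (x - z) (x - z) + ε) :=
    h1.add (continuous_const.mul (h2.add continuous_const))
  have key := le_of_mem_krasovskiiMap_ip hb.norm_hkClosed_le (ipL x) (-1)
    (b := fun z => ip w (x - z) + Λ * (ip (x - z) (x - z) + ε)) hcont.continuousAt
    (Eventually.of_forall fun z => by
      have h3 := h x z
      rw [ip_sub_left w, ip_sub_right (hkClosed n φ z)] at h3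
      rw [ipL_apply]
      linarith) hv
  rw [ip_sub_left w, ip_sub_right v]
  rw [ipL_apply] at key
  linarith

end CouplingBounds

/-- Backward stability of curves whose velocities satisfy the one-sided estimate. -/
theorem ip_sub_le_of_one_sided {X Y : ℝ → Config n N} {t Λ ε : ℝ} {K K' : NNReal} (ht : 0 ≤ t)
    (hX : LipschitzOnWith K X (Icc 0 t)) (hY : LipschitzOnWith K' Y (Icc 0 t))
    (h : ∀ᵐ s, s ∈ Icc 0 t → ∃ u w, HasDerivAt X u s ∧ HasDerivAt Y w s ∧
      -(Λ * (ip (X s - Y s) (X s - Y s) + ε)) ≤ ip (u - w) (X s - Y s)) :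
    ip (X 0 - Y 0) (X 0 - Y 0) + ε ≤ Real.exp (2 * Λ * t) * (ip (X t - Y t) (X t - Y t) + ε) := by
  have hac1 : AbsolutelyContinuousOnInterval (fun s : ℝ => -(Real.exp (2 * Λ * s))) 0 t := by
    apply ContDiffOn.absolutelyContinuousOnInterval
    fun_prop
  have hac2 : AbsolutelyContinuousOnInterval (fun s => ip (X s - Y s) (X s - Y s)) 0 t :=
    absolutelyContinuous_comp_of_contDiff (x := fun s => X s - Y s) (g := fun z => ip z z) ht (hX.sub hY)
      contDiff_ip_self
  have hac3 : AbsolutelyContinuousOnInterval (fun _ : ℝ => ε) 0 t := by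
    apply ContDiffOn.absolutelyContinuousOnInterval
    fun_prop
  -- Gronwall in reversed time: `exp (2 * Λ * s)` times the squared distance plus `ε` does not
  -- decrease.
  have hac : AbsolutelyContinuousOnInterval
      (fun s => -(Real.exp (2 * Λ * s)) * (ip (X s - Y s) (X s - Y s) + ε)) 0 t :=
    AbsolutelyContinuousOnInterval.fun_mul hac1 (hac2.fun_add hac3)
  have := le_of_absolutelyContinuous_of_ae_deriv_nonpos ht hac ?_
  · simp only [mul_zero, Real.exp_zero] at this
    linarith
  · filter_upwards [h] with s hs hmem
    obtain ⟨u, w, hu, hw, hle⟩ := hs hmem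
    have e1 : HasDerivAt (fun s => -(Real.exp (2 * Λ * s))) (-(Real.exp (2 * Λ * s) * (2 * Λ * 1))) s :=
      (((hasDerivAt_id s).const_mul (2 * Λ)).exp).neg
    have e2 : HasDerivAt (fun s => ip (X s - Y s) (X s - Y s) + ε)
        (ip (X s - Y s) (u - w) + ip (u - w) (X s - Y s)) s :=
      (hasDerivAt_ip (hu.fun_sub hw) (hu.fun_sub hw)).add_const ε
    refine ⟨_, ?_, e1.fun_mul e2⟩
    have h1 := Real.exp_pos (2 * Λ * s)
    rw [ip_comm (X s - Y s) (u - w)]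
    generalize ip (X s - Y s) (X s - Y s) = q at *
    generalize ip (u - w) (X s - Y s) = p at *
    generalize Real.exp (2 * Λ * s) = r at *
    have h2 := mul_le_mul_of_nonneg_left hle h1.le
    linarith

end Cutoffs

/-! ### Flows of bounded Lipschitz fields. -/

section Flow

variable {E : Type*} [NormedAddCommGroup E] [NormedSpace ℝ E] [CompleteSpace E]

/-- The time `t` map of a bounded Lipschitz field and its inverse. -/
theorem exists_flow {F : E → E} {K : NNReal} {M t : ℝ} (hK : LipschitzWith K F)
    (hM : ∀ x, ‖F x‖ ≤ M) (ht : 0 < t) :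
    ∃ Φ Ψ : E → E, Continuous Φ ∧ (∀ w, Φ (Ψ w) = w) ∧ (∀ x, Ψ (Φ x) = x) ∧
      ∀ w, ∃ X : ℝ → E, X 0 = Ψ w ∧ X t = w ∧ ∀ s ∈ Icc 0 t, HasDerivAt X (F (X s)) s := by
  choose ξ hξ0 hξ using fun w => exists_solution_of_lipschitz_of_bounded hK hM w
    (show 0 < t + 1 by linarith)
  have hfw : ∀ w, ∀ s ∈ Icc 0 t, HasDerivAt (ξ w) (F (ξ w s)) s := fun w s hs =>
    hξ w s ⟨by linarith [hs.1], by linarith [hs.2]⟩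
  have hbw : ∀ w, ∀ s ∈ Icc 0 t, HasDerivAt (fun s => ξ w (s - t)) (F (ξ w (s - t))) s :=
    fun w s hs => HasDerivAt.comp_sub_const s t (hξ w (s - t) ⟨by linarith [hs.1], by linarith [hs.2]⟩)
  have hunique : ∀ X Y : ℝ → E, (∀ s ∈ Icc 0 t, HasDerivAt X (F (X s)) s) →
      (∀ s ∈ Icc 0 t, HasDerivAt Y (F (Y s)) s) → X 0 = Y 0 → X t = Y t := fun X Y hX hY h =>
    ODE_solution_unique (v := fun _ => F) (fun _ => hK) (HasDerivAt.continuousOn hX)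
      (fun s hs => (hX s (Ico_subset_Icc_self hs)).hasDerivWithinAt) (HasDerivAt.continuousOn hY)
      (fun s hs => (hY s (Ico_subset_Icc_self hs)).hasDerivWithinAt) h (right_mem_Icc.2 ht.le)
  have hunique' : ∀ X Y : ℝ → E, (∀ s ∈ Icc 0 t, HasDerivAt X (F (X s)) s) →
      (∀ s ∈ Icc 0 t, HasDerivAt Y (F (Y s)) s) → X t = Y t → X 0 = Y 0 := fun X Y hX hY h =>
    ODE_solution_unique_of_mem_Icc_left (v := fun _ => F) (s := fun _ => univ)
      (fun _ _ => hK.lipschitzOnWith) (HasDerivAt.continuousOn hX)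
      (fun s hs => (hX s (Ioc_subset_Icc_self hs)).hasDerivWithinAt) (fun _ _ => trivial)
      (HasDerivAt.continuousOn hY)
      (fun s hs => (hY s (Ioc_subset_Icc_self hs)).hasDerivWithinAt) (fun _ _ => trivial)
      h (left_mem_Icc.2 ht.le)
  refine ⟨fun x => ξ x t, fun w => ξ w (-t), ?_, fun w => ?_, fun x => ?_, fun w => ?_⟩
  · refine (LipschitzWith.of_dist_le_mul (K := (Real.exp (K * t)).toNNReal) fun x y => ?_).continuous
    rw [Real.coe_toNNReal _ (Real.exp_pos _).le, mul_comm]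
    have := dist_le_of_trajectories_ODE (v := fun _ => F) (δ := dist x y) (fun _ => hK)
      (HasDerivAt.continuousOn (hfw x))
      (fun s hs => (hfw x s (Ico_subset_Icc_self hs)).hasDerivWithinAt)
      (HasDerivAt.continuousOn (hfw y))
      (fun s hs => (hfw y s (Ico_subset_Icc_self hs)).hasDerivWithinAt)
      (by rw [hξ0, hξ0]) t (right_mem_Icc.2 ht.le)
    simpa using this
  · have := hunique (ξ (ξ w (-t))) (fun s => ξ w (s - t)) (hfw _) (hbw w) (by simp [hξ0])
    simpa [hξ0] using this
  · have := hunique' (fun s => ξ (ξ x t) (s - t)) (ξ x) (hbw _) (hfw x) (by simp [hξ0])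
    simpa [hξ0] using this
  · exact ⟨fun s => ξ w (s - t), by simp, by simp [hξ0], hbw w⟩

end Flow

/-! ### Null sets of values of Lipschitz maps. -/

section Null

variable {E : Type*} [NormedAddCommGroup E] [NormedSpace ℝ E] [FiniteDimensional ℝ E]
  [MeasurableSpace E] [BorelSpace E]

/-- Haar measures are proportional to the top-dimensional Hausdorff measure, which a Lipschitz map
enlarges by at most a constant factor. -/
theorem addHaar_image_eq_zero_of_lipschitz (μ : Measure E) [μ.IsAddHaarMeasure] {B : E → E}
    {K : NNReal} (hB : LipschitzWith K B) {s : Set E} (hs : μ s = 0) : μ (B '' s) = 0 := by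
  set ν : Measure E := Measure.hausdorffMeasure (Module.finrank ℝ E) with hν
  have h1 := Measure.isAddLeftInvariant_eq_smul ν μ
  have h2 := Measure.isAddLeftInvariant_eq_smul μ ν
  have h3 : ν s = 0 := by rw [h1, Measure.smul_apply, hs, smul_zero]
  have h4 : ν (B '' s) = 0 := by
    refine le_antisymm ((hB.hausdorffMeasure_image_le (Nat.cast_nonneg _) s).trans ?_) zero_le
    rw [← hν, h3, mul_zero]
  rw [h2, Measure.smul_apply, h4, smul_zero]

/-- If every non-injectivity point of a Lipschitz map is an accumulation point of its fibre, then
almost every value is attained at most once. -/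
theorem addHaar_image_nonInjective_eq_zero (μ : Measure E) [μ.IsAddHaarMeasure] {B : E → E}
    {K : NNReal} (hB : LipschitzWith K B)
    (h : ∀ z w, z ≠ w → B z = B w → ∃ᶠ y in 𝓝[≠] z, B y = B z) :
    μ (B '' {z | ∃ w, z ≠ w ∧ B z = B w}) = 0 := by
  set S := {z | ∃ w, z ≠ w ∧ B z = B w} with hS
  have hsplit : S ⊆ {z | z ∈ S ∧ DifferentiableAt ℝ B z} ∪ {z | ¬ DifferentiableAt ℝ B z} := by
    intro z hz
    by_cases hd : DifferentiableAt ℝ B z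
    · exact Or.inl ⟨hz, hd⟩
    · exact Or.inr hd
  refine measure_mono_null (image_mono hsplit) ?_
  rw [image_union]
  refine measure_union_null ?_ ?_
  -- An invertible derivative at `z` would make `B` differ from `B z` on a punctured neighbourhood,
  -- against `h`. So the derivative is singular and Sard's theorem applies.
  · refine addHaar_image_eq_zero_of_det_fderivWithin_eq_zero μ (f' := fun z => fderiv ℝ B z)
      (fun z hz => hz.2.hasFDerivAt.hasFDerivWithinAt) ?_
    rintro z ⟨⟨w, hzw, hBzw⟩, hd⟩
    by_contra hdet
    have hne := hd.hasFDerivAt.eventually_ne (c := B z) (by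
      set e := (fderiv ℝ B z).toContinuousLinearEquivOfDetNeZero hdet
      exact ⟨_, e.antilipschitz⟩)
    exact h z w hzw hBzw (hne.mono fun y hy => hy)
  -- By Rademacher's theorem the remaining points form a null set.
  · exact addHaar_image_eq_zero_of_lipschitz μ hB (hB.ae_differentiableAt (μ := μ))

end Null

/-! ### Fibres of uniform limits of homeomorphisms. -/

section Fibre

variable {E : Type*} [NormedAddCommGroup E] [NormedSpace ℝ E] [FiniteDimensional ℝ E]

/-- A uniform limit of homeomorphisms has no isolated non-injectivity points in its fibres. -/
theorem frequently_eq_of_tendsto_homeo {Φ Ψ : ℕ → E → E} {B : E → E} {δ : ℕ → ℝ}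
    (hΦ : ∀ k, Continuous (Φ k)) (hΦΨ : ∀ k w, Φ k (Ψ k w) = w) (hΨΦ : ∀ k x, Ψ k (Φ k x) = x)
    (hB : Continuous B) (hδ : Tendsto δ atTop (𝓝 0)) (h : ∀ k w, ‖Ψ k w - B w‖ ≤ δ k)
    {z w : E} (hzw : z ≠ w) (hBzw : B z = B w) : ∃ᶠ y in 𝓝[≠] z, B y = B z := by
  have hprop : ProperSpace E := FiniteDimensional.proper ℝ E
  -- The segment from `Ψ k z` to `Ψ k w` is within `δ k` of `B z`, and `Φ k` maps it to a path from
  -- `z` to `w`. This path meets the sphere of radius `ρ`, at a point where `B` is within `2 * δ k`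
  -- of `B z`; compactness of the sphere then gives `y`.
  have key : ∀ ρ, 0 < ρ → ρ < ‖w - z‖ → ∃ y, ‖y - z‖ = ρ ∧ B y = B z := by
    intro ρ hρ hρ'
    have hk : ∀ k, ∃ y ∈ Metric.sphere z ρ, ‖B y - B z‖ ≤ 2 * δ k := by
      intro k
      have hc : Continuous fun s : ℝ => ‖Φ k (AffineMap.lineMap (Ψ k z) (Ψ k w) s) - z‖ :=
        (((hΦ k).comp AffineMap.lineMap_continuous).sub continuous_const).norm
      obtain ⟨s, hs, hsρ⟩ := intermediate_value_Icc zero_le_one hc.continuousOn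
        (show ρ ∈ Icc _ _ by
          simp only [AffineMap.lineMap_apply_zero, AffineMap.lineMap_apply_one, hΦΨ, sub_self,
            norm_zero]
          exact ⟨hρ.le, hρ'.le⟩)
      set p := AffineMap.lineMap (Ψ k z) (Ψ k w) s with hp
      refine ⟨Φ k p, by simpa [dist_eq_norm] using hsρ, ?_⟩
      have h1 : p ∈ Metric.closedBall (B z) (δ k) := by
        refine (convex_closedBall (B z) (δ k)).segment_subset ?_ ?_
          (segment_eq_image_lineMap ℝ (Ψ k z) (Ψ k w) ▸ mem_image_of_mem _ hs)
        · rw [mem_closedBall_iff_norm]; exact h k z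
        · rw [mem_closedBall_iff_norm, hBzw]; exact h k w
      rw [mem_closedBall_iff_norm] at h1
      have h2 := h k (Φ k p)
      rw [hΨΦ] at h2
      calc ‖B (Φ k p) - B z‖ = ‖(p - B z) - (p - B (Φ k p))‖ := by congr 1; abel
        _ ≤ _ := norm_sub_le _ _
        _ ≤ 2 * δ k := by linarith
    choose y hy hBy using hk
    obtain ⟨y₀, hy₀, σ, hσ, hlim⟩ := (isCompact_sphere z ρ).tendsto_subseq hy
    refine ⟨y₀, by simpa [dist_eq_norm] using hy₀, ?_⟩
    have h1 : Tendsto (fun k => ‖B (y (σ k)) - B z‖) atTop (𝓝 ‖B y₀ - B z‖) :=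
      (((hB.tendsto y₀).comp hlim).sub_const _).norm
    have h2 : Tendsto (fun k => 2 * δ (σ k)) atTop (𝓝 (2 * 0)) :=
      (hδ.comp hσ.tendsto_atTop).const_mul 2
    have h3 := le_of_tendsto_of_tendsto' h1 h2 fun k => hBy (σ k)
    rw [mul_zero] at h3
    exact sub_eq_zero.1 (norm_le_zero_iff.1 h3)
  have hpos : 0 < ‖w - z‖ := norm_pos_iff.2 (sub_ne_zero.2 hzw.symm)
  rw [frequently_nhdsWithin_iff, Metric.nhds_basis_ball.frequently_iff]
  intro r hr
  obtain ⟨y, hy, hBy⟩ := key (min r ‖w - z‖ / 2) (by positivity) (by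
    have := min_le_right r ‖w - z‖; linarith)
  refine ⟨y, ?_, hBy, ?_⟩
  · rw [mem_ball_iff_norm, hy]
    have := min_le_left r ‖w - z‖; linarith
  · rintro rfl
    have : 0 < min r ‖w - y‖ := by positivity
    rw [sub_self, norm_zero] at hy
    linarith

end Fibre

/-! ### The backward map and uniqueness for almost every initial datum. -/

section BackwardMap

variable {n N : ℕ} {φ : Fin N → Fin N → ℝ → ℝ} {c C L : ℝ}

namespace CouplingBounds

variable (hb : CouplingBounds φ c C L)
include hb

/-- The initial point of a Krasovskii solution is a Lipschitz function of its value at time `t`. -/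
theorem exists_backward_map {t : ℝ} (ht : 0 < t) :
    ∃ (B : Config n N → Config n N) (K : NNReal), LipschitzWith K B ∧
      (∀ x, IsKrasovskiiSolution (hkClosed n φ) t x → B (x t) = x 0) ∧
      ∀ z w, z ≠ w → B z = B w → ∃ᶠ y in 𝓝[≠] z, B y = B z := by
  obtain ⟨Λ, hΛ, hone⟩ := hb.exists_one_sided (n := n)
  set ε : ℕ → ℝ := fun k => 1 / ((k : ℝ) + 1) with hε
  have hε0 : ∀ k, 0 < ε k := fun k => Nat.one_div_pos_of_nat
  have hε1 : ∀ k, ε k ≤ 1 := fun k => by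
    rw [hε]; dsimp only; rw [div_le_one (by positivity)]; linarith [(Nat.cast_nonneg k : (0 : ℝ) ≤ k)]
  have hεlim : Tendsto ε atTop (𝓝 0) := tendsto_one_div_add_atTop_nhds_zero_nat
  have hεmono : ∀ k m, k ≤ m → ε m ≤ ε k := fun k m hkm => Nat.one_div_le_one_div hkm
  -- These Lipschitz fields can be integrated backward from time `t`, giving `Ψ k`. The one-sided
  -- estimate makes `Ψ k` uniformly Cauchy with limit `B`, and the same estimate against a
  -- Krasovskii solution yields `B (x t) = x 0`.
  set F : ℕ → Config n N → Config n N := fun k => weightedField φ fun _ _ => rampCutoff (ε k) with hF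
  have hcut : ∀ k, IsCutoff (ε k) (rampCutoff (ε k)) := fun k => isCutoff_rampCutoff (hε0 k)
  have habs : ∀ k r, |rampCutoff (ε k) r| ≤ 1 := fun k r => by
    rw [abs_of_nonneg ((hcut k).nonneg r)]; exact (hcut k).le_one r
  have hFM : ∀ k x, ‖F k x‖ ≤ N * C := fun k x => hb.norm_weightedField_le (fun _ _ => habs k) x
  have hFlip : ∀ k, ∃ K, LipschitzWith K (F k) := fun k =>
    hb.weightedField_lipschitz (fun _ _ => habs k) (fun _ _ => abs_rampCutoff_sub_le (hε0 k))
  choose K hK using hFlip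
  have hflow := fun k => exists_flow (hK k) (hFM k) ht
  choose Φ Ψ hΦ hΦΨ hΨΦ X hX0 hXt hX using hflow
  have hXlip : ∀ k w, LipschitzOnWith (N * C).toNNReal (X k w) (Icc 0 t) := fun k w =>
    (convex_Icc 0 t).lipschitzOnWith_of_nnnorm_hasDerivWithin_le
      (fun s hs => (hX k w s hs).hasDerivWithinAt) fun s hs => by
        rw [← NNReal.coe_le_coe, coe_nnnorm, Real.coe_toNNReal _
          (mul_nonneg (Nat.cast_nonneg _) hb.C_pos.le)]
        exact hFM k _
  set R := Real.exp (2 * Λ * t) with hR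
  have hR0 : 0 < R := Real.exp_pos _
  -- Both ramps are cutoffs for the larger width `ε k`, so one estimate compares the two different
  -- fields.
  have hest : ∀ k m, k ≤ m → ∀ w w', ‖Ψ k w - Ψ m w'‖ ^ 2 ≤ R * (N * ‖w - w'‖ ^ 2 + ε k) := by
    intro k m hkm w w'
    have h1 := ip_sub_le_of_one_sided (Λ := Λ) (ε := ε k) ht.le (hXlip k w) (hXlip m w')
      (Eventually.of_forall fun s hs => ⟨_, _, hX k w s hs, hX m w' s hs,
        hone (ε k) (hε0 k).le (hε1 k) _ _ (hcut k) ((hcut m).mono (hεmono k m hkm)) _ _⟩)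
    rw [hX0, hX0, hXt, hXt] at h1
    refine (sq_norm_le_ip _).trans ?_
    have h2 := mul_le_mul_of_nonneg_left (add_le_add_left (ip_le_sq_norm (w - w')) (ε k)) hR0.le
    linarith [hε0 k]
  have hest' : ∀ k x, IsKrasovskiiSolution (hkClosed n φ) t x →
      ‖Ψ k (x t) - x 0‖ ^ 2 ≤ R * ε k := by
    intro k x hx
    have h1 := ip_sub_le_of_one_sided (Λ := Λ) (ε := ε k) ht.le (hXlip k (x t))
      (hx.lipschitzOnWith ht.le hb.norm_hkClosed_le) (by
        filter_upwards [ae_restrict_Icc_iff.1 hx.2] with s hs hmem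
        obtain ⟨v, hv, hd⟩ := hs hmem
        refine ⟨_, v, hX k (x t) s hmem, hd, hb.one_sided_krasovskii (fun a b => ?_) hv⟩
        have := hone (ε k) (hε0 k).le (hε1 k) _ _ (hcut k) (isCutoff_closedIndicator (hε0 k).le) a b
        rwa [← hkClosed_eq_weightedField] at this)
    rw [hX0, hXt, sub_self] at h1
    have h2 : ip (0 : Config n N) 0 = 0 := by
      have := ip_smul_left 0 (0 : Config n N) 0; simpa using this
    rw [h2, zero_add] at h1
    exact (sq_norm_le_ip _).trans (by linarith [hε0 k])
  set δ : ℕ → ℝ := fun k => √(R * ε k) with hδ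
  have hδlim : Tendsto δ atTop (𝓝 0) := by
    have := (Real.continuous_sqrt.tendsto _).comp (hεlim.const_mul R)
    rwa [mul_zero, Real.sqrt_zero] at this
  have hself : ∀ k m, k ≤ m → ∀ w, ‖Ψ k w - Ψ m w‖ ≤ δ k := fun k m hkm w =>
    Real.le_sqrt_of_sq_le (by simpa using hest k m hkm w w)
  have hcauchy : ∀ w, CauchySeq fun k => Ψ k w := fun w =>
    cauchySeq_of_le_tendsto_0 (fun k => δ k + δ k) (fun k m p hk hm => by
      have h1 := hself p k hk w
      have h2 := hself p m hm w
      rw [dist_eq_norm, show Ψ k w - Ψ m w = (Ψ p w - Ψ m w) - (Ψ p w - Ψ k w) by abel]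
      exact (norm_sub_le _ _).trans (add_le_add h2 h1)) (by simpa using hδlim.add hδlim)
  choose B hBlim using fun w => cauchySeq_tendsto_of_complete (hcauchy w)
  have hclose : ∀ k w, ‖Ψ k w - B w‖ ≤ δ k := fun k w =>
    le_of_tendsto ((tendsto_const_nhds.sub (hBlim w)).norm)
      (eventually_atTop.2 ⟨k, fun m hm => hself k m hm w⟩)
  have hBlip : LipschitzWith (√(R * N)).toNNReal B := by
    refine LipschitzWith.of_dist_le_mul fun w w' => ?_
    rw [dist_eq_norm, dist_eq_norm, Real.coe_toNNReal _ (Real.sqrt_nonneg _)]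
    have h1 : ‖B w - B w'‖ ^ 2 ≤ R * (N * ‖w - w'‖ ^ 2 + 0) := by
      refine le_of_tendsto_of_tendsto' ((((hBlim w).sub (hBlim w')).norm).pow 2)
        (((hεlim.const_add _).const_mul R)) fun k => hest k k le_rfl w w'
    rw [← Real.sqrt_sq (norm_nonneg (w - w')), ← Real.sqrt_mul (by positivity)]
    exact Real.le_sqrt_of_sq_le (by linarith)
  refine ⟨B, _, hBlip, fun x hx => ?_, fun z w hzw hBzw =>
    frequently_eq_of_tendsto_homeo hΦ hΦΨ hΨΦ hBlip.continuous hδlim hclose hzw hBzw⟩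
  refine tendsto_nhds_unique (hBlim (x t)) (tendsto_iff_norm_sub_tendsto_zero.2 ?_)
  exact squeeze_zero (fun _ => norm_nonneg _)
    (fun k => Real.le_sqrt_of_sq_le (hest' k x hx)) hδlim

/-- Uniqueness of Krasovskii solutions for almost every initial datum. -/
theorem ae_uniqueFrom_krasovskii :
    ∀ᵐ x₀ : Config n N, UniqueFrom (IsKrasovskiiSolution (hkClosed n φ)) x₀ := by
  -- The null set depends on the time; rational times suffice by continuity of the solutions.
  have hall : ∀ q : ℚ, ∀ᵐ x₀ : Config n N, 0 < (q : ℝ) → ∀ x y,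
      IsKrasovskiiSolution (hkClosed n φ) q x → IsKrasovskiiSolution (hkClosed n φ) q y →
      x 0 = x₀ → y 0 = x₀ → x q = y q := by
    intro q
    by_cases hq : 0 < (q : ℝ)
    · obtain ⟨B, K, hB, hBx, hfib⟩ := hb.exists_backward_map (n := n) hq
      have hnull := addHaar_image_nonInjective_eq_zero (volume : Measure (Config n N)) hB hfib
      filter_upwards [compl_mem_ae_iff.2 hnull] with x₀ hx₀ _ x y hx hy h0 h0'
      -- Two different end points would both be mapped to `x₀` by `B`, which puts `x₀` into the null
      -- set.
      by_contra hne
      refine hx₀ ⟨x q, ⟨y q, hne, ?_⟩, ?_⟩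
      · rw [hBx x hx, hBx y hy, h0, h0']
      · rw [hBx x hx, h0]
    · exact Eventually.of_forall fun _ h => absurd h hq
  filter_upwards [ae_all_iff.2 hall] with x₀ hx₀ T x y hT hx hy h0 h0'
  have hcx := (hx.lipschitzOnWith hT.le hb.norm_hkClosed_le).continuousOn
  have hcy := (hy.lipschitzOnWith hT.le hb.norm_hkClosed_le).continuousOn
  have hrestrict : ∀ z s, 0 < s → s ≤ T → IsKrasovskiiSolution (hkClosed n φ) T z →
      IsKrasovskiiSolution (hkClosed n φ) s z := fun z s hs hsT hz =>
    ⟨hz.1.mono (by rw [uIcc_of_le hs.le, uIcc_of_le hT.le]; exact Icc_subset_Icc_right hsT),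
      ae_mono (Measure.restrict_mono (Icc_subset_Icc_right hsT) le_rfl) hz.2⟩
  have hd : EqOn x y (range ((↑) : ℚ → ℝ) ∩ Ioo 0 T) := by
    rintro _ ⟨⟨q, rfl⟩, hq⟩
    exact hx₀ q hq.1 x y (hrestrict x q hq.1 hq.2.le hx) (hrestrict y q hq.1 hq.2.le hy) h0 h0'
  refine hd.of_subset_closure hcx hcy (inter_subset_right.trans Ioo_subset_Icc_self) ?_
  have h1 := (Rat.denseRange_cast (𝕜 := ℝ)).open_subset_closure_inter (isOpen_Ioo (a := 0) (b := T))
  rw [← closure_Ioo hT.ne]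
  refine (closure_mono h1).trans ?_
  rw [closure_closure, inter_comm]

end CouplingBounds
end BackwardMap

/-! ### Concatenation of curves and global Caratheodory solutions. -/

section Continuation

theorem eventually_lt_of_hasDerivWithinAt_neg {h : ℝ → ℝ} {d a : ℝ}
    (hd : HasDerivWithinAt h d (Ioi a) a) (hneg : d < 0) : ∀ᶠ t in 𝓝[>] a, h t < h a := by
  filter_upwards [hd.limsup_slope_le' self_notMem_Ioi hneg, self_mem_nhdsWithin] with t ht hat
  rw [slope_def_field, div_neg_iff] at ht
  have hat' : a < t := hat
  rcases ht with ht | ht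
  · linarith [ht.2]
  · linarith [ht.1]

theorem eventually_gt_of_hasDerivWithinAt_pos {h : ℝ → ℝ} {d a : ℝ}
    (hd : HasDerivWithinAt h d (Ioi a) a) (hpos : 0 < d) : ∀ᶠ t in 𝓝[>] a, h a < h t := by
  filter_upwards [eventually_lt_of_hasDerivWithinAt_neg hd.neg (by linarith)] with t ht
  simpa using ht

/-- `x` followed by `y` from time `T` on. -/
noncomputable def concat {X : Type*} (T : ℝ) (x y : ℝ → X) (t : ℝ) : X := if t ≤ T then x t else y (t - T)

theorem eqOn_concat {X : Type*} (T : ℝ) (x y : ℝ → X) : EqOn x (concat T x y) (Iic T) := fun t ht => by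
  rw [concat, if_pos (show t ≤ T from ht)]

theorem eqOn_concat_right {X : Type*} {T : ℝ} {x y : ℝ → X} (h : x T = y 0) :
    EqOn (fun t => y (t - T)) (concat T x y) (Ici T) := fun t ht => by
  rcases eq_or_lt_of_le (show T ≤ t from ht) with rfl | h'
  · rw [concat, if_pos le_rfl, h]; simp
  · rw [concat, if_neg (not_le.2 h')]

variable {E : Type*} [NormedAddCommGroup E]

theorem exists_continuousOn_Icc_of_lipschitzOnWith [CompleteSpace E] {x : ℝ → E} {τ : ℝ}
    {K : NNReal} (hτ : 0 < τ) (hx : LipschitzOnWith K x (Ico 0 τ)) :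
    ∃ y, EqOn x y (Ico 0 τ) ∧ ContinuousOn y (Icc 0 τ) := by
  have hne : (𝓝[Ico 0 τ] τ).NeBot := by
    rw [← mem_closure_iff_nhdsWithin_neBot, closure_Ico hτ.ne]; exact right_mem_Icc.2 hτ.le
  obtain ⟨l, hl⟩ := CompleteSpace.complete
    ((cauchy_nhds.mono (show 𝓝[Ico 0 τ] τ ≤ 𝓝 τ from nhdsWithin_le_nhds)).map_of_le
      hx.uniformContinuousOn (le_principal_iff.2 self_mem_nhdsWithin))
  have heq : EqOn x (Function.update x τ l) (Ico 0 τ) := fun t ht => by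
    rw [Function.update_of_ne ht.2.ne]
  refine ⟨Function.update x τ l, heq, ?_⟩
  rw [← Ico_insert_right hτ.le]
  intro t ht
  rcases ht with rfl | ht
  · rw [continuousWithinAt_insert_self, ContinuousWithinAt, Function.update_self]
    exact Tendsto.congr' (eventually_nhdsWithin_of_forall heq) hl
  · have h1 : ContinuousWithinAt (Function.update x τ l) (Ico 0 τ) t :=
      (hx.continuousOn.congr heq.symm) t ht
    refine ContinuousWithinAt.mono_of_mem_nhdsWithin h1 ?_
    refine mem_nhdsWithin.2 ⟨Iio τ, isOpen_Iio, ht.2, ?_⟩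
    rintro s ⟨hs, rfl | hs'⟩
    · exact absurd hs self_notMem_Iio
    · exact hs'

theorem continuousOn_concat {T S : ℝ} {x y : ℝ → E} (hT : 0 ≤ T) (hS : 0 ≤ S)
    (hx : ContinuousOn x (Icc 0 T)) (hy : ContinuousOn y (Icc 0 S)) (h : x T = y 0) :
    ContinuousOn (concat T x y) (Icc 0 (T + S)) := by
  rw [← Icc_union_Icc_eq_Icc hT (show T ≤ T + S by linarith)]
  refine ContinuousOn.union_of_isClosed ?_ ?_ isClosed_Icc isClosed_Icc
  · exact hx.congr fun t ht => (eqOn_concat T x y ht.2).symm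
  · refine ContinuousOn.congr (f := fun t => y (t - T)) ?_
      fun t ht => (eqOn_concat_right h ht.1).symm
    exact hy.comp (by fun_prop) fun t ht => ⟨by linarith [ht.1], by linarith [ht.2]⟩

variable [NormedSpace ℝ E]

theorem hasDerivAt_concat_left {T t : ℝ} {x y : ℝ → E} {v : E} (ht : t < T)
    (h : HasDerivAt x v t) : HasDerivAt (concat T x y) v t :=
  h.congr_of_eventuallyEq <| by
    filter_upwards [Iio_mem_nhds ht] with s hs using (eqOn_concat T x y (le_of_lt (show s < T from hs))).symm

theorem hasDerivAt_concat_right {T t : ℝ} {x y : ℝ → E} {v : E} (ht : T < t)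
    (h : HasDerivAt y v (t - T)) : HasDerivAt (concat T x y) v t :=
  (h.comp_sub_const t T).congr_of_eventuallyEq <| by
    filter_upwards [Ioi_mem_nhds ht] with s hs
    rw [concat, if_neg (not_le.2 hs)]

/-- Local solvability to the right at every point implies global solvability, for bounded `f`. -/
theorem exists_global_caratheodory [CompleteSpace E] {f : E → E} {M : ℝ} (hM : ∀ y, ‖f y‖ ≤ M)
    (hloc : ∀ x₀, ∃ (ε : ℝ) (ξ : ℝ → E), 0 < ε ∧ ξ 0 = x₀ ∧ ContinuousOn ξ (Icc 0 ε) ∧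
      ∀ t ∈ Ioo 0 ε, HasDerivAt ξ (f (ξ t)) t) (x₀ : E) :
    ExistsFrom (IsCaratheodorySolution f) x₀ := by
  -- Countable exceptional sets are stable under gluing and under the countable union needed to
  -- close up at a finite end; with the bound on `f` they still give absolute continuity.
  set P : ℝ → (ℝ → E) → Prop := fun T x => x 0 = x₀ ∧ ContinuousOn x (Icc 0 T) ∧
    ∃ s : Set ℝ, s.Countable ∧ ∀ t ∈ Ioo 0 T \ s, HasDerivAt x (f (x t)) t with hP
  have hM0 : 0 ≤ M := (norm_nonneg _).trans (hM x₀)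
  -- The guard `0 ≤ T` puts `0` into `Icc 0 T`, so that curves agreeing there have the same initial
  -- point.
  suffices h : ∃ x, ∀ T, 0 < T → 0 ≤ T → P T x by
    obtain ⟨x, hx⟩ := h
    refine ⟨x, (hx 1 one_pos zero_le_one).1, fun T hT => ?_⟩
    obtain ⟨-, hc, s, hs, hd⟩ := hx T hT hT.le
    exact isCaratheodorySolution_of_off_countable hs hT.le hM hc hd
  refine exists_global_of_extension (fun T x => 0 ≤ T → P T x) ?_ ?_ ?_ ?_ ?_
  · rintro T x y hx hxy hT
    obtain ⟨h0, hc, s, hs, hd⟩ := hx hT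
    refine ⟨by rw [← hxy ⟨le_rfl, hT⟩, h0], hc.congr hxy.symm, s, hs, fun t ht => ?_⟩
    rw [← hxy (Ioo_subset_Icc_self ht.1)]
    exact (hd t ht).congr_of_eventuallyEq ((hxy.symm.mono Ioo_subset_Icc_self).eventuallyEq_of_mem
      (Ioo_mem_nhds ht.1.1 ht.1.2))
  · rintro S T x hS hST hx -
    obtain ⟨h0, hc, s, hs, hd⟩ := hx (hS.le.trans hST)
    exact ⟨h0, hc.mono (Icc_subset_Icc_right hST), s, hs,
      fun t ht => hd t ⟨Ioo_subset_Ioo_right hST ht.1, ht.2⟩⟩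
  · obtain ⟨ε, ξ, hε, h0, hc, hd⟩ := hloc x₀
    exact ⟨ε, ξ, hε, fun _ => ⟨h0, hc, ∅, countable_empty, fun t ht => hd t ht.1⟩⟩
  · rintro T x hT hx
    obtain ⟨h0, hc, s, hs, hd⟩ := hx hT.le
    obtain ⟨ε, ξ, hε, hξ0, hξc, hξd⟩ := hloc (x T)
    refine ⟨T + ε, concat T x ξ, by linarith,
      (eqOn_concat T x ξ).mono Icc_subset_Iic_self, fun _ => ⟨?_,
        continuousOn_concat hT.le hε.le hc hξc hξ0.symm, s ∪ {T}, hs.union (countable_singleton T),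
        fun t ht => ?_⟩⟩
    · rw [← eqOn_concat T x ξ hT.le, h0]
    · obtain ⟨ht1, ht2⟩ := ht
      simp only [mem_union, mem_singleton_iff, not_or] at ht2
      rcases lt_or_gt_of_ne ht2.2 with h | h
      · rw [← eqOn_concat T x ξ (le_of_lt h)]
        exact hasDerivAt_concat_left h (hd t ⟨⟨ht1.1, h⟩, ht2.1⟩)
      · rw [← eqOn_concat_right hξ0.symm (le_of_lt h)]
        exact hasDerivAt_concat_right h (hξd _ ⟨by linarith, by linarith [ht1.2]⟩)
  · rintro τ x hτ hx
    have hlip : ∀ T, 0 < T → T < τ → LipschitzOnWith M.toNNReal x (Icc 0 T) := fun T h0 hT => by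
      obtain ⟨-, hc, s, hs, hd⟩ := hx T h0 hT h0.le
      exact lipschitzOnWith_of_hasDerivAt_off_countable hs hc (fun t ht => ⟨_, hM _, hd t ht⟩) hM0
    have hlip' : LipschitzOnWith M.toNNReal x (Ico 0 τ) := by
      intro a ha b hb
      obtain ⟨T, hT, hT'⟩ := exists_between (max_lt (max_lt ha.2 hb.2) hτ)
      simp only [max_lt_iff] at hT
      exact hlip T hT.2 hT' ⟨ha.1, hT.1.1.le⟩ ⟨hb.1, hT.1.2.le⟩
    obtain ⟨y, hxy, hy⟩ := exists_continuousOn_Icc_of_lipschitzOnWith hτ hlip'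
    refine ⟨y, hxy, fun _ => ⟨?_, hy, ?_⟩⟩
    · rw [← hxy ⟨le_rfl, hτ⟩]
      exact (hx (τ / 2) (by linarith) (by linarith) (by linarith)).1
    · have hseq : ∀ k : ℕ, ∃ s : Set ℝ, s.Countable ∧
          ∀ t ∈ Ioo 0 (τ - τ / (k + 2)) \ s, HasDerivAt x (f (x t)) t := fun k => by
        have h1 : τ / ((k : ℝ) + 2) < τ := div_lt_self hτ (by
          have : (0 : ℝ) ≤ k := Nat.cast_nonneg k
          linarith)
        have h2 : 0 < τ / ((k : ℝ) + 2) := by positivity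
        exact (hx (τ - τ / (k + 2)) (by linarith) (by linarith) (by linarith)).2.2
      choose s hs hd using hseq
      refine ⟨⋃ k, s k, countable_iUnion hs, fun t ht => ?_⟩
      obtain ⟨k, hk⟩ := exists_nat_gt (τ / (τ - t))
      have hpos : 0 < τ - t := by linarith [ht.1.2]
      have hlt : t < τ - τ / (k + 2) := by
        rw [div_lt_iff₀ hpos] at hk
        have : τ / (k + 2) < τ - t := by rw [div_lt_iff₀ (by positivity)]; nlinarith
        linarith
      rw [← hxy (Ioo_subset_Ico_self ht.1)]
      refine (hd k t ⟨⟨ht.1.1, hlt⟩, fun h => ht.2 (mem_iUnion.2 ⟨k, h⟩)⟩).congr_of_eventuallyEq ?_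
      exact (hxy.symm.mono Ioo_subset_Ico_self).eventuallyEq_of_mem (Ioo_mem_nhds ht.1.1 ht.1.2)

end Continuation

/-! ### Local Caratheodory solutions along a well-chosen interaction graph. -/

section GraphField

variable {n N : ℕ} {φ : Fin N → Fin N → ℝ → ℝ} {c C L : ℝ}

/-- The field of the agents coupled along the graph `e`, whatever their distances. -/
noncomputable def graphField (φ : Fin N → Fin N → ℝ → ℝ) (e : Fin N → Fin N → Bool) :
    Config n N → Config n N :=
  weightedField φ fun i j _ => if e i j then 1 else 0

theorem hkClosed_eq_graphField {e : Fin N → Fin N → Bool} {x : Config n N}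
    (h : ∀ i j, e i j = true ↔ ‖x i - x j‖ ≤ 1) : hkClosed n φ x = graphField φ e x := by
  rw [hkClosed_eq_weightedField]
  unfold graphField weightedField closedIndicator
  funext i
  refine Finset.sum_congr rfl fun j _ => ?_
  simp only [h]

/-- The change of `graphField` caused by an edge between `i` and `j`. -/
noncomputable def edgeField (φ : Fin N → Fin N → ℝ → ℝ) (i j : Fin N) (x : Config n N) :
    Config n N :=
  Pi.single i (kernel φ i j (x j - x i)) + Pi.single j (kernel φ j i (x i - x j))

theorem ip_single_right (z : Config n N) (i : Fin N) (v : EuclideanSpace ℝ (Fin n)) :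
    ip z (Pi.single i v) = inner ℝ (z i) v := by
  rw [ip, Finset.sum_eq_single i]
  · rw [Pi.single_eq_same]
  · intro j _ hj; rw [Pi.single_eq_of_ne hj, inner_zero_right]
  · simp

namespace CouplingBounds

variable (hb : CouplingBounds φ c C L)
include hb

theorem graphField_lipschitz (e : Fin N → Fin N → Bool) :
    ∃ K, LipschitzWith K (graphField φ e : Config n N → Config n N) :=
  hb.weightedField_lipschitz (l := 0) (fun i j _ => by split_ifs <;> simp) (fun i j r s => by simp)

theorem norm_graphField_le (e : Fin N → Fin N → Bool) (x : Config n N) :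
    ‖graphField φ e x‖ ≤ N * C :=
  hb.norm_weightedField_le (fun i j _ => by split_ifs <;> simp) x

theorem ip_edgeField {i j : Fin N} (x z : Config n N) :
    ip z (edgeField φ i j x) = -(kernelCoeff φ i j ‖x i - x j‖ * inner ℝ (z i - z j) (x i - x j)) := by
  rw [edgeField, ip_add_right, ip_single_right, ip_single_right, ← neg_sub (x i) (x j), kernel_neg,
    hb.kernel_symm j i, kernel, inner_neg_right, inner_smul_right, inner_smul_right, inner_sub_left]
  ring

omit hb in
theorem graphField_update {e : Fin N → Fin N → Bool} {i j : Fin N} (hij : i ≠ j) (x : Config n N)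
    (he : e i j = false) (he' : e j i = false) :
    graphField φ (fun a b => e a b || (a == i && b == j) || (a == j && b == i)) x =
      graphField φ e x + edgeField φ i j x := by
  funext a
  simp only [graphField, weightedField, edgeField, Pi.add_apply]
  have hterm : ∀ b, (if (e a b || (a == i && b == j) || (a == j && b == i)) = true then (1 : ℝ)
      else 0) • kernel φ a b (x b - x a) = (if e a b = true then (1 : ℝ) else 0) •
        kernel φ a b (x b - x a) + ((if a = i ∧ b = j then kernel φ a b (x b - x a) else 0) +
          if a = j ∧ b = i then kernel φ a b (x b - x a) else 0) := by
    intro b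
    by_cases h1 : a = i ∧ b = j
    · obtain ⟨rfl, rfl⟩ := h1
      simp [he, hij]
    · by_cases h2 : a = j ∧ b = i
      · obtain ⟨rfl, rfl⟩ := h2
        simp [he', hij.symm]
      · have h1' : (a == i && b == j) = false := by simpa using h1
        have h2' : (a == j && b == i) = false := by simpa using h2
        rw [h1', h2', if_neg h1, if_neg h2]; simp
  rw [Finset.sum_congr rfl fun b _ => hterm b, Finset.sum_add_distrib, Finset.sum_add_distrib]
  congr 1
  congr 1
  · by_cases h : a = i
    · subst h; simp
    · simp [h]
  · by_cases h : a = j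
    · subst h; simp
    · simp [h]

/-- At every state some graph that agrees with the interaction graph off the pairs at distance
`1` strictly contracts its edges and strictly expands its non-edges among these pairs. -/
theorem exists_strict_graph (x : Config n N) : ∃ e : Fin N → Fin N → Bool, ∀ i j,
    (‖x i - x j‖ < 1 → e i j = true) ∧ (1 < ‖x i - x j‖ → e i j = false) ∧
    (‖x i - x j‖ = 1 → e i j = true →
      inner ℝ (graphField φ e x i - graphField φ e x j) (x i - x j) < 0) ∧
    (‖x i - x j‖ = 1 → e i j = false →
      0 < inner ℝ (graphField φ e x i - graphField φ e x j) (x i - x j)) := by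
  classical
  let G := {e : Fin N → Fin N → Bool // (∀ i j, e i j = e j i) ∧ ∀ i j,
    (‖x i - x j‖ < 1 → e i j = true) ∧ (1 < ‖x i - x j‖ → e i j = false)}
  have hne : Nonempty G := ⟨⟨fun i j => decide (‖x i - x j‖ ≤ 1), fun i j => by
    simp only [norm_sub_rev], fun i j => ⟨fun h => by simpa using h.le, fun h => by simpa using h⟩⟩⟩
  -- The graph maximises the squared speed. Toggling a critical edge changes the field `g` by `± E`,
  -- where `E` is its nonzero `edgeField`, so maximality gives `± 2 * ip g E + ip E E ≤ 0` and hence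
  -- a strict sign for `ip g E`. By `ip_edgeField` this is a negative multiple of the rate of the
  -- squared distance.
  obtain ⟨⟨e, hsymm, hcons⟩, hmax⟩ := Finite.exists_max fun e : G =>
    ip (graphField φ e.1 x) (graphField φ e.1 x)
  refine ⟨e, fun i j => ⟨(hcons i j).1, (hcons i j).2, fun h1 h2 => ?_, fun h1 h2 => ?_⟩⟩
  all_goals
    have hij : i ≠ j := by rintro rfl; simp at h1
    have hk := hb.kernelCoeff_pos i j (x i - x j)
    have hself : ip (edgeField φ i j x) (edgeField φ i j x) =
        2 * kernelCoeff φ i j ‖x i - x j‖ ^ 2 := by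
      rw [hb.ip_edgeField]
      have : edgeField φ i j x i - edgeField φ i j x j =
          -(2 * kernelCoeff φ i j ‖x i - x j‖) • (x i - x j) := by
        rw [edgeField, Pi.add_apply, Pi.add_apply, Pi.single_eq_same, Pi.single_eq_same,
          Pi.single_eq_of_ne hij, Pi.single_eq_of_ne hij.symm, ← neg_sub (x i) (x j), kernel_neg,
          hb.kernel_symm j i, kernel]
        module
      rw [this, real_inner_smul_left, real_inner_self_eq_norm_sq, h1]
      ring
  · set e' : Fin N → Fin N → Bool := fun a b => e a b && !(a == i && b == j) && !(a == j && b == i)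
      with he'
    have hgraph : graphField φ e x = graphField φ e' x + edgeField φ i j x := by
      rw [← graphField_update hij x (by simp [he']) (by simp [he'])]
      congr 1
      funext a b
      by_cases hab : a = i ∧ b = j
      · obtain ⟨rfl, rfl⟩ := hab; simp [he', h2]
      · by_cases hab' : a = j ∧ b = i
        · obtain ⟨rfl, rfl⟩ := hab'; simp [he', hsymm a b, h2]
        · have h3 : (a == i && b == j) = false := by simpa using hab
          have h4 : (a == j && b == i) = false := by simpa using hab'
          change e a b = ((e a b && !(a == i && b == j) && !(a == j && b == i)) || (a == i && b == j) ||
            (a == j && b == i))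
          rw [h3, h4]; simp
    have hmem := hmax ⟨e', fun a b => by
        simp only [he', hsymm a b]
        rw [Bool.and_right_comm, Bool.and_comm (b == i), Bool.and_comm (b == j)], fun a b =>
      ⟨fun h => by
        have h3 : (a == i && b == j) = false := by
          rw [Bool.eq_false_iff]; intro hh; simp at hh; rw [hh.1, hh.2] at h; linarith
        have h4 : (a == j && b == i) = false := by
          rw [Bool.eq_false_iff]; intro hh; simp at hh; rw [hh.1, hh.2, norm_sub_rev] at h; linarith
        change (e a b && !(a == i && b == j) && !(a == j && b == i)) = true
        rw [h3, h4, (hcons a b).1 h]; rfl, fun h => by simp [he', (hcons a b).2 h]⟩⟩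
    dsimp only at hmem
    have h3 : graphField φ e' x = graphField φ e x - edgeField φ i j x := by rw [hgraph]; abel
    have h4 := hb.ip_edgeField (i := i) (j := j) x (graphField φ e x)
    rw [h3, ip_sub_left, ip_sub_right, ip_sub_right, hself, ip_comm (edgeField φ i j x), h4] at hmem
    nlinarith
  · set e' : Fin N → Fin N → Bool := fun a b => e a b || (a == i && b == j) || (a == j && b == i)
      with he'
    have hgraph : graphField φ e' x = graphField φ e x + edgeField φ i j x :=
      graphField_update hij x h2 (by rw [hsymm, h2])
    have hmem := hmax ⟨e', fun a b => by
        simp only [he', hsymm a b]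
        rw [Bool.or_right_comm, Bool.and_comm (b == i), Bool.and_comm (b == j)], fun a b =>
      ⟨fun h => by simp [he', (hcons a b).1 h], fun h => by
        have h3 : (a == i && b == j) = false := by
          rw [Bool.eq_false_iff]; intro hh; simp at hh; rw [hh.1, hh.2] at h; linarith
        have h4 : (a == j && b == i) = false := by
          rw [Bool.eq_false_iff]; intro hh; simp at hh; rw [hh.1, hh.2, norm_sub_rev] at h; linarith
        change (e a b || (a == i && b == j) || (a == j && b == i)) = false
        rw [h3, h4, (hcons a b).2 h]; rfl⟩⟩
    dsimp only at hmem
    have h4 := hb.ip_edgeField (i := i) (j := j) x (graphField φ e x)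
    rw [hgraph, ip_add_left, ip_add_right, ip_add_right, hself, ip_comm (edgeField φ i j x), h4] at hmem
    nlinarith

/-- Along the flow of the strict graph, pairs at distance one move at once to the side the graph
prescribes, and other pairs stay on their side for a while. So the frozen graph is the actual one at
small positive times. -/
theorem exists_local_solution (x₀ : Config n N) : ∃ (ε : ℝ) (ξ : ℝ → Config n N), 0 < ε ∧
    ξ 0 = x₀ ∧ ContinuousOn ξ (Icc 0 ε) ∧
      ∀ t ∈ Ioo 0 ε, HasDerivAt ξ (hkClosed n φ (ξ t)) t := by
  obtain ⟨e, he⟩ := hb.exists_strict_graph x₀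
  obtain ⟨K, hK⟩ := hb.graphField_lipschitz (n := n) e
  obtain ⟨ξ, hξ0, hξ⟩ := exists_solution_of_lipschitz_of_bounded hK (hb.norm_graphField_le e) x₀
    one_pos
  have h0 : HasDerivAt ξ (graphField φ e x₀) 0 := hξ0 ▸ hξ 0 (by simp)
  have hev : ∀ᶠ t in 𝓝[>] (0 : ℝ), ∀ i j, e i j = true ↔ ‖ξ t i - ξ t j‖ ≤ 1 := by
    rw [eventually_all]; intro i
    rw [eventually_all]; intro j
    have hij : HasDerivAt (fun t => ξ t i - ξ t j) (graphField φ e x₀ i - graphField φ e x₀ j) 0 :=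
      (hasDerivAt_pi.1 h0 i).fun_sub (hasDerivAt_pi.1 h0 j)
    have hc : Tendsto (fun t => ‖ξ t i - ξ t j‖) (𝓝[>] 0) (𝓝 ‖x₀ i - x₀ j‖) := by
      have := hij.continuousAt.norm.tendsto.mono_left (nhdsWithin_le_nhds (s := Ioi 0))
      simpa [hξ0] using this
    have hsq := hij.norm_sq.hasDerivWithinAt (s := Ioi 0)
    rw [hξ0, real_inner_comm] at hsq
    obtain ⟨h1, h2, h3, h4⟩ := he i j
    rcases lt_trichotomy ‖x₀ i - x₀ j‖ 1 with h | h | h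
    · filter_upwards [hc.eventually_lt_const h] with t ht using iff_of_true (h1 h) ht.le
    · cases hcase : e i j with
      | true =>
        filter_upwards [eventually_lt_of_hasDerivWithinAt_neg hsq (by linarith [h3 h hcase])]
          with t ht
        rw [hξ0, h] at ht
        exact iff_of_true rfl ((sq_le_sq₀ (norm_nonneg _) zero_le_one).1 ht.le)
      | false =>
        filter_upwards [eventually_gt_of_hasDerivWithinAt_pos hsq (by linarith [h4 h hcase])]
          with t ht
        rw [hξ0, h] at ht
        refine iff_of_false (by simp) (not_le.2 ((sq_lt_sq₀ zero_le_one (norm_nonneg _)).1 ht))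
    · filter_upwards [hc.eventually_const_lt h] with t ht
      exact iff_of_false (by simp [h2 h]) (not_le.2 ht)
  obtain ⟨δ, hδ, hδ'⟩ := mem_nhdsGT_iff_exists_Ioo_subset.1 hev
  have hδ0 : (0 : ℝ) < δ := hδ
  refine ⟨min δ 1 / 2, ξ, by positivity, hξ0, ?_, fun t ht => ?_⟩
  · have hm := min_le_right δ 1
    exact HasDerivAt.continuousOn fun t ht => hξ t ⟨by linarith [ht.1], by linarith [ht.2]⟩
  · have hm := min_le_right δ 1
    have hm' := min_le_left δ 1
    rw [hkClosed_eq_graphField (hδ' ⟨ht.1, by linarith [ht.2]⟩)]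
    exact hξ t ⟨by linarith [ht.1], by linarith [ht.2]⟩

theorem existsFrom_caratheodory (x₀ : Config n N) :
    ExistsFrom (IsCaratheodorySolution (hkClosed n φ)) x₀ :=
  exists_global_caratheodory hb.norm_hkClosed_le hb.exists_local_solution x₀

end CouplingBounds
end GraphField

/-! ### Euler polygons and CLSS solutions. -/

section Euler

variable {E : Type*} [NormedAddCommGroup E] [NormedSpace ℝ E] {f : E → E} {η M : ℝ}

/-- The points of the Euler scheme with step `η`. -/
def eulerPoint (f : E → E) (η : ℝ) (x₀ : E) : ℕ → E
  | 0 => x₀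
  | j + 1 => eulerPoint f η x₀ j + η • f (eulerPoint f η x₀ j)

/-- The polygon through the points of the Euler scheme. -/
noncomputable def eulerCurve (f : E → E) (η : ℝ) (x₀ : E) (t : ℝ) : E :=
  eulerPoint f η x₀ ⌊t / η⌋₊ + (t - ⌊t / η⌋₊ * η) • f (eulerPoint f η x₀ ⌊t / η⌋₊)

/-- At the right end the floor jumps to `j + 1`, and the recursion makes both formulas agree there.
Including both ends gives continuity of the polygon. -/
theorem eulerCurve_of_mem (hη : 0 < η) (x₀ : E) {j : ℕ} {t : ℝ}
    (ht : t ∈ Icc (j * η) ((j + 1 : ℕ) * η)) :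
    eulerCurve f η x₀ t = eulerPoint f η x₀ j + (t - j * η) • f (eulerPoint f η x₀ j) := by
  rcases eq_or_lt_of_le ht.2 with h | h
  · have hfl : ⌊t / η⌋₊ = j + 1 := by
      rw [h, mul_div_cancel_right₀ _ hη.ne', Nat.floor_natCast]
    rw [eulerCurve, hfl, h, sub_self, zero_smul, add_zero, eulerPoint]
    push_cast
    rw [add_mul, one_mul, add_sub_cancel_left]
  · have hfl : ⌊t / η⌋₊ = j := by
      rw [Nat.floor_eq_iff (div_nonneg ((mul_nonneg (Nat.cast_nonneg _) hη.le).trans ht.1) hη.le)]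
      refine ⟨(le_div_iff₀ hη).2 ht.1, (div_lt_iff₀ hη).2 ?_⟩
      exact_mod_cast h
    rw [eulerCurve, hfl]

theorem continuousOn_eulerCurve (hη : 0 < η) (x₀ : E) (m : ℕ) :
    ContinuousOn (eulerCurve f η x₀) (Icc 0 (m * η)) := by
  induction m with
  | zero => simp
  | succ m ih =>
    rw [← Icc_union_Icc_eq_Icc (mul_nonneg (Nat.cast_nonneg m) hη.le)
      (show (m : ℝ) * η ≤ (m + 1 : ℕ) * η by push_cast; linarith)]
    refine ih.union_of_isClosed ?_ isClosed_Icc isClosed_Icc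
    refine ContinuousOn.congr (f := fun t => eulerPoint f η x₀ m +
      (t - m * η) • f (eulerPoint f η x₀ m)) (by fun_prop) fun t ht => eulerCurve_of_mem hη x₀ ht

theorem isSampleAndHold_eulerCurve (hη : 0 < η) (x₀ : E) {T : ℝ} (hT : 0 < T) :
    IsSampleAndHold f T η (eulerCurve f η x₀) := by
  -- The nodes are multiples of `η` cut off at `T`. By the choice of `m` only the last one is
  -- affected, so they are strictly increasing.
  set m := ⌈T / η⌉₊ with hm
  have hTm : T ≤ m * η := (div_le_iff₀ hη).1 (Nat.le_ceil _)
  have hlt : ∀ i : ℕ, i < m → i * η < T := fun i hi =>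
    (lt_div_iff₀ hη).1 (Nat.lt_ceil.1 hi)
  have hmin : ∀ i : ℕ, i < m → min (i * η) T = i * η := fun i hi => min_eq_left (hlt i hi).le
  refine ⟨(continuousOn_eulerCurve hη x₀ m).mono (Icc_subset_Icc_right hTm), m,
    fun i => min (i * η) T, ?_, by simp [hT.le], by simp [hTm], fun j => ?_⟩
  · intro i j hij
    have h1 : (i : ℕ) < m := lt_of_lt_of_le hij (Nat.lt_succ_iff.1 j.2)
    have h2 : ((i : ℕ) : ℝ) < (j : ℕ) := by exact_mod_cast hij
    simp only
    rw [hmin i h1]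
    exact lt_min (mul_lt_mul_of_pos_right h2 hη) (hlt i h1)
  · simp only [Fin.val_castSucc, Fin.val_succ]
    rw [hmin j j.2]
    have h3 : min (((j : ℕ) + 1 : ℕ) * η) T ≤ ((j : ℕ) + 1 : ℕ) * η := min_le_left _ _
    have hsub : Ico ((j : ℕ) * η) (min (((j : ℕ) + 1 : ℕ) * η) T) ⊆
        Icc ((j : ℕ) * η) (((j : ℕ) + 1 : ℕ) * η) :=
      fun t ht => ⟨ht.1, ht.2.le.trans h3⟩
    have hpt : eulerCurve f η x₀ ((j : ℕ) * η) = eulerPoint f η x₀ j := by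
      rw [eulerCurve_of_mem hη x₀ (left_mem_Icc.2 (by push_cast; linarith)), sub_self, zero_smul,
        add_zero]
    refine ⟨by push_cast at h3 ⊢; linarith, fun t ht => ?_⟩
    rw [hpt]
    refine HasDerivWithinAt.congr (f := fun t => eulerPoint f η x₀ j +
      (t - (j : ℕ) * η) • f (eulerPoint f η x₀ j)) ?_
      (fun s hs => eulerCurve_of_mem hη x₀ (hsub hs)) (eulerCurve_of_mem hη x₀ (hsub ht))
    have := ((((hasDerivAt_id t).sub_const ((j : ℕ) * η)).smul_const
      (f (eulerPoint f η x₀ j))).const_add (eulerPoint f η x₀ j)).hasDerivWithinAt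
      (s := Ico ((j : ℕ) * η) (min (((j : ℕ) + 1 : ℕ) * η) T))
    simpa using this

theorem norm_eulerCurve_sub_le (hM : ∀ y, ‖f y‖ ≤ M) (hη : 0 < η) (x₀ : E) {t : ℝ} (ht : 0 ≤ t) :
    ‖eulerCurve f η x₀ t - eulerPoint f η x₀ ⌊t / η⌋₊‖ ≤ η * M := by
  have h1 := (le_div_iff₀ hη).1 (Nat.floor_le (div_nonneg ht hη.le))
  have h2 := (div_lt_iff₀ hη).1 (Nat.lt_floor_add_one (t / η))
  rw [eulerCurve, add_sub_cancel_left, norm_smul, Real.norm_of_nonneg (by linarith)]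
  exact mul_le_mul (by linarith) (hM _) (norm_nonneg _) hη.le

/-- Euler polygons with step sizes tending to zero have a limit along an ultrafilter, which is a
global CLSS solution. -/
theorem exists_clss_limit [FiniteDimensional ℝ E] (hM : ∀ y, ‖f y‖ ≤ M) (x₀ : E) {η : ℕ → ℝ}
    (hη : ∀ k, 0 < η k) (hlim : Tendsto η atTop (𝓝 0)) :
    ∃ (U : Ultrafilter ℕ) (x : ℝ → E), ↑U ≤ (atTop : Filter ℕ) ∧ x 0 = x₀ ∧
      IsGlobal (IsCLSSSolution f) x ∧
      ∀ t, 0 ≤ t → Tendsto (fun k => eulerCurve f (η k) x₀ t) U (𝓝 (x t)) := by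
  have hprop : ProperSpace E := FiniteDimensional.proper ℝ E
  have hM0 : 0 ≤ M := (norm_nonneg _).trans (hM x₀)
  have h0 : ∀ k, eulerCurve f (η k) x₀ 0 = x₀ := fun k => by simp [eulerCurve, eulerPoint]
  have hlip : ∀ k T, 0 < T → ∀ s ∈ Icc 0 T, ∀ t ∈ Icc 0 T,
      dist (eulerCurve f (η k) x₀ s) (eulerCurve f (η k) x₀ t) ≤ M * dist s t := by
    intro k T hT s hs t ht
    have := ((isSampleAndHold_eulerCurve (f := f) (hη k) x₀ hT).lipschitzOnWith hM).dist_le_mul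
      s hs t ht
    rwa [Real.coe_toNNReal _ hM0] at this
  -- The ultrafilter yields limits at all times simultaneously, hence one curve on `[0, ∞)`.
  set U : Ultrafilter ℕ := hyperfilter ℕ with hU
  have hUle : (U : Filter ℕ) ≤ atTop := Nat.hyperfilter_le_atTop
  have hex : ∀ t, 0 ≤ t → ∃ l, Tendsto (fun k => eulerCurve f (η k) x₀ t) U (𝓝 l) := by
    intro t ht
    obtain ⟨l, -, hl⟩ := (isCompact_closedBall x₀ (M * (t + 1))).ultrafilter_le_nhds
      (U.map fun k => eulerCurve f (η k) x₀ t) (by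
        rw [le_principal_iff, Ultrafilter.mem_coe, Ultrafilter.mem_map]
        refine Filter.univ_mem' fun k => ?_
        have := hlip k (t + 1) (by linarith) t ⟨ht, by linarith⟩ 0 ⟨le_rfl, by linarith⟩
        rw [h0, Real.dist_eq, sub_zero, abs_of_nonneg ht] at this
        exact this.trans (by nlinarith))
    exact ⟨l, hl⟩
  choose! x hx using hex
  have hx0 : x 0 = x₀ := tendsto_nhds_unique (hx 0 le_rfl) (by simp [h0])
  refine ⟨U, x, hUle, hx0, fun T hT => ?_, hx⟩
  have hxlip : LipschitzOnWith M.toNNReal x (Icc 0 T) :=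
    LipschitzOnWith.of_dist_le_mul fun s hs t ht => by
      rw [Real.coe_toNNReal _ hM0]
      exact le_of_tendsto ((hx s hs.1).dist (hx t ht.1))
        (Eventually.of_forall fun k => hlip k T hT s hs t ht)
  -- Pointwise convergence of equi-Lipschitz curves on a finite net is uniform up to `ε`.
  have hunif : ∀ ε, 0 < ε → ∀ᶠ k in (U : Filter ℕ), ∀ t ∈ Icc 0 T,
      dist (x t) (eulerCurve f (η k) x₀ t) < ε := by
    intro ε hε
    obtain ⟨S, hS, hSf, hcov⟩ := (isCompact_Icc (a := (0 : ℝ)) (b := T)).finite_cover_balls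
      (show 0 < ε / (3 * (M + 1)) by positivity)
    have hev : ∀ᶠ k in (U : Filter ℕ), ∀ s ∈ S, dist (x s) (eulerCurve f (η k) x₀ s) < ε / 3 :=
      (eventually_all_finite hSf).2 fun s hs => by
        have := Metric.tendsto_nhds.1 (hx s (hS hs).1) (ε / 3) (by linarith)
        simpa only [dist_comm] using this
    filter_upwards [hev] with k hk t ht
    obtain ⟨s, hs, hts⟩ := mem_iUnion₂.1 (hcov ht)
    rw [Metric.mem_ball, lt_div_iff₀ (by positivity)] at hts
    have h1 := hxlip.dist_le_mul t ht s (hS hs)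
    have h2 := hlip k T hT s (hS hs) t ht
    rw [Real.coe_toNNReal _ hM0] at h1
    rw [dist_comm s t] at h2
    have h3 := hk s hs
    have h4 := dist_triangle4 (x t) (x s) (eulerCurve f (η k) x₀ s) (eulerCurve f (η k) x₀ t)
    have h5 := dist_nonneg (x := t) (y := s)
    nlinarith
  -- The solution concept asks for a sequence; one is extracted from the ultrafilter for each `T`.
  have hchoose : ∀ j : ℕ, ∃ k ≥ j, ∀ t ∈ Icc 0 T,
      dist (x t) (eulerCurve f (η k) x₀ t) < 1 / ((j : ℝ) + 1) := fun j =>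
    (Filter.Eventually.and (f := (U : Filter ℕ)) (hUle (eventually_ge_atTop j))
      (hunif _ Nat.one_div_pos_of_nat)).exists
  choose κ hκ hκx using hchoose
  refine ⟨hxlip.continuousOn, fun j => η (κ j), fun j => eulerCurve f (η (κ j)) x₀,
    hlim.comp (tendsto_atTop_mono hκ tendsto_id), fun j => ⟨(h0 _).trans hx0.symm,
      isSampleAndHold_eulerCurve (hη _) x₀ hT⟩, ?_⟩
  rw [Metric.tendstoUniformlyOn_iff]
  intro ε hε
  filter_upwards [tendsto_one_div_add_atTop_nhds_zero_nat.eventually_lt_const hε] with j hj t ht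
  exact (hκx j t ht).trans hj

theorem existsFrom_clss [FiniteDimensional ℝ E] (hM : ∀ y, ‖f y‖ ≤ M) (x₀ : E) :
    ExistsFrom (IsCLSSSolution f) x₀ := by
  obtain ⟨U, x, -, h0, hx, -⟩ := exists_clss_limit hM x₀ (η := fun k : ℕ => 1 / ((k : ℝ) + 1))
    (fun k => Nat.one_div_pos_of_nat) tendsto_one_div_add_atTop_nhds_zero_nat
  exact ⟨x, h0, hx⟩

/-- The polygon is within `η k * M` of the last Euler point, so both have the same limit. Only Euler
points need to be computed in the examples. -/
theorem mem_of_eulerPoint_mem (hM : ∀ y, ‖f y‖ ≤ M) {x₀ : E} {η : ℕ → ℝ} {x : ℝ → E}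
    (hη : ∀ k, 0 < η k) (hlim : Tendsto η atTop (𝓝 0)) {U : Ultrafilter ℕ}
    (hU : ↑U ≤ (atTop : Filter ℕ)) {t : ℝ} (ht : 0 ≤ t)
    (hx : Tendsto (fun k => eulerCurve f (η k) x₀ t) U (𝓝 (x t))) {A : Set E} (hA : IsClosed A)
    (h : ∀ k, eulerPoint f (η k) x₀ ⌊t / η k⌋₊ ∈ A) : x t ∈ A := by
  have h1 : Tendsto (fun k => eulerCurve f (η k) x₀ t - eulerPoint f (η k) x₀ ⌊t / η k⌋₊) U
      (𝓝 0) :=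
    squeeze_zero_norm (fun k => norm_eulerCurve_sub_le hM (hη k) x₀ ht)
      (by simpa using (hlim.mono_left hU).mul_const M)
  have h2 := hx.sub h1
  simp only [sub_sub_cancel, sub_zero] at h2
  exact hA.mem_of_tendsto h2 (Eventually.of_forall h)

end Euler

/-! ### Uniqueness of classical solutions. -/

section ClassicalSolutions

variable {n N : ℕ} {φ : Fin N → Fin N → ℝ → ℝ} {c C L T : ℝ}

/-- The pairs of agents at distance at most one. -/
noncomputable def linkGraph (z : Config n N) (i j : Fin N) : Bool := decide (‖z i - z j‖ ≤ 1)

theorem linkGraph_eq_true {z : Config n N} {i j : Fin N} :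
    linkGraph z i j = true ↔ ‖z i - z j‖ ≤ 1 := by
  simp [linkGraph]

theorem hkClosed_eq_linkGraph (z : Config n N) :
    hkClosed n φ z = graphField φ (linkGraph z) z :=
  hkClosed_eq_graphField fun _ _ => linkGraph_eq_true

theorem IsClassicalSolution.hasDerivWithinAt_Ici {E : Type*} [NormedAddCommGroup E]
    [NormedSpace ℝ E] {f : E → E} {x : ℝ → E} (hx : IsClassicalSolution f T x) {t : ℝ}
    (ht : t ∈ Ico 0 T) : HasDerivWithinAt x (f (x t)) (Ici t) t :=
  (hx t (Ico_subset_Icc_self ht)).mono_of_mem_nhdsWithin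
    (Icc_mem_nhdsGE_of_mem ⟨ht.1, ht.2⟩)

namespace CouplingBounds

variable (hb : CouplingBounds φ c C L)
include hb

theorem ip_graphField_self {e : Fin N → Fin N → Bool} (he : ∀ i j, e i j = e j i)
    (z : Config n N) : ip (graphField φ e z) z =
      -(1 / 2) * ∑ i, ∑ j, (if e i j then (1 : ℝ) else 0) *
        (kernelCoeff φ i j ‖z i - z j‖ * ‖z i - z j‖ ^ 2) := by
  rw [graphField, hb.ip_weightedField (fun i j r => by rw [he])]
  simp only [inner_kernel_self]

/-- Beyond distance one the continued kernel dissipates `φ i j 1 * r`. This bounds from below the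
dissipation missing when a link is lost. -/
theorem le_kernelCoeff_mul_sq (i j : Fin N) {r : ℝ} (hr : 1 ≤ r) :
    c ≤ kernelCoeff φ i j r * r ^ 2 := by
  have h1 := hb.lower i j 1 (by simp)
  have h2 := hb.pos
  rw [kernelCoeff, min_eq_right hr, max_eq_right hr,
    show φ i j 1 / r * r ^ 2 = φ i j 1 * r by field_simp]
  nlinarith

/-- Unlinked pairs stay unlinked for a while by continuity. If a link is lost, the energy rate `D`
exceeds the continuous rate `G` of the frozen graph by at least `c / 2`; if none is lost, `D = G`.
Being a derivative at every time, `D` has the Darboux property and cannot jump over the gap. -/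
theorem eventually_linkGraph_eq {x : ℝ → Config n N}
    (hx : IsClassicalSolution (hkClosed n φ) T x) {t : ℝ} (ht : t ∈ Ico 0 T) :
    ∀ᶠ s in 𝓝[>] t, linkGraph (x s) = linkGraph (x t) := by
  set e := linkGraph (x t) with he
  have hsymm : ∀ z : Config n N, ∀ i j, linkGraph z i j = linkGraph z j i := fun z i j => by
    simp only [linkGraph, norm_sub_rev]
  set G : ℝ → ℝ := fun s => ip (graphField φ e (x s)) (x s) with hG
  set D : ℝ → ℝ := fun s => ip (hkClosed n φ (x s)) (x s) with hD
  have hcx : ContinuousWithinAt x (Ioi t) t :=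
    ((hx.hasDerivWithinAt_Ici ht).mono Ioi_subset_Ici_self).continuousWithinAt
  have hcd : ∀ i j, Tendsto (fun s => ‖x s i - x s j‖) (𝓝[>] t) (𝓝 ‖x t i - x t j‖) := fun i j =>
    (((continuous_apply i).continuousAt.tendsto.comp hcx).sub
      ((continuous_apply j).continuousAt.tendsto.comp hcx)).norm
  obtain ⟨K, hK⟩ := hb.graphField_lipschitz (n := n) e
  have hcG : Tendsto G (𝓝[>] t) (𝓝 (D t)) := by
    have h1 : Continuous fun z : Config n N => ip (graphField φ e z) z :=
      continuous_ip hK.continuous continuous_id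
    have h2 : D t = ip (graphField φ e (x t)) (x t) := by
      simp only [hD, hkClosed_eq_linkGraph]; rfl
    rw [h2]
    exact (h1.tendsto (x t)).comp hcx
  have hc := hb.pos
  have hmono : ∀ᶠ s in 𝓝[>] t, ∀ i j, linkGraph (x s) i j = true → e i j = true := by
    rw [eventually_all]; intro i
    rw [eventually_all]; intro j
    by_cases h : ‖x t i - x t j‖ ≤ 1
    · exact Eventually.of_forall fun s _ => linkGraph_eq_true.2 h
    · filter_upwards [(hcd i j).eventually_const_lt (not_le.1 h)] with s hs hs'
      exact absurd (linkGraph_eq_true.1 hs') (not_le.2 hs)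
  -- the energy rate jumps by at least `c / 2` when a link is lost
  have hgap : ∀ s, (∀ i j, linkGraph (x s) i j = true → e i j = true) → linkGraph (x s) ≠ e →
      G s + c / 2 ≤ D s := by
    intro s hs hne
    have h1 : ∃ i j, e i j = true ∧ linkGraph (x s) i j = false := by
      by_contra! hcon
      refine hne (funext fun i => funext fun j => ?_)
      rw [Bool.eq_iff_iff]
      exact ⟨hs i j, fun h => by simpa using hcon i j h⟩
    obtain ⟨i₀, j₀, h2, h3⟩ := h1
    have hterm : ∀ i j, (if linkGraph (x s) i j then (1 : ℝ) else 0) *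
        (kernelCoeff φ i j ‖x s i - x s j‖ * ‖x s i - x s j‖ ^ 2) ≤
        (if e i j then (1 : ℝ) else 0) *
        (kernelCoeff φ i j ‖x s i - x s j‖ * ‖x s i - x s j‖ ^ 2) := by
      intro i j
      have h4 : 0 ≤ kernelCoeff φ i j ‖x s i - x s j‖ * ‖x s i - x s j‖ ^ 2 :=
        mul_nonneg (hb.kernelCoeff_pos i j _).le (sq_nonneg _)
      refine mul_le_mul_of_nonneg_right ?_ h4
      by_cases h5 : linkGraph (x s) i j = true
      · rw [if_pos h5, if_pos (hs i j h5)]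
      · rw [if_neg h5]; split_ifs <;> norm_num
    have hstrict : ∑ i, ∑ j, (if linkGraph (x s) i j then (1 : ℝ) else 0) *
        (kernelCoeff φ i j ‖x s i - x s j‖ * ‖x s i - x s j‖ ^ 2) + c ≤
        ∑ i, ∑ j, (if e i j then (1 : ℝ) else 0) *
        (kernelCoeff φ i j ‖x s i - x s j‖ * ‖x s i - x s j‖ ^ 2) := by
      rw [← le_sub_iff_add_le', ← Finset.sum_sub_distrib]
      simp only [← Finset.sum_sub_distrib]
      have h6 : ∀ i j, 0 ≤ (if e i j then (1 : ℝ) else 0) *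
          (kernelCoeff φ i j ‖x s i - x s j‖ * ‖x s i - x s j‖ ^ 2) -
          (if linkGraph (x s) i j then (1 : ℝ) else 0) *
          (kernelCoeff φ i j ‖x s i - x s j‖ * ‖x s i - x s j‖ ^ 2) := fun i j =>
        sub_nonneg.2 (hterm i j)
      refine le_trans ?_ (Finset.single_le_sum (fun i _ => Finset.sum_nonneg fun j _ => h6 i j)
        (Finset.mem_univ i₀))
      refine le_trans ?_ (Finset.single_le_sum (fun j _ => h6 i₀ j) (Finset.mem_univ j₀))
      rw [h2, h3]
      have h7 : 1 ≤ ‖x s i₀ - x s j₀‖ := by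
        by_contra! h8
        rw [linkGraph_eq_true.2 h8.le] at h3
        exact absurd h3 (by decide)
      simpa using hb.le_kernelCoeff_mul_sq i₀ j₀ h7
    simp only [hG, hD, hkClosed_eq_linkGraph]
    rw [hb.ip_graphField_self (hsymm _), hb.ip_graphField_self (hsymm _)]
    linarith
  have hnear : ∀ᶠ s in 𝓝[>] t, |G s - D t| < c / 8 := by
    have := Metric.tendsto_nhds.1 hcG (c / 8) (by linarith)
    simpa only [Real.dist_eq] using this
  obtain ⟨δ, hδ, hδ'⟩ := mem_nhdsGT_iff_exists_Ioo_subset.1 (hmono.and hnear)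
  have hδt : t < δ := hδ
  filter_upwards [Ioo_mem_nhdsGT (lt_min hδt ht.2)] with s hs
  have hsδ : s < δ := hs.2.trans_le (min_le_left _ _)
  have hsT : s < T := hs.2.trans_le (min_le_right _ _)
  by_contra hne
  have h1 := hgap s (hδ' ⟨hs.1, hsδ⟩).1 hne
  have h2 := abs_lt.1 (hδ' ⟨hs.1, hsδ⟩).2
  have hderiv : ∀ r ∈ Icc t s, HasDerivWithinAt (fun r => ip (x r) (x r) / 2) (D r) (Icc t s) r := by
    intro r hr
    have h3 := (hx r ⟨ht.1.trans hr.1, hr.2.trans hsT.le⟩).mono (Icc_subset_Icc ht.1 hsT.le)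
    have h4 := (hasDerivWithinAt_ip h3 h3).div_const 2
    rw [ip_comm (x r) (hkClosed n φ (x r)), add_self_div_two] at h4
    exact h4
  -- The intermediate value `D t + c / 4` is impossible: with all links kept `D` is below `D t + c /
  -- 8`, with one lost it is above `D t + 3 * c / 8`.
  have hconn := ordConnected_Icc.image_hasDerivWithinAt hderiv
  obtain ⟨r, hr, hDr⟩ := hconn.out (mem_image_of_mem D (left_mem_Icc.2 hs.1.le))
    (mem_image_of_mem D (right_mem_Icc.2 hs.1.le))
    (show D t + c / 4 ∈ Icc (D t) (D s) from ⟨by linarith, by linarith⟩)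
  have hrt : t < r := by
    refine lt_of_le_of_ne hr.1 fun h => ?_
    rw [← h] at hDr; linarith
  obtain ⟨h5, h6⟩ := hδ' ⟨hrt, hr.2.trans_lt hsδ⟩
  have h7 := abs_lt.1 h6
  by_cases h8 : linkGraph (x r) = e
  · have h9 : D r = G r := by simp only [hD, hG, hkClosed_eq_linkGraph, h8]
    linarith
  · linarith [hgap r h5 h8]

/-- Where two solutions meet they have the same link graph, which both keep for a while; there both
solve the same Lipschitz equation. -/
theorem uniqueFrom_classical (x₀ : Config n N) :
    UniqueFrom (IsClassicalSolution (hkClosed n φ)) x₀ := by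
  intro T x y hT hx hy h0 h0'
  refine eqOn_Icc_of_forall_eventuallyEq hx.continuousOn hy.continuousOn (h0.trans h0'.symm)
    fun t ht hxy => ?_
  obtain ⟨K, hK⟩ := hb.graphField_lipschitz (n := n) (linkGraph (x t))
  have hgx := hb.eventually_linkGraph_eq hx ht
  have hgy := hb.eventually_linkGraph_eq hy ht
  rw [← hxy] at hgy
  obtain ⟨δ, hδ, hδ'⟩ := mem_nhdsGT_iff_exists_Ioo_subset.1 (hgx.and hgy)
  have hδt : t < δ := hδ
  filter_upwards [Ioo_mem_nhdsGT (lt_min hδt ht.2)] with s hs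
  have hsδ : s < δ := hs.2.trans_le (min_le_left _ _)
  have hsT : s < T := hs.2.trans_le (min_le_right _ _)
  have hd : ∀ z : ℝ → Config n N, IsClassicalSolution (hkClosed n φ) T z → z t = x t →
      (∀ r ∈ Ioo t δ, linkGraph (z r) = linkGraph (x t)) → ∀ r ∈ Ico t s,
      HasDerivWithinAt z (graphField φ (linkGraph (x t)) (z r)) (Ici r) r := by
    intro z hz hzt hzl r hr
    have h1 := hz.hasDerivWithinAt_Ici ⟨ht.1.trans hr.1, hr.2.trans hsT⟩
    rw [hkClosed_eq_linkGraph] at h1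
    rcases eq_or_lt_of_le hr.1 with rfl | h
    · rwa [hzt] at h1 ⊢
    · rwa [hzl r ⟨h, hr.2.trans hsδ⟩] at h1
  exact ODE_solution_unique (v := fun _ => graphField φ (linkGraph (x t))) (fun _ => hK)
    (hx.continuousOn.mono (Icc_subset_Icc ht.1 hsT.le)) (hd x hx rfl fun r hr => (hδ' hr).1)
    (hy.continuousOn.mono (Icc_subset_Icc ht.1 hsT.le)) (hd y hy hxy.symm fun r hr => (hδ' hr).2)
    hxy (right_mem_Icc.2 hs.1.le)

end CouplingBounds

end ClassicalSolutions

/-! ### A datum without classical solution. -/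

section LineConfigurations

variable {n N : ℕ} {φ : Fin N → Fin N → ℝ → ℝ}

/-- Agents on the line spanned by `u`. -/
noncomputable def lineConfig (u : EuclideanSpace ℝ (Fin n)) (a : Fin N → ℝ) : Config n N :=
  fun i => a i • u

theorem norm_lineConfig_sub {u : EuclideanSpace ℝ (Fin n)} (hu : ‖u‖ = 1) (a : Fin N → ℝ)
    (i j : Fin N) : ‖lineConfig u a i - lineConfig u a j‖ = |a i - a j| := by
  rw [lineConfig, lineConfig, ← sub_smul, norm_smul, hu, mul_one, Real.norm_eq_abs]

theorem hkClosed_lineConfig {u : EuclideanSpace ℝ (Fin n)} (hu : ‖u‖ = 1) (a : Fin N → ℝ) :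
    hkClosed n (unitCoupling N) (lineConfig u a) =
      lineConfig u fun i => ∑ j, if |a i - a j| ≤ 1 then a j - a i else 0 := by
  funext i
  simp only [hkClosed, hkField, closedCutoff, norm_lineConfig_sub hu, unitCoupling]
  change _ = (∑ j, if |a i - a j| ≤ 1 then a j - a i else 0) • u
  rw [Finset.sum_smul]
  refine Finset.sum_congr rfl fun j _ => ?_
  rw [lineConfig, lineConfig, ← sub_smul]
  split_ifs <;> simp

theorem exists_norm_eq_one (hn : 1 ≤ n) : ∃ u : EuclideanSpace ℝ (Fin n), ‖u‖ = 1 :=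
  ⟨EuclideanSpace.single ⟨0, hn⟩ 1, by simp⟩

/-- The agent at 0 is linked to one agent at 1 and three at -1. It starts with velocity -2 and the
agent at 1 with velocity -1, so their critical link breaks at once, although a classical solution
keeps its link graph. -/
theorem not_exists_classicalSolution : ∃ x₀ : Config 1 5, ¬ ∃ x : ℝ → Config 1 5, x 0 = x₀ ∧
    IsClassicalSolution (hkClosed 1 (unitCoupling 5)) 1 x := by
  obtain ⟨u, hu⟩ := exists_norm_eq_one (n := 1) le_rfl
  obtain ⟨c, C, L, hb⟩ := (isCoupling_unitCoupling (N := 5)).exists_bounds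
  refine ⟨lineConfig u fun i => if i = 0 then 0 else if i = 1 then 1 else -1, ?_⟩
  rintro ⟨x, h0, hx⟩
  have hd := (hx.hasDerivWithinAt_Ici (t := 0) (by simp)).mono Ioi_subset_Ici_self
  rw [h0, hkClosed_lineConfig hu] at hd
  have hd01 := ((hasDerivWithinAt_pi.1 hd 0).fun_sub (hasDerivWithinAt_pi.1 hd 1)).norm_sq
  have hlink := hb.eventually_linkGraph_eq hx (t := 0) (by simp)
  have hpos := eventually_gt_of_hasDerivWithinAt_pos hd01 (by
    rw [h0]
    simp only [lineConfig, ← sub_smul, real_inner_smul_left, real_inner_smul_right,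
      real_inner_self_eq_norm_sq, hu, Fin.sum_univ_five]
    norm_num [Fin.ext_iff])
  obtain ⟨s, hs1, hs2⟩ := (hlink.and hpos).exists
  rw [h0, norm_lineConfig_sub hu] at hs2
  have h1 : linkGraph (x 0) 0 1 = true := by
    rw [linkGraph_eq_true, h0, norm_lineConfig_sub hu]; norm_num
  rw [← hs1, linkGraph_eq_true] at h1
  norm_num at hs2
  linarith

end LineConfigurations

/-! ### Curves inside submanifolds. -/

section Cells

variable {E : Type*} [NormedAddCommGroup E] [NormedSpace ℝ E] {f : E → E} {A : Set E}

theorem IsC1Submanifold.exists_isClosed_inter_closedBall {d : ℕ} (hA : IsC1Submanifold A d) {z : E}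
    (hz : z ∈ A) : ∃ r₀ > 0, ∀ r ≤ r₀, IsClosed (A ∩ Metric.closedBall z r) := by
  obtain ⟨k, -, h⟩ := hA
  obtain ⟨V, G, hV, hzV, hG, -, hAV⟩ := h z hz
  obtain ⟨r₀, hr₀, hr₀'⟩ := Metric.nhds_basis_closedBall.mem_iff.1 (hV.mem_nhds hzV)
  refine ⟨r₀, hr₀, fun r hr => ?_⟩
  have hsub : Metric.closedBall z r ⊆ V := (Metric.closedBall_subset_closedBall hr).trans hr₀'
  have h1 : A ∩ Metric.closedBall z r = Metric.closedBall z r ∩ G ⁻¹' {0} := by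
    ext y
    constructor
    · rintro ⟨hy, hy'⟩
      have : y ∈ A ∩ V := ⟨hy, hsub hy'⟩
      rw [hAV] at this
      exact ⟨hy', this.2⟩
    · rintro ⟨hy, hy'⟩
      have : y ∈ A ∩ V := by rw [hAV]; exact ⟨hsub hy, hy'⟩
      exact ⟨this.1, hy⟩
  rw [h1]
  exact (hG.continuousOn.mono hsub).preimage_isClosed_of_isClosed Metric.isClosed_closedBall
    isClosed_singleton

theorem IsSmoothOnSubset.exists_lipschitzOnWith (hf : IsSmoothOnSubset f A) {z : E} (hz : z ∈ A) :
    ∃ (g : E → E) (K : NNReal) (r : ℝ), 0 < r ∧ ContDiffAt ℝ 1 g z ∧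
      LipschitzOnWith K g (Metric.closedBall z r) ∧ EqOn f g (A ∩ Metric.closedBall z r) := by
  obtain ⟨U, g, hU, hzU, hg, hfg⟩ := hf z hz
  have hg1 : ContDiffAt ℝ 1 g z := (hg.contDiffAt (hU.mem_nhds hzU)).of_le (by exact_mod_cast le_top)
  obtain ⟨K, s, hs, hK⟩ := hg1.exists_lipschitzOnWith
  obtain ⟨r, hr, hr'⟩ := Metric.nhds_basis_closedBall.mem_iff.1 (inter_mem hs (hU.mem_nhds hzU))
  exact ⟨g, K, r, hr, hg1, hK.mono (hr'.trans inter_subset_left),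
    hfg.mono (inter_subset_inter_right _ (hr'.trans inter_subset_right))⟩

/-- A tangent, smooth field on a submanifold has local solutions inside the submanifold. -/
theorem exists_solution_in_submanifold [FiniteDimensional ℝ E] {d : ℕ} (hA : IsC1Submanifold A d)
    (htan : ∀ x ∈ A, f x ∈ tangentVectors A x) (hf : IsSmoothOnSubset f A) {z : E} (hz : z ∈ A) :
    ∃ (δ : ℝ) (ξ : ℝ → E), 0 < δ ∧ ξ 0 = z ∧ ∀ t ∈ Icc 0 δ, ξ t ∈ A ∧ HasDerivAt ξ (f (ξ t)) t := by
  have hprop : ProperSpace E := FiniteDimensional.proper ℝ E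
  obtain ⟨r₀, hr₀, hclosed⟩ := hA.exists_isClosed_inter_closedBall hz
  obtain ⟨g, K, r₁, hr₁, hg, hK, hfg⟩ := hf.exists_lipschitzOnWith hz
  obtain ⟨r, hr, hrr₀, hrr₁⟩ : ∃ r > 0, r ≤ r₀ ∧ r ≤ r₁ :=
    ⟨min r₀ r₁, lt_min hr₀ hr₁, min_le_left _ _, min_le_right _ _⟩
  set B := A ∩ Metric.closedBall z r with hB
  have hBclosed : IsClosed B := hclosed r hrr₀
  have hzB : z ∈ B := ⟨hz, Metric.mem_closedBall_self hr.le⟩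
  have hsub := Metric.closedBall_subset_closedBall (x := z) hrr₁
  -- The equation is solved in the ambient space for a smooth local extension `g` of `f`; it remains
  -- to see that `ξ` does not leave `A`.
  obtain ⟨ξ, hξ0, ε, hε, hξ⟩ :=
    hg.exists_forall_mem_closedBall_exists_eq_forall_mem_Ioo_hasDerivAt₀ 0
  have hcont : ContinuousAt ξ 0 := (hξ 0 (by simpa using hε)).continuousAt
  have hev : ∀ᶠ t in 𝓝 (0 : ℝ), ξ t ∈ Metric.ball z (r / 2) ∧ t < ε :=
    (hcont.eventually (by rw [hξ0]; exact Metric.ball_mem_nhds z (by linarith))).and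
      (gt_mem_nhds hε)
  obtain ⟨δ₀, hδ₀, hδ₀'⟩ := Metric.eventually_nhds_iff_ball.1 hev
  have hin : ∀ t ∈ Icc 0 (δ₀ / 2), ξ t ∈ Metric.ball z (r / 2) ∧ HasDerivAt ξ (g (ξ t)) t := by
    intro t ht
    have h1 := hδ₀' t (by
      rw [Metric.mem_ball, Real.dist_eq, sub_zero, abs_of_nonneg ht.1]; linarith [ht.2])
    exact ⟨h1.1, hξ t ⟨by linarith [ht.1], by linarith⟩⟩
  -- The distance to `B` obeys a Gronwall inequality with rate `K`: a curve in `B` through the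
  -- nearest point `p`, with velocity `f p = g p`, follows `ξ` with relative speed at most `K` times
  -- that distance. As the distance starts at 0, it stays 0.
  have hdist : ∀ t ∈ Icc 0 (δ₀ / 2), Metric.infDist (ξ t) B ≤
      gronwallBound 0 K 0 (t - 0) := by
    refine le_gronwallBound_of_liminf_deriv_right_le (f' := fun t => K * Metric.infDist (ξ t) B)
      ?_ ?_ ?_ ?_
    · exact (Metric.continuous_infDist_pt B).comp_continuousOn
        (HasDerivAt.continuousOn fun t ht => (hin t ht).2)
    · intro t ht ρ hρ
      obtain ⟨hball, hd⟩ := hin t (Ico_subset_Icc_self ht)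
      obtain ⟨p, hpB, hp⟩ := hBclosed.exists_infDist_eq_dist ⟨z, hzB⟩ (ξ t)
      rw [Metric.mem_ball] at hball
      -- Since `ξ t` is within `r / 2` of `z ∈ B`, the nearest point lies in the open ball, and the
      -- tangent curve through it stays in `B`.
      have hp1 : dist p z < r := by
        have h1 := Metric.infDist_le_dist_of_mem (x := ξ t) hzB
        have h2 := dist_triangle_left p z (ξ t)
        linarith
      obtain ⟨γ, hγ0, hγA, hγ, hγd⟩ := htan p hpB.1
      have hγ' : HasDerivAt γ (f p) 0 := hγd ▸ (hγ.differentiableAt one_ne_zero).hasDerivAt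
      have hshift : Tendsto (fun s => s - t) (𝓝 t) (𝓝 0) := by
        have : ContinuousAt (fun s => s - t) t := by fun_prop
        simpa [ContinuousAt] using this
      have hw : HasDerivAt (fun s => ξ s - γ (s - t)) (g (ξ t) - f p) t :=
        hd.fun_sub (HasDerivAt.comp_sub_const t t (by rwa [sub_self]))
      have hγB : ∀ᶠ s in 𝓝 t, γ (s - t) ∈ B := by
        have h1 : ∀ᶠ s in 𝓝 (0 : ℝ), γ s ∈ Metric.ball z r :=
          hγ.continuousAt.eventually (by rw [hγ0]; exact Metric.isOpen_ball.mem_nhds hp1)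
        filter_upwards [hshift.eventually (hγA.and h1)] with s hs
        exact ⟨hs.1, Metric.ball_subset_closedBall hs.2⟩
      have hnorm : ‖g (ξ t) - f p‖ < ρ := by
        rw [hfg ⟨hpB.1, hsub hpB.2⟩, ← dist_eq_norm]
        refine (hK.dist_le_mul _ (hsub ?_) _ (hsub hpB.2)).trans_lt (by rwa [← hp])
        rw [Metric.mem_closedBall]; linarith
      refine Eventually.frequently ?_
      filter_upwards [(hw.hasDerivWithinAt (s := Ioi t)).limsup_slope_norm_le hnorm,
        nhdsWithin_le_nhds hγB, self_mem_nhdsWithin] with s hs hsB hts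
      have hts' : 0 < s - t := sub_pos.2 hts
      rw [Real.norm_of_nonneg hts'.le, sub_self, hγ0, ← dist_eq_norm, ← dist_eq_norm, ← hp] at hs
      refine lt_of_le_of_lt (mul_le_mul_of_nonneg_left ?_ (inv_nonneg.2 hts'.le)) hs
      exact sub_le_sub_right (Metric.infDist_le_dist_of_mem hsB) _
    · rw [hξ0, Metric.infDist_zero_of_mem hzB]
    · intro t _; simp
  refine ⟨δ₀ / 2, ξ, by linarith, hξ0, fun t ht => ?_⟩
  have h1 := hdist t ht
  rw [gronwallBound_ε0_δ0] at h1
  have h2 : ξ t ∈ B := (hBclosed.mem_iff_infDist_zero ⟨z, hzB⟩).2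
    (le_antisymm h1 Metric.infDist_nonneg)
  refine ⟨h2.1, ?_⟩
  rw [hfg ⟨h2.1, hsub h2.2⟩]
  exact (hin t ht).2

/-- Bootstrapping: locally `ξ' = g ∘ ξ` with `g` smooth, so `ξ'` is as regular as `ξ`. -/
theorem contDiffOn_of_hasDerivAt (hf : IsSmoothOnSubset f A) {ξ : ℝ → E} {a b : ℝ}
    (h : ∀ t ∈ Ioo a b, ξ t ∈ A ∧ HasDerivAt ξ (f (ξ t)) t) :
    ContDiffOn ℝ (⊤ : ℕ∞) ξ (Ioo a b) := by
  have hc : ContinuousOn ξ (Ioo a b) := HasDerivAt.continuousOn fun t ht => (h t ht).2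
  refine contDiffOn_infty.2 fun m => ?_
  induction m with
  | zero => exact contDiffOn_zero.2 hc
  | succ m ih =>
    push_cast
    rw [contDiffOn_succ_iff_deriv_of_isOpen isOpen_Ioo]
    refine ⟨fun t ht => (h t ht).2.differentiableAt.differentiableWithinAt, by simp, fun t ht => ?_⟩
    obtain ⟨U, g, hU, hzU, hg, hfg⟩ := hf (ξ t) (h t ht).1
    have hgt : ContDiffAt ℝ m g (ξ t) :=
      (hg.contDiffAt (hU.mem_nhds hzU)).of_le (by exact_mod_cast le_top)
    have h1 : ContDiffAt ℝ m (g ∘ ξ) t := hgt.comp t (ih.contDiffAt (Ioo_mem_nhds ht.1 ht.2))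
    refine (h1.congr_of_eventuallyEq ?_).contDiffWithinAt
    filter_upwards [Ioo_mem_nhds ht.1 ht.2,
      (hc.continuousAt (Ioo_mem_nhds ht.1 ht.2)).eventually (hU.mem_nhds hzU)] with s hs hsU
    rw [(h s hs).2.deriv, Function.comp_apply, hfg ⟨(h s hs).1, hsU⟩]

/-- A curve with a continuous right derivative is differentiable. -/
theorem hasDerivAt_of_hasDerivWithinAt_Ici [CompleteSpace E] {x v : ℝ → E} {a b : ℝ}
    (hx : ContinuousOn x (Ico a b)) (hv : ContinuousOn v (Ico a b))
    (hd : ∀ t ∈ Ico a b, HasDerivWithinAt x (v t) (Ici t) t) :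
    ∀ t ∈ Ioo a b, HasDerivAt x (v t) t := by
  intro t ht
  obtain ⟨b', htb', hb'⟩ := exists_between ht.2
  have hsub : Icc a b' ⊆ Ico a b := Icc_subset_Ico_right hb'
  have hab' : a ≤ b' := (ht.1.trans htb').le
  have hvi : ∀ s ∈ Icc a b', IntervalIntegrable v volume a s := fun s hs =>
    ((hv.mono hsub).mono (by rw [uIcc_of_le hs.1]; exact Icc_subset_Icc_right hs.2)).intervalIntegrable
  set F : ℝ → E := fun s => ∫ r in a..s, v r with hF
  have hF' : ∀ s ∈ Ioo a b', HasDerivAt F (v s) s := fun s hs =>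
    intervalIntegral.integral_hasDerivAt_right (hvi s (Ioo_subset_Icc_self hs))
      ((hv.mono hsub).stronglyMeasurableAtFilter_nhdsWithin measurableSet_Icc s |>.filter_mono (by
        rw [nhdsWithin_eq_nhds.2 (Icc_mem_nhds hs.1 hs.2)]))
      ((hv.mono hsub).continuousAt (Icc_mem_nhds hs.1 hs.2))
  have hFc : ContinuousOn F (Icc a b') := by
    have := intervalIntegral.continuousOn_primitive_interval' (hvi b' (right_mem_Icc.2 hab'))
      left_mem_uIcc
    rwa [uIcc_of_le hab'] at this
  have hFright : ∀ s ∈ Ico a b', HasDerivWithinAt F (v s) (Ici s) s := by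
    intro s hs
    rcases eq_or_lt_of_le hs.1 with rfl | h
    · exact hasDerivWithinAt_Ici_of_hasDerivAt_Ioo (g := v) (b := b') hs.2
        ((hFc a (left_mem_Icc.2 hab')).mono Ico_subset_Icc_self) hF'
        (((hv a (hsub (left_mem_Icc.2 hab'))).mono_left (nhdsWithin_le_of_mem
          (mem_of_superset (Ioo_mem_nhdsGT (ht.1.trans ht.2)) Ioo_subset_Ico_self))))
    · exact (hF' s ⟨h, hs.2⟩).hasDerivWithinAt
  have hconst := constant_of_has_deriv_right_zero ((hx.mono hsub).sub hFc) fun s hs => by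
    have := (hd s (hsub (Ico_subset_Icc_self hs))).sub (hFright s hs)
    rwa [sub_self] at this
  refine ((hF' t ⟨ht.1, htb'⟩).add_const (x a - F a)).congr_of_eventuallyEq ?_
  filter_upwards [Icc_mem_nhds ht.1 htb'] with s hs
  have := hconst s hs
  simp only [Pi.sub_apply] at this
  rw [← this]; abel

end Cells

/-! ### Uniqueness for a fixed stratification. -/

section StratifiedUniqueness

variable {E : Type*} [NormedAddCommGroup E] [NormedSpace ℝ E] {f : E → E} {S : Stratification f}
  {T : ℝ} {x : ℝ → E}

theorem Stratification.cell_unique (S : Stratification f) {i j : S.ι} {z : E}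
    (hi : z ∈ S.cell i) (hj : z ∈ S.cell j) : i = j := by
  by_contra h
  exact Set.disjoint_left.1 (S.disjoint_cell i j h) hi hj

theorem Stratification.exists_mem_cell (S : Stratification f) (z : E) : ∃ i, z ∈ S.cell i :=
  mem_iUnion.1 (S.iUnion_cell ▸ mem_univ z)

/-- Inside a type II piece, after its starting time, the solution is already in the assigned type I
cell. Hence the behaviour to the right of `t` is governed by the cell of `x t` alone, whatever the
partition. -/
theorem IsStratifiedSolution.exists_right_structure (hx : IsStratifiedSolution S T x) {t : ℝ}
    (ht : t ∈ Ico 0 T) {i : S.ι} (hi : x t ∈ S.cell i) : ∃ δ, t < δ ∧ δ ≤ T ∧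
      ((i ∈ S.typeI ∧ ∀ s ∈ Ico t δ, x s ∈ S.cell i ∧ HasDerivWithinAt x (f (x s)) (Ici s) s) ∨
       (i ∉ S.typeI ∧ ∀ s ∈ Ioo t δ, x s ∈ S.cell (S.next i) ∧ HasDerivAt x (f (x s)) s)) := by
  obtain ⟨hc, l, τ, cl, hτ, h0, hl, hp⟩ := hx
  obtain ⟨k, hk⟩ := exists_mem_Ico_of_partition h0 hl ht
  refine ⟨τ k.succ, hk.2, hl ▸ hτ.monotone (Fin.le_last _), ?_⟩
  rcases (hp k).2 with ⟨hI, h⟩ | ⟨hII, h1, h2⟩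
  · obtain rfl := S.cell_unique hi (h t hk).1
    refine Or.inl ⟨hI, fun s hs => ?_⟩
    have hs' : s ∈ Ico (τ k.castSucc) (τ k.succ) := ⟨hk.1.trans hs.1, hs.2⟩
    exact ⟨(h s hs').1, (h s hs').2.mono_of_mem_nhdsWithin (mem_of_superset
      (Ico_mem_nhdsGE hs.2) (Ico_subset_Ico_left hs'.1))⟩
  · rcases eq_or_lt_of_le hk.1 with h | h
    · rw [h] at h1
      obtain rfl := S.cell_unique hi h1
      exact Or.inr ⟨hII, fun s hs => h2 s ⟨h ▸ hs.1, hs.2⟩⟩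
    · obtain rfl := S.cell_unique hi (h2 t ⟨h, hk.2⟩).1
      refine Or.inl ⟨S.next_mem _ hII, fun s hs => ?_⟩
      have := h2 s ⟨h.trans_le hs.1, hs.2⟩
      exact ⟨this.1, this.2.hasDerivWithinAt⟩

/-- Solutions that meet are in the same cell. In type I both solve the equation of one Lipschitz
extension of `f`; in type II both are entering curves, which the stratification makes locally
unique. -/
theorem uniqueFrom_stratified [CompleteSpace E] {M : ℝ} (hM : ∀ y, ‖f y‖ ≤ M)
    (S : Stratification f) (x₀ : E) : UniqueFrom (IsStratifiedSolution S) x₀ := by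
  intro T x y hT hx hy h0 h0'
  refine eqOn_Icc_of_forall_eventuallyEq hx.1 hy.1 (h0.trans h0'.symm) fun t ht hxy => ?_
  obtain ⟨i, hi⟩ := S.exists_mem_cell (x t)
  obtain ⟨δ, hδ, hδT, hcx⟩ := hx.exists_right_structure ht hi
  obtain ⟨δ', hδ', hδT', hcy⟩ := hy.exists_right_structure ht (hxy ▸ hi)
  by_cases hI : i ∈ S.typeI
  · replace hcx := (hcx.resolve_right fun h => h.1 hI).2
    replace hcy := (hcy.resolve_right fun h => h.1 hI).2
    obtain ⟨g, K, r, hr, -, hK, hfg⟩ := (S.smooth i hI).exists_lipschitzOnWith hi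
    have hball : ∀ z : ℝ → E, ContinuousOn z (Icc 0 T) → z t = x t →
        ∀ᶠ s in 𝓝[≥] t, z s ∈ Metric.closedBall (x t) r := by
      intro z hz hzt
      have h1 : ContinuousWithinAt z (Ici t) t :=
        (hz t (Ico_subset_Icc_self ht)).mono_of_mem_nhdsWithin (Icc_mem_nhdsGE_of_mem ht)
      exact h1.eventually (by rw [hzt]; exact Metric.closedBall_mem_nhds _ hr)
    obtain ⟨δ₂, hδ₂, hδ₂'⟩ := mem_nhdsGE_iff_exists_Ico_subset.1
      ((hball x hx.1 rfl).and (hball y hy.1 hxy.symm))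
    have hδ₂t : t < δ₂ := hδ₂
    filter_upwards [Ioo_mem_nhdsGT (lt_min (lt_min hδ hδ') hδ₂t)] with s hs
    obtain ⟨hs1, hs2⟩ := lt_min_iff.1 hs.2
    obtain ⟨hs3, hs4⟩ := lt_min_iff.1 hs1
    refine ODE_solution_unique_of_mem_Icc_right (v := fun _ => g)
      (s := fun _ => Metric.closedBall (x t) r) (K := K) (fun _ _ => hK)
      (hx.1.mono (Icc_subset_Icc ht.1 (hs3.le.trans hδT))) (fun q hq => ?_)
      (fun q hq => (hδ₂' ⟨hq.1, hq.2.trans hs2⟩).1)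
      (hy.1.mono (Icc_subset_Icc ht.1 (hs3.le.trans hδT))) (fun q hq => ?_)
      (fun q hq => (hδ₂' ⟨hq.1, hq.2.trans hs2⟩).2) hxy (right_mem_Icc.2 hs.1.le)
    · have h1 := hcx q ⟨hq.1, hq.2.trans hs3⟩
      rw [hfg ⟨h1.1, (hδ₂' ⟨hq.1, hq.2.trans hs2⟩).1⟩] at h1
      exact h1.2
    · have h1 := hcy q ⟨hq.1, hq.2.trans hs4⟩
      rw [hfg ⟨h1.1, (hδ₂' ⟨hq.1, hq.2.trans hs2⟩).2⟩] at h1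
      exact h1.2
  · replace hcx := (hcx.resolve_left fun h => hI h.1).2
    replace hcy := (hcy.resolve_left fun h => hI h.1).2
    obtain ⟨ε, ξ, hε, -, huniq⟩ := S.entering i hI (x t) hi
    set ρ := min ε (min (δ - t) (δ' - t)) with hρ
    have hρ0 : 0 < ρ := lt_min hε (lt_min (by linarith) (by linarith))
    have hρ1 : ρ ≤ δ - t := (min_le_right _ _).trans (min_le_left _ _)
    have hρ2 : ρ ≤ δ' - t := (min_le_right _ _).trans (min_le_right _ _)
    have hent : ∀ (z : ℝ → E) (d : ℝ), IsStratifiedSolution S T z → z t = x t → ρ ≤ d - t → d ≤ T →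
        (∀ s ∈ Ioo t d, z s ∈ S.cell (S.next i) ∧ HasDerivAt z (f (z s)) s) →
        IsEnteringCurve f (S.cell (S.next i)) (x t) ρ fun s => z (t + s) := by
      intro z d hz hzt hρd hdT hzd
      refine ⟨by simpa using hzt, fun b hb => ?_, fun s hs => ?_⟩
      · have hlip : LipschitzOnWith M.toNNReal (fun s => z (t + s)) (Icc 0 b) := by
          refine lipschitzOnWith_of_hasDerivAt_off_countable countable_empty ?_ ?_
            ((norm_nonneg _).trans (hM x₀))
          · exact hz.1.comp (by fun_prop) fun s hs =>
              ⟨by linarith [ht.1, hs.1], by linarith [hs.2, hb.2]⟩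
          · rintro s ⟨hs, -⟩
            exact ⟨_, hM _, ((hzd (t + s) ⟨by linarith [hs.1], by linarith [hs.2, hb.2]⟩).2).comp_const_add
              t s⟩
        refine LipschitzOnWith.absolutelyContinuousOnInterval (K := M.toNNReal) ?_
        rwa [uIcc_of_le hb.1.le]
      · have h1 := hzd (t + s) ⟨by linarith [hs.1], by linarith [hs.2]⟩
        exact ⟨h1.1, h1.2.comp_const_add t s⟩
    have hex := huniq ρ _ hρ0 (min_le_left _ _) (hent x δ hx rfl hρ1 hδT hcx)
    have hey := huniq ρ _ hρ0 (min_le_left _ _) (hent y δ' hy hxy.symm hρ2 hδT' hcy)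
    filter_upwards [Ioo_mem_nhdsGT (show t < t + ρ by linarith)] with s hs
    have hmem : s - t ∈ Ico 0 ρ := ⟨by linarith [hs.1], by linarith [hs.2]⟩
    have h1 := (hex hmem).trans (hey hmem).symm
    simpa using h1

end StratifiedUniqueness

/-! ### Concatenation and continuation of stratified solutions. -/

section Pieces

variable {E : Type*} [NormedAddCommGroup E] [NormedSpace ℝ E] {f : E → E}

/-- `x` moves on `[a, b)` as prescribed by the cell of `x a`. -/
def IsPiece (S : Stratification f) (x : ℝ → E) (a b : ℝ) : Prop :=
  a < b ∧ ContDiffOn ℝ (⊤ : ℕ∞) x (Ioo a b) ∧ ∃ c : S.ι,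
    ((c ∈ S.typeI ∧ ∀ t ∈ Ico a b, x t ∈ S.cell c ∧ HasDerivWithinAt x (f (x t)) (Ico a b) t) ∨
     (c ∉ S.typeI ∧ x a ∈ S.cell c ∧
        ∀ t ∈ Ioo a b, x t ∈ S.cell (S.next c) ∧ HasDerivAt x (f (x t)) t))

variable {S : Stratification f} {x y : ℝ → E} {a b c T : ℝ}

theorem IsPiece.congr (h : IsPiece S x a b) (hxy : EqOn x y (Ico a b)) : IsPiece S y a b := by
  obtain ⟨hab, hs, i, h⟩ := h
  refine ⟨hab, hs.congr fun t ht => (hxy (Ioo_subset_Ico_self ht)).symm, i, ?_⟩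
  rcases h with ⟨hI, h⟩ | ⟨hII, h1, h⟩
  · refine Or.inl ⟨hI, fun t ht => ?_⟩
    rw [← hxy ht]
    exact ⟨(h t ht).1, (h t ht).2.congr (fun s hs => (hxy hs).symm) (hxy ht).symm⟩
  · refine Or.inr ⟨hII, hxy (left_mem_Ico.2 hab) ▸ h1, fun t ht => ?_⟩
    rw [← hxy (Ioo_subset_Ico_self ht)]
    exact ⟨(h t ht).1, (h t ht).2.congr_of_eventuallyEq
      ((hxy.symm.mono Ioo_subset_Ico_self).eventuallyEq_of_mem (Ioo_mem_nhds ht.1 ht.2))⟩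

theorem IsPiece.restrict (h : IsPiece S x a b) (hac : a < c) (hcb : c ≤ b) : IsPiece S x a c := by
  obtain ⟨hab, hs, i, h⟩ := h
  refine ⟨hac, hs.mono (Ioo_subset_Ioo_right hcb), i, ?_⟩
  rcases h with ⟨hI, h⟩ | ⟨hII, h1, h⟩
  · exact Or.inl ⟨hI, fun t ht => ⟨(h t (Ico_subset_Ico_right hcb ht)).1,
      (h t (Ico_subset_Ico_right hcb ht)).2.mono (Ico_subset_Ico_right hcb)⟩⟩
  · exact Or.inr ⟨hII, h1, fun t ht => h t (Ioo_subset_Ioo_right hcb ht)⟩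

theorem IsPiece.shift (h : IsPiece S x a b) (T : ℝ) :
    IsPiece S (fun t => x (t - T)) (a + T) (b + T) := by
  obtain ⟨hab, hs, i, h⟩ := h
  have hmem : ∀ t, t ∈ Ioo (a + T) (b + T) → t - T ∈ Ioo a b := fun t ht =>
    ⟨by linarith [ht.1], by linarith [ht.2]⟩
  have hmem' : ∀ t, t ∈ Ico (a + T) (b + T) → t - T ∈ Ico a b := fun t ht =>
    ⟨by linarith [ht.1], by linarith [ht.2]⟩
  refine ⟨by linarith, hs.comp (by fun_prop) hmem, i, ?_⟩
  rcases h with ⟨hI, h⟩ | ⟨hII, h1, h⟩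
  · refine Or.inl ⟨hI, fun t ht => ⟨(h _ (hmem' t ht)).1, ?_⟩⟩
    have h2 : HasDerivWithinAt (fun t => t - T) 1 (Ico (a + T) (b + T)) t :=
      ((hasDerivAt_id t).sub_const T).hasDerivWithinAt
    have := HasDerivWithinAt.scomp t (h _ (hmem' t ht)).2 h2 hmem'
    rwa [one_smul] at this
  · refine Or.inr ⟨hII, by simpa using h1, fun t ht => ⟨(h _ (hmem t ht)).1, ?_⟩⟩
    exact HasDerivAt.comp_sub_const t T (h _ (hmem t ht)).2

theorem le_of_reflTransGen_isPiece (h : Relation.ReflTransGen (IsPiece S x) a b) : a ≤ b := by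
  induction h with
  | refl => exact le_rfl
  | tail _ h ih => exact ih.trans h.1.le

theorem reflTransGen_isPiece_congr (h : Relation.ReflTransGen (IsPiece S x) a b)
    (hxy : EqOn x y (Ico a b)) : Relation.ReflTransGen (IsPiece S y) a b := by
  induction h with
  | refl => exact .refl
  | tail h1 h ih =>
    refine .tail (ih (hxy.mono (Ico_subset_Ico_right h.1.le))) (h.congr (hxy.mono ?_))
    exact Ico_subset_Ico_left (le_of_reflTransGen_isPiece h1)

theorem reflTransGen_isPiece_restrict (h : Relation.ReflTransGen (IsPiece S x) a b)
    (hac : a ≤ c) (hcb : c ≤ b) : Relation.ReflTransGen (IsPiece S x) a c := by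
  induction h with
  | refl => rw [le_antisymm hcb hac]
  | @tail b' b'' h1 h ih =>
    rcases le_or_gt c b' with h2 | h2
    · exact ih h2
    · exact .tail h1 (h.restrict h2 hcb)

/-- Chains of pieces replace the indexed partition, so restriction, shift and concatenation become
inductions on the chain. -/
theorem isStratifiedSolution_iff : IsStratifiedSolution S T x ↔
    ContinuousOn x (Icc 0 T) ∧ Relation.ReflTransGen (IsPiece S x) 0 T := by
  constructor
  · rintro ⟨hc, l, τ, cl, hτ, h0, hl, hp⟩
    refine ⟨hc, ?_⟩
    have : ∀ k : Fin (l + 1), Relation.ReflTransGen (IsPiece S x) 0 (τ k) := fun k => by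
      induction k using Fin.induction with
      | zero => rw [h0]
      | succ k ih =>
        exact .tail ih ⟨hτ k.castSucc_lt_succ, (hp k).1, cl k, (hp k).2⟩
    rw [← hl]; exact this _
  · rintro ⟨hc, h⟩
    have : ∃ (l : ℕ) (τ : Fin (l + 1) → ℝ), StrictMono τ ∧ τ 0 = 0 ∧ τ (Fin.last l) = T ∧
        ∀ k : Fin l, IsPiece S x (τ k.castSucc) (τ k.succ) := by
      clear hc
      induction h with
      | refl => exact ⟨0, fun _ => 0, Fin.strictMono_iff_lt_succ.2 fun k => k.elim0, rfl, rfl, fun k => k.elim0⟩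
      | @tail b b' h1 h ih =>
        obtain ⟨l, τ, hτ, h0, hl, hp⟩ := ih
        have hp' : ∀ k : Fin (l + 1), IsPiece S x ((Fin.snoc τ b' : Fin (l + 2) → ℝ) k.castSucc)
            ((Fin.snoc τ b' : Fin (l + 2) → ℝ) k.succ) := fun k => by
          induction k using Fin.lastCases with
          | last => rw [Fin.succ_last, Fin.snoc_last, Fin.snoc_castSucc, hl]; exact h
          | cast k => rw [Fin.succ_castSucc, Fin.snoc_castSucc, Fin.snoc_castSucc]; exact hp k
        refine ⟨l + 1, Fin.snoc τ b', Fin.strictMono_iff_lt_succ.2 fun k => (hp' k).1, ?_,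
          Fin.snoc_last _ _, hp'⟩
        have := Fin.snoc_castSucc (α := fun _ => ℝ) b' τ 0
        rw [Fin.castSucc_zero] at this
        rw [this, h0]
    obtain ⟨l, τ, hτ, h0, hl, hp⟩ := this
    choose h1 h2 cl h3 using hp
    exact ⟨hc, l, τ, cl, hτ, h0, hl, fun k => ⟨h2 k, h3 k⟩⟩

theorem IsStratifiedSolution.restrict (h : IsStratifiedSolution S T x) {s : ℝ} (hs : 0 ≤ s)
    (hsT : s ≤ T) : IsStratifiedSolution S s x := by
  rw [isStratifiedSolution_iff] at h ⊢
  exact ⟨h.1.mono (Icc_subset_Icc_right hsT), reflTransGen_isPiece_restrict h.2 hs hsT⟩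

theorem IsStratifiedSolution.congr (h : IsStratifiedSolution S T x) (hxy : EqOn x y (Icc 0 T)) :
    IsStratifiedSolution S T y := by
  rw [isStratifiedSolution_iff] at h ⊢
  exact ⟨h.1.congr hxy.symm, reflTransGen_isPiece_congr h.2 (hxy.mono Ico_subset_Icc_self)⟩

theorem IsStratifiedSolution.concat {s : ℝ} (hT : 0 ≤ T) (h : IsStratifiedSolution S T x)
    (hs : 0 ≤ s) (hy : IsStratifiedSolution S s y) (hxy : x T = y 0) :
    IsStratifiedSolution S (T + s) (concat T x y) := by
  rw [isStratifiedSolution_iff] at h hy ⊢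
  refine ⟨continuousOn_concat hT hs h.1 hy.1 hxy, ?_⟩
  have h1 := reflTransGen_isPiece_congr h.2
    ((eqOn_concat T x y).mono fun t ht => le_of_lt (show t < T from ht.2))
  refine h1.trans ?_
  have h2 : Relation.ReflTransGen (IsPiece S fun t => y (t - T)) (0 + T) (s + T) :=
    Relation.ReflTransGen.lift (r := IsPiece S y) (fun r => r + T) (fun a b hab => IsPiece.shift hab T) _ _ hy.2
  rw [zero_add, add_comm] at h2
  exact reflTransGen_isPiece_congr h2 ((eqOn_concat_right hxy).mono fun t ht => ht.1)

theorem IsPiece.isStratifiedSolution (hc : ContinuousOn x (Icc 0 T)) (h : IsPiece S x 0 T) :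
    IsStratifiedSolution S T x :=
  isStratifiedSolution_iff.2 ⟨hc, .single h⟩

variable [FiniteDimensional ℝ E]

theorem exists_local_stratifiedSolution (S : Stratification f) (z : E) : ∃ (ε : ℝ) (ξ : ℝ → E),
    0 < ε ∧ ξ 0 = z ∧ IsStratifiedSolution S ε ξ := by
  obtain ⟨i, hi⟩ := S.exists_mem_cell z
  by_cases hI : i ∈ S.typeI
  · obtain ⟨δ, ξ, hδ, h0, h⟩ := exists_solution_in_submanifold (S.isC1Submanifold i)
      (S.tangent i hI) (S.smooth i hI) hi
    refine ⟨δ, ξ, hδ, h0, IsPiece.isStratifiedSolution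
      (HasDerivAt.continuousOn fun t ht => (h t ht).2) ⟨hδ, contDiffOn_of_hasDerivAt (S.smooth i hI)
        fun t ht => h t (Ioo_subset_Icc_self ht), i, Or.inl ⟨hI, fun t ht => ?_⟩⟩⟩
    have := h t (Ico_subset_Icc_self ht)
    exact ⟨this.1, this.2.hasDerivWithinAt⟩
  · obtain ⟨ε, ξ, hε, ⟨h0, hac, h⟩, -⟩ := S.entering i hI z hi
    have h' : ∀ t ∈ Ioo 0 (ε / 2), ξ t ∈ S.cell (S.next i) ∧ HasDerivAt ξ (f (ξ t)) t :=
      fun t ht => h t ⟨ht.1, by linarith [ht.2]⟩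
    refine ⟨ε / 2, ξ, by linarith, h0, IsPiece.isStratifiedSolution ?_ ⟨by linarith,
      contDiffOn_of_hasDerivAt (S.smooth _ (S.next_mem i hI)) h', i, Or.inr ⟨hI, h0 ▸ hi, h'⟩⟩⟩
    have := (hac (ε / 2) ⟨by linarith, by linarith⟩).continuousOn
    rwa [uIcc_of_le (by linarith)] at this

/-- The hypothesis `hS` serves only to close up at a finite end `τ`. Near `τ` the solution stays in
one cell, necessarily of type I because a type II cell is left at once, and this last stretch forms
a single piece. -/
theorem existsFrom_stratified {M : ℝ} (hM : ∀ y, ‖f y‖ ≤ M) {S : Stratification f} {x₀ : E}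
    (hS : NoAccumulationFrom S x₀) : ExistsFrom (IsStratifiedSolution S) x₀ := by
  suffices h : ∃ x, ∀ T, 0 < T → 0 < T → x 0 = x₀ ∧ IsStratifiedSolution S T x by
    obtain ⟨x, hx⟩ := h
    exact ⟨x, (hx 1 one_pos one_pos).1, fun T hT => (hx T hT hT).2⟩
  refine exists_global_of_extension (fun T x => 0 < T → x 0 = x₀ ∧ IsStratifiedSolution S T x)
    ?_ ?_ ?_ ?_ ?_
  · rintro T x y hx hxy hT
    exact ⟨by rw [← hxy ⟨le_rfl, hT.le⟩, (hx hT).1], (hx hT).2.congr hxy⟩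
  · rintro s T x hs hsT hx -
    obtain ⟨h0, h⟩ := hx (hs.trans_le hsT)
    exact ⟨h0, h.restrict hs.le hsT⟩
  · obtain ⟨ε, ξ, hε, h0, hξ⟩ := exists_local_stratifiedSolution S x₀
    exact ⟨ε, ξ, hε, fun _ => ⟨h0, hξ⟩⟩
  · rintro T x hT hx
    obtain ⟨h0, h⟩ := hx hT
    obtain ⟨ε, ξ, hε, hξ0, hξ⟩ := exists_local_stratifiedSolution S (x T)
    exact ⟨T + ε, concat T x ξ, by linarith, (eqOn_concat T x ξ).mono Icc_subset_Iic_self,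
      fun _ => ⟨by rw [← eqOn_concat T x ξ hT.le, h0], h.concat hT.le hε.le hξ hξ0.symm⟩⟩
  · rintro τ x hτ hx
    have hsol : ∀ T, 0 < T → T < τ → IsStratifiedSolution S T x := fun T h0 hT => (hx T h0 hT h0).2
    have hx0 : x 0 = x₀ := (hx (τ / 2) (by linarith) (by linarith) (by linarith)).1
    obtain ⟨s, hs, i, hi⟩ := hS τ x hτ hx0 hsol
    have hlip : LipschitzOnWith M.toNNReal x (Ico 0 τ) := by
      intro a ha b hb
      obtain ⟨T, hT, hT'⟩ := exists_between (max_lt (max_lt ha.2 hb.2) hτ)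
      simp only [max_lt_iff] at hT
      exact ((hsol T hT.2 hT').isCaratheodorySolution hT.2.le hM).isKrasovskiiSolution.lipschitzOnWith
        hT.2.le hM ⟨ha.1, hT.1.1.le⟩ ⟨hb.1, hT.1.2.le⟩
    obtain ⟨y, hxy, hy⟩ := exists_continuousOn_Icc_of_lipschitzOnWith hτ hlip
    obtain ⟨s', hss', hs'τ⟩ := exists_between hs.2
    have hs'0 : 0 < s' := hs.1.trans_lt hss'
    have hmem : ∀ t ∈ Ico s' τ, x t ∈ S.cell i := fun t ht => hi t ⟨hss'.trans_le ht.1, ht.2⟩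
    have hstruct : ∀ t ∈ Ico s' τ, i ∈ S.typeI ∧ HasDerivWithinAt x (f (x t)) (Ici t) t := by
      intro t ht
      obtain ⟨T, hT, hTτ⟩ := exists_between ht.2
      have ht0 : 0 < t := hs'0.trans_le ht.1
      obtain ⟨δ, htδ, hδT, h⟩ := (hsol T (ht0.trans hT) hTτ).exists_right_structure ⟨ht0.le, hT⟩
        (hmem t ht)
      rcases h with ⟨hI, h⟩ | ⟨hII, h⟩
      · exact ⟨hI, (h t ⟨le_rfl, htδ⟩).2⟩
      · obtain ⟨r, hr, hr'⟩ := exists_between htδ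
        have h1 := S.cell_unique (h r ⟨hr, hr'⟩).1
          (hmem r ⟨ht.1.trans hr.le, (hr'.trans_le hδT).trans hTτ⟩)
        exact absurd (h1 ▸ S.next_mem i hII) hII
    have hI := (hstruct s' ⟨le_rfl, hs'τ⟩).1
    have hxc : ContinuousOn x (Ico s' τ) := hlip.continuousOn.mono (Ico_subset_Ico_left hs'0.le)
    have hfx : ContinuousOn (fun t => f (x t)) (Ico s' τ) := by
      intro t ht
      obtain ⟨g, K, r, hr, hg, -, hfg⟩ := (S.smooth i hI).exists_lipschitzOnWith (hmem t ht)
      have h1 : ContinuousWithinAt (fun t => g (x t)) (Ico s' τ) t :=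
        hg.continuousAt.comp_continuousWithinAt (hxc t ht)
      have hxt : x t ∈ S.cell i ∩ Metric.closedBall (x t) r :=
        ⟨hmem t ht, Metric.mem_closedBall_self hr.le⟩
      refine h1.congr_of_eventuallyEq ?_ (hfg hxt)
      filter_upwards [(hxc t ht).eventually (Metric.closedBall_mem_nhds _ hr), self_mem_nhdsWithin]
        with q hq hq' using hfg ⟨hmem q hq', hq⟩
    -- Piece ends may occur inside the stretch, so only right derivatives are known. They are
    -- continuous, which excludes corners.
    have hderiv := hasDerivAt_of_hasDerivWithinAt_Ici hxc hfx fun t ht => (hstruct t ht).2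
    have hpiece : IsPiece S x s' τ := by
      refine ⟨hs'τ, contDiffOn_of_hasDerivAt (S.smooth i hI) fun t ht =>
        ⟨hmem t (Ioo_subset_Ico_self ht), hderiv t ht⟩, i, Or.inl ⟨hI, fun t ht =>
          ⟨hmem t ht, ?_⟩⟩⟩
      rcases eq_or_lt_of_le ht.1 with rfl | h
      · exact (hstruct s' ht).2.mono fun r hr => hr.1
      · exact (hderiv t ⟨h, ht.2⟩).hasDerivWithinAt
    refine ⟨y, hxy, fun _ => ⟨by rw [← hxy ⟨le_rfl, hτ⟩, hx0], isStratifiedSolution_iff.2 ⟨hy, ?_⟩⟩⟩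
    refine reflTransGen_isPiece_congr (.tail ?_ hpiece) hxy
    exact (isStratifiedSolution_iff.1 (hsol s' hs'0 hs'τ)).2

end Pieces

/-! ### Constant solutions. -/

section Equilibria

variable {E : Type*} [NormedAddCommGroup E] [NormedSpace ℝ E] {f : E → E} {x₀ : E} {T : ℝ}

theorem isClassicalSolution_const (h : f x₀ = 0) : IsClassicalSolution f T fun _ => x₀ :=
  fun t _ => by rw [h]; exact hasDerivWithinAt_const _ _ _

theorem isCaratheodorySolution_const (h : f x₀ = 0) : IsCaratheodorySolution f T fun _ => x₀ :=
  ⟨LipschitzOnWith.absolutelyContinuousOnInterval (K := 0)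
    ((LipschitzWith.const x₀).lipschitzOnWith), Eventually.of_forall fun t => by
      rw [h]; exact hasDerivAt_const _ _⟩

theorem isCLSSSolution_const (hT : 0 < T) (h : f x₀ = 0) : IsCLSSSolution f T fun _ => x₀ := by
  have hpt : ∀ η j, eulerPoint f η x₀ j = x₀ := fun η j => by
    induction j with
    | zero => rfl
    | succ j ih => rw [eulerPoint, ih, h, smul_zero, add_zero]
  have hcurve : ∀ η, eulerCurve f η x₀ = fun _ => x₀ := fun η => by
    funext t
    rw [eulerCurve, hpt, h, smul_zero, add_zero]
  refine ⟨continuousOn_const, fun k : ℕ => 1 / ((k : ℝ) + 1), fun _ _ => x₀,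
    tendsto_one_div_add_atTop_nhds_zero_nat, fun k => ⟨rfl, ?_⟩, ?_⟩
  · have := isSampleAndHold_eulerCurve (f := f) (η := 1 / ((k : ℝ) + 1)) Nat.one_div_pos_of_nat x₀ hT
    rwa [hcurve] at this
  · rw [Metric.tendstoUniformlyOn_iff]
    exact fun ε hε => Eventually.of_forall fun k t _ => by simpa using hε

theorem eq_zero_of_isCaratheodorySolution_const (hT : 0 < T)
    (h : IsCaratheodorySolution f T fun _ => x₀) : f x₀ = 0 := by
  have hne : (volume.restrict (Icc (0 : ℝ) T)) ≠ 0 := by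
    rw [Ne, Measure.restrict_eq_zero, Real.volume_Icc]
    simpa using hT
  have : (ae (volume.restrict (Icc (0 : ℝ) T))).NeBot := ae_neBot.2 hne
  obtain ⟨t, ht⟩ := h.2.exists
  exact ht.unique (hasDerivAt_const t x₀)

end Equilibria

/-! ### A pair at distance one separates the original model from the variant. -/

section CriticalPair

variable {n N : ℕ} {φ : Fin N → Fin N → ℝ → ℝ} {c C L T : ℝ}

/-- A pair of agents at distance one, all other distances being large. -/
structure IsCriticalPair (x₀ : Config n N) (i j : Fin N) : Prop where
  dist_eq : ‖x₀ i - x₀ j‖ = 1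
  left : ∀ k, k ≠ i → k ≠ j → 2 ≤ ‖x₀ i - x₀ k‖
  right : ∀ k, k ≠ i → k ≠ j → 2 ≤ ‖x₀ j - x₀ k‖
  other : ∀ k l, k ≠ l → 1 ≤ ‖x₀ k - x₀ l‖

theorem exists_isCriticalPair (hn : 1 ≤ n) (hN : 2 ≤ N) :
    ∃ (x₀ : Config n N) (i j : Fin N), IsCriticalPair x₀ i j := by
  obtain ⟨u, hu⟩ := exists_norm_eq_one hn
  -- The positions are 0, 1, 20, 30, and so on.
  refine ⟨lineConfig u fun k => if k.val = 1 then 1 else 10 * k.val, ⟨0, by omega⟩, ⟨1, by omega⟩, ?_⟩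
  have hge : ∀ k : Fin N, k ≠ ⟨0, by omega⟩ → k ≠ ⟨1, by omega⟩ → (2 : ℝ) ≤ (k.val : ℝ) ∧ k.val ≠ 1 := by
    intro k h0 h1
    have h0' : k.val ≠ 0 := fun h => h0 (Fin.ext h)
    have h1' : k.val ≠ 1 := fun h => h1 (Fin.ext h)
    exact ⟨by exact_mod_cast (show 2 ≤ k.val by omega), h1'⟩
  constructor
  · rw [norm_lineConfig_sub hu]; norm_num
  · intro k h0 h1
    obtain ⟨h2, h3⟩ := hge k h0 h1
    rw [norm_lineConfig_sub hu, if_neg h3, le_abs]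
    right; simp; linarith
  · intro k h0 h1
    obtain ⟨h2, h3⟩ := hge k h0 h1
    rw [norm_lineConfig_sub hu, if_neg h3, le_abs]
    right; simp; linarith
  · intro k l hkl
    have hkl' : k.val ≠ l.val := fun h => hkl (Fin.ext h)
    rw [norm_lineConfig_sub hu, le_abs]
    have hcase : k.val + 1 ≤ l.val ∨ l.val + 1 ≤ k.val := by omega
    have key : ∀ a b : ℕ, a + 1 ≤ b → (1 : ℝ) ≤ (if b = 1 then 1 else 10 * (b : ℝ)) -
        (if a = 1 then 1 else 10 * (a : ℝ)) := by
      intro a b hab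
      have hab' : (a : ℝ) + 1 ≤ b := by exact_mod_cast hab
      by_cases hb : b = 1
      · have ha : a = 0 := by omega
        subst hb ha; norm_num
      · rw [if_neg hb]
        split_ifs with ha
        · have : (2 : ℝ) ≤ b := by exact_mod_cast (show 2 ≤ b by omega)
          linarith
        · linarith
    rcases hcase with h | h
    · right; have := key _ _ h; linarith
    · left; exact key _ _ h

theorem IsCriticalPair.hkOpen_eq_zero {x₀ : Config n N} {i j : Fin N} (h : IsCriticalPair x₀ i j) :
    hkOpen n φ x₀ = 0 := by
  funext k
  simp only [hkOpen, hkField, openCutoff, Pi.zero_apply]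
  refine Finset.sum_eq_zero fun l _ => ?_
  by_cases hkl : k = l
  · rw [hkl, sub_self, smul_zero]
  · rw [if_neg (not_lt.2 (h.other k l hkl)), zero_smul]

theorem hkClosed_apply_of_isolated {y : Config n N} {i j : Fin N} (hij : ‖y i - y j‖ ≤ 1)
    (h : ∀ k, k ≠ i → k ≠ j → 1 < ‖y i - y k‖) :
    hkClosed n φ y i = φ i j ‖y i - y j‖ • (y j - y i) := by
  simp only [hkClosed, hkField, closedCutoff]
  rw [Finset.sum_eq_single j]
  · rw [if_pos hij]
  · intro k _ hkj
    by_cases hki : k = i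
    · rw [hki, sub_self, smul_zero]
    · rw [if_neg (not_le.2 (h k hki hkj)), zero_smul]
  · simp

theorem IsCriticalPair.hkClosed_sub_apply {x₀ y : Config n N} {i j : Fin N}
    (h : IsCriticalPair x₀ i j) (hy : ‖y - x₀‖ ≤ 1 / 8) (hij : ‖y i - y j‖ ≤ 1) :
    hkClosed n φ y i - hkClosed n φ y j =
      -((φ i j ‖y i - y j‖ + φ j i ‖y i - y j‖) • (y i - y j)) := by
  have hk : ∀ k, ‖y k - x₀ k‖ ≤ 1 / 8 := fun k => (norm_le_pi_norm (y - x₀) k).trans hy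
  have hfar : ∀ k l, 2 ≤ ‖x₀ k - x₀ l‖ → 1 < ‖y k - y l‖ := by
    intro k l hkl
    have h1 : x₀ k - x₀ l = (y k - y l) - (y k - x₀ k) + (y l - x₀ l) := by abel
    have h2 := norm_add_le ((y k - y l) - (y k - x₀ k)) (y l - x₀ l)
    have h3 := norm_sub_le (y k - y l) (y k - x₀ k)
    rw [← h1] at h2
    linarith [hk k, hk l]
  rw [hkClosed_apply_of_isolated hij fun k h0 h1 => hfar _ _ (h.left k h0 h1),
    hkClosed_apply_of_isolated (by rwa [norm_sub_rev]) fun k h0 h1 => hfar _ _ (h.right k h1 h0),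
    norm_sub_rev (y j) (y i)]
  module

theorem IsCriticalPair.hkClosed_ne_zero {x₀ : Config n N} {i j : Fin N}
    (h : IsCriticalPair x₀ i j) (hb : CouplingBounds φ c C L) : hkClosed n φ x₀ ≠ 0 := by
  intro h0
  have h1 := h.hkClosed_sub_apply (φ := φ) (y := x₀) (by simp) h.dist_eq.le
  rw [h0, Pi.zero_apply, Pi.zero_apply, sub_zero, eq_comm, neg_eq_zero, smul_eq_zero] at h1
  have h2 := hb.lower i j 1 (by simp)
  have h3 := hb.lower j i 1 (by simp)
  have h4 := hb.pos
  rcases h1 with h1 | h1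
  · rw [h.dist_eq] at h1; linarith
  · have := h.dist_eq
    rw [h1, norm_zero] at this; linarith

theorem quarter_le_inner_of_near {F : Type*} [NormedAddCommGroup F] [InnerProductSpace ℝ F]
    {a b u : F} (hu : ‖u‖ = 1) (ha : ‖a - u‖ ≤ 1 / 4) (hb : ‖b - u‖ ≤ 1 / 4) :
    1 / 4 ≤ inner ℝ a b := by
  have h1 : inner ℝ a b = inner ℝ (a - u) (b - u) + inner ℝ u (b - u) + inner ℝ (a - u) u + 1 := by
    have : inner ℝ u u = (1 : ℝ) := by rw [real_inner_self_eq_norm_sq, hu, one_pow]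
    simp only [inner_sub_left, inner_sub_right, this]; ring
  have h2 := abs_le.1 (abs_real_inner_le_norm (a - u) (b - u))
  have h3 := abs_le.1 (abs_real_inner_le_norm u (b - u))
  have h4 := abs_le.1 (abs_real_inner_le_norm (a - u) u)
  have h7 : ‖a - u‖ * ‖b - u‖ ≤ 1 / 4 * (1 / 4) := by gcongr
  rw [hu] at h3 h4
  linarith [h2.1, h3.1, h4.1]

/-- A sample-and-hold curve near `x₀` starts with the critical pair linked, and every step shrinks
its squared distance at rate at least `c`. So the pair stays linked and is visibly closer at time
`T`. -/
theorem IsCriticalPair.not_isCLSSSolution_const {x₀ : Config n N} {i j : Fin N}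
    (h : IsCriticalPair x₀ i j) (hb : CouplingBounds φ c C L) (hT : 0 < T) :
    ¬ IsCLSSSolution (hkClosed n φ) T fun _ => x₀ := by
  rintro ⟨-, η, y, -, hy, hlim⟩
  have hc := hb.pos
  rw [Metric.tendstoUniformlyOn_iff] at hlim
  -- The bound `1 / 8` keeps the other agents out of reach. The bound `c * T / 8` forces a final
  -- distance of at least `1 - c * T / 4`, against its square being at most `1 - c * T`.
  obtain ⟨k, hk⟩ := (hlim (min (1 / 8) (c * T / 8)) (by positivity)).exists
  obtain ⟨hy0, hcont, m, τ, hτ, h0, hl, hstep⟩ := hy k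
  set z := y k with hz
  have hclose : ∀ t ∈ Icc 0 T, ‖z t - x₀‖ ≤ 1 / 8 := fun t ht => by
    have := hk t ht
    rw [dist_comm, dist_eq_norm] at this
    exact this.le.trans (min_le_left _ _)
  set Δ : ℝ → EuclideanSpace ℝ (Fin n) := fun t => z t i - z t j with hΔ
  set u := x₀ i - x₀ j with hu
  have hu1 : ‖u‖ = 1 := h.dist_eq
  have hΔu : ∀ t ∈ Icc 0 T, ‖Δ t - u‖ ≤ 1 / 4 := fun t ht => by
    have h1 : Δ t - u = (z t - x₀) i - (z t - x₀) j := by simp only [hΔ, hu, Pi.sub_apply]; abel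
    rw [h1]
    have h2 := norm_le_pi_norm (z t - x₀) i
    have h3 := norm_le_pi_norm (z t - x₀) j
    have h4 := norm_sub_le ((z t - x₀) i) ((z t - x₀) j)
    linarith [hclose t ht]
  -- With the coupling `w ≥ 2 * c` of the pair this makes the rate `-2 * w * ⟪Δ t, Δ s⟫` at most
  -- `-c`.
  have hinner : ∀ s ∈ Icc 0 T, ∀ t ∈ Icc 0 T, 1 / 4 ≤ inner ℝ (Δ s) (Δ t) := by
    intro s hs t ht
    exact quarter_le_inner_of_near hu1 (hΔu s hs) (hΔu t ht)
  have hτ0 : ∀ p, 0 ≤ τ p := fun p => h0 ▸ hτ.monotone (Fin.zero_le p)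
  have hτT : ∀ p, τ p ≤ T := fun p => hl ▸ hτ.monotone (Fin.le_last p)
  have hcΔ : ContinuousOn Δ (Icc 0 T) :=
    ((continuous_apply i).comp_continuousOn hcont).sub ((continuous_apply j).comp_continuousOn hcont)
  -- the squared distance decreases at rate at least `c`
  have hmain : ∀ p : Fin (m + 1), ‖Δ (τ p)‖ ^ 2 ≤ 1 - c * τ p := by
    intro p
    induction p using Fin.induction with
    | zero =>
      rw [h0]
      have : Δ 0 = u := by simp only [hΔ, hu, hy0]
      rw [this, hu1]; simp
    | succ p ih =>
      have hpT : Icc (τ p.castSucc) (τ p.succ) ⊆ Icc 0 T := Icc_subset_Icc (hτ0 _) (hτT _)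
      have hlt := hτ p.castSucc_lt_succ
      have hlink : ‖z (τ p.castSucc) i - z (τ p.castSucc) j‖ ≤ 1 := by
        have h1 : 0 ≤ c * τ p.castSucc := mul_nonneg hc.le (hτ0 _)
        have h2 : ‖Δ (τ p.castSucc)‖ ^ 2 ≤ 1 := by linarith
        exact (sq_le_one_iff₀ (norm_nonneg _)).1 h2
      have hf := h.hkClosed_sub_apply (φ := φ) (hclose _ ⟨hτ0 p.castSucc, hτT _⟩) hlink
      set w := φ i j ‖z (τ p.castSucc) i - z (τ p.castSucc) j‖ +
        φ j i ‖z (τ p.castSucc) i - z (τ p.castSucc) j‖ with hw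
      have hw2 : 2 * c ≤ w := by
        have h1 := hb.lower i j _ ⟨norm_nonneg _, hlink⟩
        have h2 := hb.lower j i _ ⟨norm_nonneg _, hlink⟩
        linarith
      have hd : ∀ t ∈ Ico (τ p.castSucc) (τ p.succ), HasDerivWithinAt (fun s => ‖Δ s‖ ^ 2)
          (2 * inner ℝ (Δ t) (-(w • Δ (τ p.castSucc)))) (Ici t) t := by
        intro t ht
        have h1 : HasDerivWithinAt z (hkClosed n φ (z (τ p.castSucc))) (Ici t) t :=
          ((hstep p).2 t ht).mono_of_mem_nhdsWithin (mem_of_superset (Ico_mem_nhdsGE ht.2) (Ico_subset_Ico_left ht.1))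
        have h2 := (hasDerivWithinAt_pi.1 h1 i).fun_sub (hasDerivWithinAt_pi.1 h1 j)
        rw [hf] at h2
        exact h2.norm_sq
      have hB : ∀ t, HasDerivAt (fun s => ‖Δ (τ p.castSucc)‖ ^ 2 - c * (s - τ p.castSucc)) (-c) t := by
        intro t
        have := (((hasDerivAt_id t).sub_const (τ p.castSucc)).const_mul c).const_sub
          (‖Δ (τ p.castSucc)‖ ^ 2)
        simpa using this
      have hle : ‖Δ (τ p.succ)‖ ^ 2 ≤ ‖Δ (τ p.castSucc)‖ ^ 2 - c * (τ p.succ - τ p.castSucc) :=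
        image_le_of_deriv_right_le_deriv_boundary (f := fun s => ‖Δ s‖ ^ 2)
        ((hcΔ.mono hpT).norm.pow 2) hd (by simp)
        (HasDerivAt.continuousOn fun t _ => hB t) (fun t _ => (hB t).hasDerivWithinAt)
        (fun t ht => by
          have h1 := hinner t (hpT (Ico_subset_Icc_self ht)) _ (hpT (left_mem_Icc.2 hlt.le))
          rw [inner_neg_right, inner_smul_right]
          nlinarith) (right_mem_Icc.2 hlt.le)
      linarith
  have h1 := hmain (Fin.last m)
  rw [hl] at h1
  have h2 := hk T (right_mem_Icc.2 hT.le)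
  rw [dist_comm, dist_eq_norm] at h2
  have h3 : ‖z T - x₀‖ < c * T / 8 := h2.trans_le (min_le_right _ _)
  have h4 : 1 - ‖Δ T‖ ≤ c * T / 4 := by
    have h5 : u = (u - Δ T) + Δ T := by abel
    have h6 : u - Δ T = -((z T - x₀) i - (z T - x₀) j) := by simp only [hΔ, hu, Pi.sub_apply]; abel
    have h7 := norm_add_le (u - Δ T) (Δ T)
    rw [← h5, hu1, h6, norm_neg] at h7
    have h8 := norm_le_pi_norm (z T - x₀) i
    have h9 := norm_le_pi_norm (z T - x₀) j
    have h10 := norm_sub_le ((z T - x₀) i) ((z T - x₀) j)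
    linarith
  have hcT : 0 < c * T := by positivity
  nlinarith [norm_nonneg (Δ T), sq_nonneg (‖Δ T‖ - 1)]

theorem classical_ne (hφ : IsCoupling φ) (hn : 1 ≤ n) (hN : 2 ≤ N) (hT : 0 < T) :
    {x | IsClassicalSolution (hkClosed n φ) T x} ≠ {x | IsClassicalSolution (hkOpen n φ) T x} ∧
    {x | IsCaratheodorySolution (hkClosed n φ) T x} ≠
      {x | IsCaratheodorySolution (hkOpen n φ) T x} ∧
    {x | IsCLSSSolution (hkClosed n φ) T x} ≠ {x | IsCLSSSolution (hkOpen n φ) T x} := by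
  obtain ⟨c, C, L, hb⟩ := hφ.exists_bounds
  obtain ⟨x₀, i, j, h⟩ := exists_isCriticalPair hn hN
  have h0 : hkOpen n φ x₀ = 0 := h.hkOpen_eq_zero
  refine ⟨fun heq => ?_, fun heq => ?_, fun heq => ?_⟩
  · have : (fun _ => x₀) ∈ {x | IsClassicalSolution (hkClosed n φ) T x} :=
      heq ▸ isClassicalSolution_const h0
    exact h.hkClosed_ne_zero hb (eq_zero_of_isCaratheodorySolution_const hT
      (IsClassicalSolution.isCaratheodorySolution hT.le hb.norm_hkClosed_le this))
  · have : (fun _ => x₀) ∈ {x | IsCaratheodorySolution (hkClosed n φ) T x} :=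
      heq ▸ isCaratheodorySolution_const h0
    exact h.hkClosed_ne_zero hb (eq_zero_of_isCaratheodorySolution_const hT this)
  · have : (fun _ => x₀) ∈ {x | IsCLSSSolution (hkClosed n φ) T x} :=
      heq ▸ isCLSSSolution_const hT h0
    exact h.not_isCLSSSolution_const hb hT this

end CriticalPair

/-! ### Partitions of a space by the signs of functions. -/

section SignStratification

variable {X : Type*} {m : ℕ} {g : Fin m → X → ℝ} {σ τ : Fin m → SignType} {x : X}

/-- The points where the functions `g k` have the signs `σ k`. -/
def signCell (g : Fin m → X → ℝ) (σ : Fin m → SignType) : Set X :=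
  {x | ∀ k, SignType.sign (g k x) = σ k}

theorem eventually_sign_eq [TopologicalSpace X] (hg : ∀ k, Continuous (g k)) (hx : x ∈ signCell g σ) :
    ∀ᶠ y in 𝓝 x, ∀ k, σ k ≠ 0 → SignType.sign (g k y) = σ k := by
  rw [eventually_all]
  intro k
  have hxk := hx k
  cases hσ : σ k with
  | zero => exact Eventually.of_forall fun y h => absurd rfl h
  | neg =>
    rw [hσ] at hxk
    filter_upwards [(hg k).continuousAt.eventually_lt continuousAt_const (sign_eq_neg_one_iff.1 hxk)]
      with y hy _ using sign_eq_neg_one_iff.2 hy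
  | pos =>
    rw [hσ] at hxk
    filter_upwards [continuousAt_const.eventually_lt (hg k).continuousAt (sign_eq_one_iff.1 hxk)]
      with y hy _ using sign_eq_one_iff.2 hy

theorem disjoint_signCell (h : σ ≠ τ) : Disjoint (signCell g σ) (signCell g τ) :=
  Set.disjoint_left.2 fun _ hx hx' => h (funext fun k => (hx k).symm.trans (hx' k))

theorem iUnion_signCell : ⋃ σ, signCell g σ = univ :=
  eq_univ_of_forall fun x => mem_iUnion.2 ⟨fun k => SignType.sign (g k x), fun _ => rfl⟩

theorem isOpen_signCell [TopologicalSpace X] (hg : ∀ k, Continuous (g k)) (hσ : ∀ k, σ k ≠ 0) :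
    IsOpen (signCell g σ) :=
  isOpen_iff_mem_nhds.2 fun x hx => by
    filter_upwards [eventually_sign_eq hg hx] with y hy k using hy k (hσ k)

end SignStratification

/-! ### Sign partitions of transversal functions are stratifications. -/

section TransversalStratification

variable {E : Type*} [NormedAddCommGroup E] [NormedSpace ℝ E] {m : ℕ}

/-- Differentiable functions whose zero sets cross transversally. -/
structure IsTransversal (g : Fin m → E → ℝ) : Prop where
  contDiff : ∀ k, ContDiff ℝ 1 (g k)
  surjective : ∀ (x : E) (w : Fin m → ℝ), ∃ v : E, ∀ k, g k x = 0 → fderiv ℝ (g k) x v = w k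
  le_finrank : m ≤ Module.finrank ℝ E

variable {g : Fin m → E → ℝ} {σ τ : Fin m → SignType} {x : E}

/-- The derivative of the functions vanishing on a cell. -/
noncomputable def zeroDeriv (g : Fin m → E → ℝ) (σ : Fin m → SignType) (y : E) :
    E →L[ℝ] ({k // σ k = 0} → ℝ) :=
  ContinuousLinearMap.pi fun k => fderiv ℝ (g k) y

namespace IsTransversal

variable (hg : IsTransversal g)
include hg

theorem continuous (k : Fin m) : Continuous (g k) := (hg.contDiff k).continuous

theorem zeroDeriv_surjective (hx : x ∈ signCell g σ) :
    Function.Surjective (zeroDeriv g σ x) := by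
  intro w
  obtain ⟨v, hv⟩ := hg.surjective x fun k => if h : σ k = 0 then w ⟨k, h⟩ else 0
  refine ⟨v, funext fun k => ?_⟩
  have := hv k (sign_eq_zero_iff.1 ((hx k).trans k.2))
  rw [dif_pos k.2] at this
  exact this

theorem continuous_zeroDeriv : Continuous (zeroDeriv g σ) := by
  have h : ∀ k : {k // σ k = 0}, Continuous fun y => fderiv ℝ (g k) y := fun k =>
    (hg.contDiff k).continuous_fderiv one_ne_zero
  exact (ContinuousLinearMap.piEquivL ℝ E fun _ : {k // σ k = 0} => ℝ).continuous.comp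
    (continuous_pi h)

/-- Composing with a right inverse at `x` gives the identity at `x`, hence an invertible map nearby,
since units form an open set. -/
theorem eventually_zeroDeriv_surjective [FiniteDimensional ℝ E] (hx : x ∈ signCell g σ) :
    ∀ᶠ y in 𝓝 x, Function.Surjective (zeroDeriv g σ y) := by
  obtain ⟨R, hR⟩ := (zeroDeriv g σ x).exists_rightInverse_of_surjective
    (LinearMap.range_eq_top.2 (hg.zeroDeriv_surjective hx))
  have hc : Continuous fun y => (zeroDeriv g σ y).comp R :=
    hg.continuous_zeroDeriv.clm_comp continuous_const
  have h1 : ∀ᶠ y in 𝓝 x, IsUnit ((zeroDeriv g σ y).comp R) := by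
    refine hc.continuousAt.eventually (Units.isOpen.mem_nhds ?_)
    change IsUnit ((zeroDeriv g σ x).comp R)
    rw [hR]; exact isUnit_one
  filter_upwards [h1] with y hy w
  obtain ⟨u, hu⟩ := hy
  refine ⟨R ((↑u⁻¹ : ({k // σ k = 0} → ℝ) →L[ℝ] ({k // σ k = 0} → ℝ)) w), ?_⟩
  have := congrArg (fun A : ({k // σ k = 0} → ℝ) →L[ℝ] ({k // σ k = 0} → ℝ) => A w) u.mul_inv
  rw [hu] at this
  exact this

theorem isC1Submanifold_signCell [FiniteDimensional ℝ E] (σ : Fin m → SignType) :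
    IsC1Submanifold (signCell g σ) (Module.finrank ℝ E - Fintype.card {k // σ k = 0}) := by
  have hcard : Fintype.card {k // σ k = 0} ≤ Module.finrank ℝ E :=
    ((Fintype.card_subtype_le _).trans (Fintype.card_fin m).le).trans hg.le_finrank
  refine ⟨Fintype.card {k // σ k = 0}, Nat.sub_add_cancel hcard, fun x hx => ?_⟩
  obtain ⟨U, hU, hUo, hxU⟩ := mem_nhds_iff.1
    ((eventually_sign_eq hg.continuous hx).and (hg.eventually_zeroDeriv_surjective hx))
  set e := (Fintype.equivFin {k // σ k = 0}).symm with he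
  refine ⟨U, fun y i => g (e i) y, hUo, hxU,
    (contDiff_pi.2 fun i => hg.contDiff (e i)).contDiffOn, fun y hy w => ?_, ?_⟩
  · obtain ⟨v, hv⟩ := (hU hy).2 fun k => w (e.symm k)
    refine ⟨v, ?_⟩
    rw [fderiv_pi fun i => ((hg.contDiff (e i)).differentiable one_ne_zero).differentiableAt]
    funext i
    have := congrFun hv (e i)
    rw [e.symm_apply_apply] at this
    exact this
  · ext y
    constructor
    · rintro ⟨hy, hyU⟩
      exact ⟨hyU, funext fun i => sign_eq_zero_iff.1 ((hy (e i)).trans (e i).2)⟩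
    · rintro ⟨hyU, hy⟩
      refine ⟨fun k => ?_, hyU⟩
      by_cases hk : σ k = 0
      · have := congrFun hy (e.symm ⟨k, hk⟩)
        simp only [e.apply_symm_apply, Pi.zero_apply] at this
        rw [this, hk, sign_zero]
      · exact (hU hyU).1 k hk

/-- The functions vanishing at `x` form a submersion, which is open. Arbitrarily close to `x` they
take the values `ε • τ`, while the other functions keep their signs. -/
theorem mem_closure_signCell [FiniteDimensional ℝ E] (hx : x ∈ signCell g σ)
    (h : ∀ k, σ k ≠ 0 → τ k = σ k) : x ∈ closure (signCell g τ) := by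
  have hstrict : HasStrictFDerivAt (fun y (k : {k // σ k = 0}) => g k y) (zeroDeriv g σ x) x :=
    hasStrictFDerivAt_pi'.2 fun k => (hg.contDiff k).hasStrictFDerivAt one_ne_zero
  have hmap := hstrict.map_nhds_eq_of_surj
    (LinearMap.range_eq_top.2 (hg.zeroDeriv_surjective hx))
  have hzero : (fun k : {k // σ k = 0} => g k x) = 0 :=
    funext fun k => sign_eq_zero_iff.1 ((hx k).trans k.2)
  rw [hzero] at hmap
  rw [mem_closure_iff_nhds]
  intro W hW
  have h1 : (fun y (k : {k // σ k = 0}) => g k y) ''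
      (W ∩ {y | ∀ k, σ k ≠ 0 → SignType.sign (g k y) = σ k}) ∈ 𝓝 (0 : {k // σ k = 0} → ℝ) := by
    rw [← hmap]
    exact image_mem_map (inter_mem hW (eventually_sign_eq hg.continuous hx))
  have h2 : Tendsto (fun ε : ℝ => ε • fun k : {k // σ k = 0} => ((τ k : SignType) : ℝ)) (𝓝[>] 0)
      (𝓝 0) := by
    have : Continuous fun ε : ℝ => ε • fun k : {k // σ k = 0} => ((τ k : SignType) : ℝ) := by
      fun_prop
    simpa using this.continuousAt.tendsto.mono_left (nhdsWithin_le_nhds (a := (0 : ℝ)) (s := Ioi 0))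
  obtain ⟨ε, ⟨y, ⟨hyW, hys⟩, hy⟩, hε⟩ := ((h2.eventually h1).and self_mem_nhdsWithin).exists
  refine ⟨y, hyW, fun k => ?_⟩
  by_cases hk : σ k = 0
  · have := congrFun hy ⟨k, hk⟩
    simp only [Pi.smul_apply, smul_eq_mul] at this
    rw [this, sign_mul, sign_pos hε, one_mul]
    cases τ k <;> simp
  · rw [hys k hk, h k hk]

/-- Nonzero signs persist nearby, so `τ` agrees with `σ` wherever `σ` is nonzero, and as they differ
`τ` has fewer zeros. The agreement does not depend on the point, so the whole cell lies in the
frontier. -/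
theorem frontier_condition [FiniteDimensional ℝ E] (hne : σ ≠ τ)
    (h : (signCell g σ ∩ frontier (signCell g τ)).Nonempty) :
    signCell g σ ⊆ frontier (signCell g τ) ∧
      Module.finrank ℝ E - Fintype.card {k // σ k = 0} <
        Module.finrank ℝ E - Fintype.card {k // τ k = 0} := by
  obtain ⟨x, hx, hxf⟩ := h
  have hστ : ∀ k, σ k ≠ 0 → τ k = σ k := by
    intro k hk
    obtain ⟨y, hy, hy'⟩ := mem_closure_iff_nhds.1 (frontier_subset_closure hxf) _
      (eventually_sign_eq hg.continuous hx)
    exact (hy' k).symm.trans (hy k hk)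
  refine ⟨fun y hy => ⟨hg.mem_closure_signCell hy hστ, fun hy' =>
    Set.disjoint_left.1 (disjoint_signCell hne) hy (interior_subset hy')⟩, ?_⟩
  have hcard : Fintype.card {k // σ k = 0} ≤ Module.finrank ℝ E :=
    ((Fintype.card_subtype_le _).trans (Fintype.card_fin m).le).trans hg.le_finrank
  have hlt : Fintype.card {k // τ k = 0} < Fintype.card {k // σ k = 0} := by
    obtain ⟨k, hk⟩ := Function.ne_iff.1 hne
    have hσk : σ k = 0 := by
      by_contra h; exact hk (hστ k h).symm
    have hτk : τ k ≠ 0 := fun h => hk (hσk.trans h.symm)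
    have himp : ∀ k, τ k = 0 → σ k = 0 := fun k h => by
      by_contra h'; exact h' ((hστ k h').symm.trans h)
    refine Fintype.card_lt_of_injective_of_notMem (b := ⟨k, hσk⟩)
      (fun k : {k // τ k = 0} => (⟨k, himp k k.2⟩ : {k // σ k = 0})) ?_ ?_
    · intro a b hab; exact Subtype.ext (congrArg (fun c : {k // σ k = 0} => c.1) hab)
    · rintro ⟨a, ha⟩
      have : a.1 = k := congrArg (fun c : {k // σ k = 0} => c.1) ha
      exact hτk (this ▸ a.2)
  omega

/-- The partition of the space according to the signs of transversal functions, as a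
stratification. -/
noncomputable def stratification [FiniteDimensional ℝ E] {f : E → E}
    (typeI : Set (Fin m → SignType)) (next : (Fin m → SignType) → Fin m → SignType)
    (next_mem : ∀ σ, σ ∉ typeI → next σ ∈ typeI)
    (tangent : ∀ σ ∈ typeI, ∀ x ∈ signCell g σ, f x ∈ tangentVectors (signCell g σ) x)
    (smooth : ∀ σ ∈ typeI, IsSmoothOnSubset f (signCell g σ))
    (entering : ∀ σ, σ ∉ typeI → ∀ x ∈ signCell g σ, ∃ (ε : ℝ) (ξ : ℝ → E), 0 < ε ∧
      IsEnteringCurve f (signCell g (next σ)) x ε ξ ∧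
      ∀ (δ : ℝ) (η : ℝ → E), 0 < δ → δ ≤ ε → IsEnteringCurve f (signCell g (next σ)) x δ η →
        EqOn η ξ (Ico 0 δ)) : Stratification f where
  ι := Fin m → SignType
  countable_index := inferInstance
  cell := signCell g
  dim σ := Module.finrank ℝ E - Fintype.card {k // σ k = 0}
  isC1Submanifold := hg.isC1Submanifold_signCell
  iUnion_cell := iUnion_signCell
  locallyFinite _ _ := Set.toFinite _
  disjoint_cell _ _ h := disjoint_signCell h
  frontier_condition _ _ := hg.frontier_condition
  typeI := typeI
  next := next
  next_mem := next_mem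
  tangent := tangent
  smooth := smooth
  entering := entering

end IsTransversal

theorem mem_tangentVectors_of_isOpen {A : Set E} (hA : IsOpen A) (hx : x ∈ A) (v : E) :
    v ∈ tangentVectors A x := by
  have hc : ContDiff ℝ 1 fun t : ℝ => x + t • v := by fun_prop
  refine ⟨fun t => x + t • v, by simp, ?_, hc.contDiffAt, ?_⟩
  · refine hc.continuous.continuousAt.eventually (hA.mem_nhds ?_)
    simpa using hx
  · have : HasDerivAt (fun t : ℝ => x + t • v) ((1 : ℝ) • v) 0 :=
      ((hasDerivAt_id (0 : ℝ)).smul_const v).const_add x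
    rw [this.deriv, one_smul]

theorem zero_mem_tangentVectors {A : Set E} (hx : x ∈ A) : (0 : E) ∈ tangentVectors A x :=
  ⟨fun _ => x, rfl, Eventually.of_forall fun _ => hx, contDiffAt_const, deriv_const _ _⟩

theorem isSmoothOnSubset_of_eqOn {f F : E → E} {A : Set E} (hF : ContDiff ℝ (⊤ : ℕ∞) F)
    (h : EqOn f F A) : IsSmoothOnSubset f A :=
  fun _ _ => ⟨univ, F, isOpen_univ, mem_univ _, hF.contDiffOn, h.mono inter_subset_left⟩

end TransversalStratification

/-! ### Stratified solutions differ for two agents. -/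

section TwoAgents

variable {n : ℕ} {T : ℝ}

/-- The sign of this function tells whether two agents interact. -/
noncomputable def pairGap (n : ℕ) (_ : Fin 1) (x : Config n 2) : ℝ := ‖x 0 - x 1‖ ^ 2 - 1

theorem hasFDerivAt_pairGap (k : Fin 1) (x v : Config n 2) :
    fderiv ℝ (pairGap n k) x v = 2 * inner ℝ (x 0 - x 1) (v 0 - v 1) := by
  have h1 : HasFDerivAt (fun x : Config n 2 => x 0 - x 1)
      (ContinuousLinearMap.proj (R := ℝ) (φ := fun _ : Fin 2 => EuclideanSpace ℝ (Fin n)) 0 -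
        ContinuousLinearMap.proj 1) x :=
    (hasFDerivAt_apply 0 x).fun_sub (hasFDerivAt_apply 1 x)
  have h2 := h1.norm_sq.sub_const 1
  unfold pairGap
  rw [h2.fderiv]
  simp
  simp only [inner_sub_left, inner_sub_right]

theorem isTransversal_pairGap (hn : 1 ≤ n) : IsTransversal (pairGap n) where
  contDiff k := by
    unfold pairGap
    have : ContDiff ℝ 1 fun x : Config n 2 => x 0 - x 1 := by fun_prop
    exact (this.norm_sq ℝ).sub contDiff_const
  surjective x w := by
    refine ⟨Pi.single 0 ((w 0 / 2) • (x 0 - x 1)), fun k hk => ?_⟩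
    have h1 : ‖x 0 - x 1‖ ^ 2 = 1 := by unfold pairGap at hk; linarith
    rw [hasFDerivAt_pairGap, Pi.single_eq_same, Pi.single_eq_of_ne (by decide), sub_zero,
      inner_smul_right, real_inner_self_eq_norm_sq, h1, Subsingleton.elim k 0]
    ring
  le_finrank := by
    rw [Module.finrank_pi_fintype]; simp; omega

theorem hkOpen_two_of_lt {x : Config n 2} (h : ‖x 0 - x 1‖ < 1) :
    hkOpen n (unitCoupling 2) x = fun i => x (i + 1) - x i := by
  funext i
  simp only [hkOpen, hkField, openCutoff, unitCoupling, Fin.sum_univ_two]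
  fin_cases i
  · simp [h]
  · simp [norm_sub_rev (x 1) (x 0), h]

theorem hkOpen_two_of_ge {x : Config n 2} (h : 1 ≤ ‖x 0 - x 1‖) :
    hkOpen n (unitCoupling 2) x = 0 := by
  funext i
  simp only [hkOpen, hkField, openCutoff, unitCoupling, Fin.sum_univ_two]
  fin_cases i
  · simp [not_lt.2 h]
  · simp [norm_sub_rev (x 1) (x 0), not_lt.2 h]

theorem hkOpen_two_cases {σ : Fin 1 → SignType} {x : Config n 2} (hx : x ∈ signCell (pairGap n) σ) :
    (σ 0 = -1 → ‖x 0 - x 1‖ < 1) ∧ (σ 0 ≠ -1 → 1 ≤ ‖x 0 - x 1‖) := by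
  have h0 := hx 0
  constructor
  · intro h
    rw [h, sign_eq_neg_one_iff, pairGap, sub_neg] at h0
    exact (sq_lt_one_iff₀ (norm_nonneg _)).1 h0
  · intro h
    by_contra! hlt
    refine h (h0 ▸ sign_eq_neg_one_iff.2 ?_)
    rw [pairGap, sub_neg]
    exact (sq_lt_one_iff₀ (norm_nonneg _)).2 hlt

/-- The stratification of the original model for two agents. -/
noncomputable def openStratification (hn : 1 ≤ n) : Stratification (hkOpen n (unitCoupling 2)) :=
  -- All cells can be of type I: the field vanishes from distance one on, and the cell of smaller
  -- distances is open.
  (isTransversal_pairGap hn).stratification univ id (fun _ h => absurd (mem_univ _) h)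
    (fun σ _ x hx => by
      by_cases hσ : σ 0 = -1
      · refine mem_tangentVectors_of_isOpen (isOpen_signCell (isTransversal_pairGap hn).continuous
          fun k => ?_) hx _
        rw [Subsingleton.elim k 0, hσ]; decide
      · rw [hkOpen_two_of_ge ((hkOpen_two_cases hx).2 hσ)]
        exact zero_mem_tangentVectors hx)
    (fun σ _ => by
      by_cases hσ : σ 0 = -1
      · exact isSmoothOnSubset_of_eqOn (F := fun x i => x (i + 1) - x i) (by fun_prop)
          fun x hx => hkOpen_two_of_lt ((hkOpen_two_cases hx).1 hσ)
      · exact isSmoothOnSubset_of_eqOn (F := fun _ => 0) (by fun_prop)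
          fun x hx => hkOpen_two_of_ge ((hkOpen_two_cases hx).2 hσ))
    (fun _ h => absurd (mem_univ _) h)

/-- The constant curve at a critical pair solves the original model. For the variant, stratified
solutions of any stratification are Caratheodory solutions, and a constant one must sit at an
equilibrium. -/
theorem stratified_ne (hn : 1 ≤ n) (hT : 0 < T) :
    {x | IsSomeStratifiedSolution (hkClosed n (unitCoupling 2)) T x} ≠
      {x | IsSomeStratifiedSolution (hkOpen n (unitCoupling 2)) T x} := by
  intro heq
  obtain ⟨c, C, L, hb⟩ := (isCoupling_unitCoupling (N := 2)).exists_bounds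
  obtain ⟨x₀, i, j, h⟩ := exists_isCriticalPair hn le_rfl
  have hopen : IsSomeStratifiedSolution (hkOpen n (unitCoupling 2)) T fun _ => x₀ := by
    refine ⟨openStratification hn, IsPiece.isStratifiedSolution continuousOn_const
      ⟨hT, contDiffOn_const, fun k => SignType.sign (pairGap n k x₀), Or.inl ⟨mem_univ _,
        fun t _ => ⟨fun _ => rfl, ?_⟩⟩⟩⟩
    rw [h.hkOpen_eq_zero]; exact hasDerivWithinAt_const _ _ _
  have hclosed : (fun _ => x₀) ∈ {x | IsSomeStratifiedSolution (hkClosed n (unitCoupling 2)) T x} :=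
    heq ▸ hopen
  obtain ⟨S, hS⟩ := hclosed
  exact h.hkClosed_ne_zero hb (eq_zero_of_isCaratheodorySolution_const hT
    (hS.isCaratheodorySolution hT.le hb.norm_hkClosed_le))

end TwoAgents

/-! ### Entering curves of linear fields. -/

section LinearEntering

variable {E : Type*} [NormedAddCommGroup E] [NormedSpace ℝ E] [CompleteSpace E]

/-- The flow of `F` enters `A` by `h`. Any other entering curve solves the same linear equation,
also at time 0, where its right derivative is the limit of its velocities. -/
theorem exists_enteringCurve_of_clm {f : E → E} {A : Set E} {x : E} (F : E →L[ℝ] E)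
    (hfF : EqOn f F A)
    (h : ∀ ξ : ℝ → E, ξ 0 = x → HasDerivAt ξ (F x) 0 → ∀ᶠ t in 𝓝[>] 0, ξ t ∈ A) :
    ∃ (ε : ℝ) (ξ : ℝ → E), 0 < ε ∧ IsEnteringCurve f A x ε ξ ∧
      ∀ (δ : ℝ) (η : ℝ → E), 0 < δ → δ ≤ ε → IsEnteringCurve f A x δ η → EqOn η ξ (Ico 0 δ) := by
  obtain ⟨ξ, h0, ε₁, hε₁, hξ⟩ :=
    ContDiffAt.exists_forall_mem_closedBall_exists_eq_forall_mem_Ioo_hasDerivAt₀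
      (F.contDiff.contDiffAt (x := x)) 0
  rw [zero_sub, zero_add] at hξ
  have hξ0 := hξ 0 ⟨by linarith, hε₁⟩
  rw [h0] at hξ0
  obtain ⟨ε₂, hε₂, hA⟩ := mem_nhdsGT_iff_exists_Ioo_subset.1 (h ξ h0 hξ0)
  have hε₂' : 0 < ε₂ := hε₂
  have hcont : ContinuousOn ξ (Ioo (-ε₁) ε₁) := fun t ht =>
    (hξ t ht).continuousAt.continuousWithinAt
  refine ⟨min ε₁ ε₂, ξ, lt_min hε₁ hε₂', ⟨h0, fun b hb => ?_, fun t ht => ?_⟩, ?_⟩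
  · have hsub : Icc 0 b ⊆ Ioo (-ε₁) ε₁ := fun t ht =>
      ⟨by linarith [ht.1], ht.2.trans_lt (hb.2.trans_le (min_le_left _ _))⟩
    obtain ⟨M, hM⟩ := isCompact_Icc.exists_bound_of_continuousOn
      (F.continuous.comp_continuousOn (hcont.mono hsub))
    have hlip := lipschitzOnWith_of_hasDerivAt_off_countable countable_empty (hcont.mono hsub)
      (fun t ht => ⟨_, hM t (Ioo_subset_Icc_self ht.1), hξ t (hsub (Ioo_subset_Icc_self ht.1))⟩)
      ((norm_nonneg _).trans (hM 0 ⟨le_rfl, hb.1.le⟩))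
    refine LipschitzOnWith.absolutelyContinuousOnInterval (K := M.toNNReal) ?_
    rwa [uIcc_of_le hb.1.le]
  · obtain ⟨h1, h2⟩ := lt_min_iff.1 ht.2
    have hmem : ξ t ∈ A := hA ⟨ht.1, h2⟩
    exact ⟨hmem, hfF hmem ▸ hξ t ⟨by linarith [ht.1], h1⟩⟩
  · intro δ η hδ hδε hη t ht
    obtain ⟨b, htb, hbδ⟩ := exists_between ht.2
    have hb0 : 0 < b := ht.1.trans_lt htb
    have hηc : ContinuousOn η (Icc 0 b) := by
      have := (hη.2.1 b ⟨hb0, hbδ⟩).continuousOn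
      rwa [uIcc_of_le hb0.le] at this
    have hηd : ∀ s ∈ Ioo 0 b, HasDerivAt η (F (η s)) s := fun s hs => by
      have := hη.2.2 s ⟨hs.1, hs.2.trans hbδ⟩
      exact hfF this.1 ▸ this.2
    have hsub : Icc 0 b ⊆ Ioo (-ε₁) ε₁ := fun t ht =>
      ⟨by linarith [ht.1], (ht.2.trans_lt hbδ).trans_le (hδε.trans (min_le_left _ _))⟩
    refine ODE_solution_unique_of_mem_Icc_right (v := fun _ => F) (s := fun _ => univ)
      (K := ‖F‖₊) (fun _ _ => F.lipschitz.lipschitzOnWith) hηc (fun s hs => ?_)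
      (fun _ _ => mem_univ _) (hcont.mono hsub)
      (fun s hs => (hξ s (hsub (Ico_subset_Icc_self hs))).hasDerivWithinAt)
      (fun _ _ => mem_univ _) (hη.1.trans h0.symm) ⟨ht.1, htb.le⟩
    rcases eq_or_lt_of_le hs.1 with rfl | hs0
    · have hηc0 := hηc 0 ⟨le_rfl, hb0.le⟩
      refine hasDerivWithinAt_Ici_of_hasDerivAt_Ioo (g := fun s => F (η s)) hb0
        (hηc0.mono Ico_subset_Icc_self) hηd ?_
      refine F.continuous.continuousAt.tendsto.comp (hηc0.tendsto.mono_left ?_)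
      exact nhdsWithin_le_of_mem (mem_of_superset (Ioo_mem_nhdsGT hb0) Ioo_subset_Icc_self)
    · exact (hηd s ⟨hs0, hs.2⟩).hasDerivWithinAt

end LinearEntering

/-! ### Two stratifications whose solutions from one datum have different limits. -/

section ThreeAgents

theorem norm_eq_abs_apply_zero (v : EuclideanSpace ℝ (Fin 1)) : ‖v‖ = |v 0| := by
  rw [EuclideanSpace.norm_eq, Fin.sum_univ_one, Real.norm_eq_abs, sq_abs, Real.sqrt_sq_eq_abs]

/-- The signs of these functions tell which of three agents on the line interact. -/
noncomputable def edgeGap (k : Fin 3) (x : Config 1 3) : ℝ := (x k 0 - x (k + 1) 0) ^ 2 - 1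

theorem hasFDerivAt_coord {N : ℕ} (i : Fin N) (x : Config 1 N) :
    HasFDerivAt (fun x : Config 1 N => x i 0)
      ((EuclideanSpace.proj 0 : EuclideanSpace ℝ (Fin 1) →L[ℝ] ℝ).comp
        (ContinuousLinearMap.proj (R := ℝ) (φ := fun _ : Fin N => EuclideanSpace ℝ (Fin 1)) i)) x :=
  ContinuousLinearMap.hasFDerivAt (f := (EuclideanSpace.proj 0 : EuclideanSpace ℝ (Fin 1) →L[ℝ] ℝ).comp
    (ContinuousLinearMap.proj (R := ℝ) (φ := fun _ : Fin N => EuclideanSpace ℝ (Fin 1)) i))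

theorem fderiv_edgeGap (k : Fin 3) (x v : Config 1 3) :
    fderiv ℝ (edgeGap k) x v = 2 * (x k 0 - x (k + 1) 0) * (v k 0 - v (k + 1) 0) := by
  have h := (((hasFDerivAt_coord k x).fun_sub (hasFDerivAt_coord (k + 1) x)).pow 2).sub_const 1
  unfold edgeGap
  rw [h.fderiv]
  simp
  
theorem contDiff_edgeGap (k : Fin 3) : ContDiff ℝ 1 (edgeGap k) := by
  unfold edgeGap
  fun_prop

/-- The three differences sum to 0, so they cannot all be `±1` and at most two functions vanish at
once. Two of the differences `c k - c (k + 1)` can be prescribed freely. -/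
theorem isTransversal_edgeGap : IsTransversal edgeGap where
  contDiff := contDiff_edgeGap
  surjective x w := by
    have hsq : ∀ k, edgeGap k x = 0 → (x k 0 - x (k + 1) 0) ^ 2 = 1 := fun k hk => by
      rw [edgeGap] at hk; linarith
    have hderiv : ∀ (c : Fin 3 → ℝ) k, (edgeGap k x = 0 →
        c k - c (k + 1) = w k / 2 * (x k 0 - x (k + 1) 0)) → edgeGap k x = 0 →
        fderiv ℝ (edgeGap k) x (fun i => EuclideanSpace.single 0 (c i)) = w k := by
      intro c k hc hk
      rw [fderiv_edgeGap, PiLp.single_apply, PiLp.single_apply, if_pos rfl, if_pos rfl, hc hk]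
      linear_combination w k * hsq k hk
    have hne : ∃ k, edgeGap k x ≠ 0 := by
      by_contra! h
      have h0 := hsq 0 (h 0)
      have h1 := hsq 1 (h 1)
      have h2 := hsq 2 (h 2)
      simp only [Fin.isValue, zero_add, Fin.reduceAdd] at h0 h1 h2
      rcases sq_eq_one_iff.1 h0 with h | h <;>
        rcases sq_eq_one_iff.1 h1 with h' | h' <;> nlinarith
    set u : Fin 3 → ℝ := fun k => w k / 2 * (x k 0 - x (k + 1) 0) with hu
    obtain ⟨k₀, hk₀⟩ := hne
    fin_cases k₀
    · refine ⟨_, fun k => hderiv ![0, u 1 + u 2, u 2] k fun hk => ?_⟩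
      fin_cases k
      · exact absurd hk hk₀
      · simp [u]
      · simp [u]
    · refine ⟨_, fun k => hderiv ![u 0, 0, u 0 + u 2] k fun hk => ?_⟩
      fin_cases k
      · simp [u]
      · exact absurd hk hk₀
      · simp [u]
    · refine ⟨_, fun k => hderiv ![u 0 + u 1, u 1, 0] k fun hk => ?_⟩
      fin_cases k
      · simp [u]
      · simp [u]
      · exact absurd hk hk₀
  le_finrank := by
    rw [Module.finrank_pi_fintype]; simp

/-- Interaction of three agents with fixed weights on the edges `{k, k + 1}`. -/
noncomputable def triangleField (w : Fin 3 → ℝ) : Config 1 3 →L[ℝ] Config 1 3 :=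
  letI P (i : Fin 3) : Config 1 3 →L[ℝ] EuclideanSpace ℝ (Fin 1) := ContinuousLinearMap.proj i
  ContinuousLinearMap.pi fun i => w i • (P (i + 1) - P i) + w (i + 2) • (P (i + 2) - P i)

theorem triangleField_apply (w : Fin 3 → ℝ) (x : Config 1 3) (i : Fin 3) :
    triangleField w x i = w i • (x (i + 1) - x i) + w (i + 2) • (x (i + 2) - x i) := rfl

/-- The edges that interact in a cell. -/
noncomputable def edgeWeight (σ : Fin 3 → SignType) (k : Fin 3) : ℝ := if σ k = 1 then 0 else 1

theorem edgeWeight_eq {σ : Fin 3 → SignType} {x : Config 1 3} (hx : x ∈ signCell edgeGap σ)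
    (k : Fin 3) : edgeWeight σ k = if ‖x k - x (k + 1)‖ ≤ 1 then 1 else 0 := by
  have h : σ k = 1 ↔ ¬ ‖x k - x (k + 1)‖ ≤ 1 := by
    rw [← hx k, sign_eq_one_iff, edgeGap, sub_pos, norm_eq_abs_apply_zero, not_le, one_lt_sq_iff_one_lt_abs]
    rfl
  rw [edgeWeight]
  by_cases h' : ‖x k - x (k + 1)‖ ≤ 1
  · rw [if_pos h', if_neg (fun h1 => h.1 h1 h')]
  · rw [if_neg h', if_pos (h.2 h')]

theorem hkClosed_eq_triangleField {σ : Fin 3 → SignType} {x : Config 1 3}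
    (hx : x ∈ signCell edgeGap σ) :
    hkClosed 1 (unitCoupling 3) x = triangleField (edgeWeight σ) x := by
  funext i
  rw [triangleField_apply, edgeWeight_eq hx, edgeWeight_eq hx]
  simp only [hkClosed, hkField, closedCutoff, unitCoupling, Fin.sum_univ_three]
  fin_cases i
  · simp [norm_sub_rev (x 2) (x 0)]
  · simp [norm_sub_rev (x 1) (x 0), add_comm]
  · simp [norm_sub_rev (x 2) (x 1)]

/-- The cell entered from a cell with critical edges: the critical edges become interacting, except
that if both edges of an agent are critical and the third edge is long, only the edge `p` does. -/
def nextSign (p : Fin 3) (σ : Fin 3 → SignType) (k : Fin 3) : SignType :=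
  if σ = ![0, 0, 1] then (if k = p then -1 else 1) else if σ k = 0 then -1 else σ k

theorem hasDerivAt_edgeGap {w : Fin 3 → ℝ} {x : Config 1 3} {ξ : ℝ → Config 1 3} (h0 : ξ 0 = x)
    (h : HasDerivAt ξ (triangleField w x) 0) (k : Fin 3) :
    HasDerivAt (fun t => edgeGap k (ξ t)) (2 * (x k 0 - x (k + 1) 0) *
      (-2 * w k * (x k 0 - x (k + 1) 0) + w (k + 1) * (x (k + 1) 0 - x (k + 2) 0) +
        w (k + 2) * (x (k + 2) 0 - x k 0))) 0 := by
  have hd := ((contDiff_edgeGap k).differentiable one_ne_zero (ξ 0)).hasFDerivAt.comp_hasDerivAt 0 h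
  rw [h0, fderiv_edgeGap, triangleField_apply, triangleField_apply] at hd
  refine hd.congr_deriv ?_
  have h1 : k + 1 + 2 = k := by fin_cases k <;> rfl
  have h2 : k + 1 + 1 = k + 2 := by fin_cases k <;> rfl
  rw [h1, h2]
  simp only [PiLp.sub_apply, PiLp.add_apply, PiLp.smul_apply, smul_eq_mul]
  ring

/-- In the cell `![0, 0, 1]` agent 1 lies midway between the others; with only edge `p` active that
edge contracts, and drags the middle agent away from the other neighbour. In the other cells a
critical edge contracts with force 2 against at most 1 from a single further link, and two further
links together only strengthen the contraction. -/
theorem eventually_mem_signCell_nextSign {p : Fin 3} (hp : p = 0 ∨ p = 1) {σ : Fin 3 → SignType}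
    {x : Config 1 3} (hx : x ∈ signCell edgeGap σ) {ξ : ℝ → Config 1 3} (h0 : ξ 0 = x)
    (h : HasDerivAt ξ (triangleField (edgeWeight (nextSign p σ)) x) 0) :
    ∀ᶠ t in 𝓝[>] 0, ξ t ∈ signCell edgeGap (nextSign p σ) := by
  have hold := (h.continuousAt.tendsto.mono_left (nhdsWithin_le_nhds (s := Ioi 0))).eventually
    (h0.symm ▸ eventually_sign_eq (fun k => (contDiff_edgeGap k).continuous) hx)
  suffices hall : ∀ k, ∀ᶠ t in 𝓝[>] 0, SignType.sign (edgeGap k (ξ t)) = nextSign p σ k from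
    (eventually_all.2 hall)
  intro k
  by_cases hk : σ k = 0
  swap
  · have hnk : nextSign p σ k = σ k := by
      rw [nextSign]
      split_ifs with h1 h2
      · subst h1
        rcases hp with rfl | rfl <;> subst h2 <;> simp at hk
      · subst h1
        fin_cases k <;> simp at hk ⊢
      · rfl
    filter_upwards [hold] with t ht
    rw [ht k hk, hnk]
  have hd := (hasDerivAt_edgeGap h0 h k).hasDerivWithinAt (s := Ioi 0)
  have hgk : edgeGap k x = 0 := sign_eq_zero_iff.1 ((hx k).trans hk)
  have hsq : (x k 0 - x (k + 1) 0) ^ 2 = 1 := by rw [edgeGap] at hgk; linarith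
  have hbound : ∀ j, edgeWeight σ j = 0 ∨
      edgeWeight σ j = 1 ∧ (x j 0 - x (j + 1) 0) ^ 2 ≤ 1 := by
    intro j
    rw [edgeWeight_eq hx, norm_eq_abs_apply_zero]
    split_ifs with h
    · exact Or.inr ⟨rfl, (sq_le_one_iff_abs_le_one _).2 h⟩
    · exact Or.inl rfl
  by_cases hs : σ = ![0, 0, 1]
  · have hx2 : 1 < (x 2 0 - x 0 0) ^ 2 := by
      have := hx 2
      rw [hs] at this
      have := sign_eq_one_iff.1 this
      rw [edgeGap] at this
      simp only [Fin.isValue, Fin.reduceAdd] at this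
      linarith
    have hx01 : ∀ j : Fin 3, j ≠ 2 → (x j 0 - x (j + 1) 0) ^ 2 = 1 := by
      intro j hj
      have := hx j
      rw [hs] at this
      have : edgeGap j x = 0 := sign_eq_zero_iff.1 (this.trans (by fin_cases j <;> simp at hj ⊢))
      rw [edgeGap] at this
      linarith
    have hx0 := hx01 0 (by decide)
    have hx1 := hx01 1 (by decide)
    simp only [Fin.isValue, zero_add, Fin.reduceAdd] at hx0 hx1
    have hprod : 0 < (x 0 0 - x 1 0) * (x 1 0 - x 2 0) := by nlinarith
    have hk2 : k ≠ 2 := by rintro rfl; rw [hs] at hk; exact absurd hk (by decide)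
    by_cases hkp : k = p
    · have hnk : nextSign p σ k = -1 := by simp [nextSign, hs, hkp]
      have hneg := eventually_lt_of_hasDerivWithinAt_neg hd (by
        rcases hp with rfl | rfl <;> subst hkp <;>
          simp [edgeWeight, nextSign, hs] <;> nlinarith)
      filter_upwards [hneg] with t ht
      rw [h0, hgk] at ht
      rw [hnk, sign_eq_neg_one_iff]
      exact ht
    · have hnk : nextSign p σ k = 1 := by simp [nextSign, hs, hkp]
      have hpos := eventually_gt_of_hasDerivWithinAt_pos hd (by
        rcases hp with rfl | rfl <;> fin_cases k <;> simp at hkp hk2 <;>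
          simp [edgeWeight, nextSign, hs] <;> nlinarith)
      filter_upwards [hpos] with t ht
      rw [h0, hgk] at ht
      rw [hnk, sign_eq_one_iff]
      exact ht
  -- Critical edges already carry weight one, so entering the next cell leaves the field unchanged.
  · have hnext : ∀ j, edgeWeight (nextSign p σ) j = edgeWeight σ j := by
      intro j
      simp only [edgeWeight, nextSign, if_neg hs]
      by_cases hj : σ j = 0 <;> simp [hj]
    have hnk : nextSign p σ k = -1 := by simp [nextSign, hs, hk]
    have hwk : edgeWeight σ k = 1 := by simp [edgeWeight, hk]
    simp only [hnext, hwk] at hd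
    have hneg := eventually_lt_of_hasDerivWithinAt_neg hd (by
      have h1 := hbound (k + 1)
      have h2 := hbound (k + 2)
      have e1 : k + 1 + 1 = k + 2 := by fin_cases k <;> rfl
      have e2 : k + 2 + 1 = k := by fin_cases k <;> rfl
      rw [e1] at h1
      rw [e2] at h2
      rcases h1 with h1 | ⟨h1, h1'⟩ <;> rcases h2 with h2 | ⟨h2, h2'⟩ <;> rw [h1, h2] <;> nlinarith)
    filter_upwards [hneg] with t ht
    rw [h0, hgk] at ht
    rw [hnk, sign_eq_neg_one_iff]
    exact ht

/-- The stratification of the variant for three agents on the line belonging to `nextSign p`. -/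
noncomputable def triangleStratification (p : Fin 3) (hp : p = 0 ∨ p = 1) :
    Stratification (hkClosed 1 (unitCoupling 3)) :=
  isTransversal_edgeGap.stratification {σ | ∀ k, σ k ≠ 0} (nextSign p)
    (fun σ _ k => by
      rw [nextSign]
      split_ifs <;> first | decide | assumption)
    (fun _ hσ _ hx => mem_tangentVectors_of_isOpen
      (isOpen_signCell isTransversal_edgeGap.continuous hσ) hx _)
    (fun σ _ => isSmoothOnSubset_of_eqOn (triangleField (edgeWeight σ)).contDiff
      fun _ hx => hkClosed_eq_triangleField hx)
    (fun _ _ _ hx => exists_enteringCurve_of_clm _ (fun _ hy => hkClosed_eq_triangleField hy)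
      fun _ h0 h => eventually_mem_signCell_nextSign hp hx h0 h)

/-- The limit of the curve from `(-1, 0, 1)` along which the agent at `0` joins the agent that
shares the edge `p` with it. -/
noncomputable def splitLimit (p : Fin 3) : Config 1 3 := fun i =>
  EuclideanSpace.single 0 (if p = 0 then ![-(1 / 2), -(1 / 2), 1] i else ![-1, 1 / 2, 1 / 2] i)

/-- The direction in which that curve approaches its limit. -/
noncomputable def splitDirection (p : Fin 3) : Config 1 3 := fun i =>
  EuclideanSpace.single 0 (if p = 0 then ![-(1 / 2), 1 / 2, 0] i else ![0, -(1 / 2), 1 / 2] i)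

/-- The curve from `(-1, 0, 1)` along which the agent at `0` joins the agent that shares the edge
`p` with it. -/
noncomputable def splitCurve (p : Fin 3) (t : ℝ) : Config 1 3 :=
  splitLimit p + Real.exp (-2 * t) • splitDirection p

theorem hasDerivAt_splitCurve {p : Fin 3} (hp : p = 0 ∨ p = 1) (t : ℝ) :
    HasDerivAt (splitCurve p) (triangleField (fun k => if k = p then 1 else 0) (splitCurve p t)) t := by
  have hE : HasDerivAt (fun t : ℝ => Real.exp (-2 * t)) (-2 * Real.exp (-2 * t)) t := by
    have := ((hasDerivAt_id t).const_mul (-2)).exp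
    simpa [mul_comm] using this
  refine ((hE.smul_const (splitDirection p)).const_add (splitLimit p)).congr_deriv ?_
  have h1 : triangleField (fun k => if k = p then 1 else 0) (splitLimit p) = 0 := by
    ext i j
    rw [Subsingleton.elim j 0, triangleField_apply]
    rcases hp with rfl | rfl <;> fin_cases i <;> simp [splitLimit]
  have h2 : triangleField (fun k => if k = p then 1 else 0) (splitDirection p) =
      (-2 : ℝ) • splitDirection p := by
    ext i j
    rw [Subsingleton.elim j 0, triangleField_apply]
    rcases hp with rfl | rfl <;> fin_cases i <;> simp [splitDirection] <;> norm_num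
  rw [splitCurve, map_add, map_smul, h1, h2, zero_add, smul_smul, mul_comm]

theorem contDiff_splitCurve (p : Fin 3) : ContDiff ℝ (⊤ : ℕ∞) (splitCurve p) := by
  unfold splitCurve
  fun_prop

theorem splitCurve_zero {p : Fin 3} (hp : p = 0 ∨ p = 1) :
    splitCurve p 0 = fun i => EuclideanSpace.single 0 (![-1, 0, 1] i) := by
  ext i j
  rw [Subsingleton.elim j 0]
  rcases hp with rfl | rfl <;> fin_cases i <;> norm_num [splitCurve, splitLimit, splitDirection]

theorem splitCurve_zero_mem {p : Fin 3} (hp : p = 0 ∨ p = 1) :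
    splitCurve p 0 ∈ signCell edgeGap ![0, 0, 1] := by
  intro k
  rw [splitCurve_zero hp, edgeGap]
  fin_cases k
  · simp
  · simp
  · simp [sign_eq_one_iff]; norm_num

theorem splitCurve_mem {p : Fin 3} (hp : p = 0 ∨ p = 1) {t : ℝ} (ht : 0 < t) :
    splitCurve p t ∈ signCell edgeGap (nextSign p ![0, 0, 1]) := by
  have h1 : Real.exp (-2 * t) < 1 := Real.exp_lt_one_iff.2 (by linarith)
  have h2 := Real.exp_pos (-2 * t)
  have hc : splitCurve p t = splitLimit p + Real.exp (-2 * t) • splitDirection p := rfl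
  rw [hc]
  generalize Real.exp (-2 * t) = E at h1 h2
  clear hc
  intro k
  have key : edgeGap k (splitLimit p + E • splitDirection p) = if k = p then E ^ 2 - 1 else
      if k = 2 then (3 / 2 + E / 2) ^ 2 - 1 else (3 / 2 - E / 2) ^ 2 - 1 := by
    rcases hp with rfl | rfl <;> fin_cases k <;>
      simp [edgeGap, splitLimit, splitDirection] <;> ring
  rw [key, nextSign, if_pos rfl]
  split_ifs
  · rw [sign_eq_neg_one_iff]; nlinarith
  · rw [sign_eq_one_iff]; nlinarith
  · rw [sign_eq_one_iff]; nlinarith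

theorem isGlobal_splitCurve {p : Fin 3} (hp : p = 0 ∨ p = 1) :
    IsGlobal (IsStratifiedSolution (triangleStratification p hp)) (splitCurve p) := by
  intro T hT
  refine IsPiece.isStratifiedSolution (contDiff_splitCurve p).continuous.continuousOn
    ⟨hT, (contDiff_splitCurve p).contDiffOn, ![0, 0, 1], Or.inr ⟨fun h => h 0 rfl,
      splitCurve_zero_mem hp, fun t ht => ⟨splitCurve_mem hp ht.1, ?_⟩⟩⟩
  have hw : edgeWeight (nextSign p ![0, 0, 1]) = fun k => if k = p then 1 else 0 := by
    funext k
    by_cases hk : k = p <;> simp [edgeWeight, nextSign, hk]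
  rw [hkClosed_eq_triangleField (splitCurve_mem hp ht.1), hw]
  exact hasDerivAt_splitCurve hp t

theorem tendsto_splitCurve (p : Fin 3) : Tendsto (splitCurve p) atTop (𝓝 (splitLimit p)) := by
  have h : Tendsto (fun t : ℝ => Real.exp (-2 * t)) atTop (𝓝 0) :=
    Real.tendsto_exp_atBot.comp (tendsto_id.const_mul_atTop_of_neg (by norm_num))
  have := (h.smul_const (splitDirection p)).const_add (splitLimit p)
  rw [zero_smul, add_zero] at this
  exact this

theorem exists_stratifications_different_limits :
    ∃ (S S' : Stratification (hkClosed 1 (unitCoupling 3))) (x y : ℝ → Config 1 3)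
      (l l' : Config 1 3), x 0 = y 0 ∧ IsGlobal (IsStratifiedSolution S) x ∧
      IsGlobal (IsStratifiedSolution S') y ∧ Tendsto x atTop (𝓝 l) ∧ Tendsto y atTop (𝓝 l') ∧
      l ≠ l' := by
  refine ⟨_, _, _, _, _, _, (splitCurve_zero (.inl rfl)).trans (splitCurve_zero (.inr rfl)).symm,
    isGlobal_splitCurve (.inl rfl), isGlobal_splitCurve (.inr rfl), tendsto_splitCurve 0,
    tendsto_splitCurve 1, fun h => ?_⟩
  have := congrArg (fun x : Config 1 3 => x 0 0) h
  norm_num [splitLimit] at this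

end ThreeAgents

/-! ### CLSS solutions that depend on the step sizes. -/

section PlanarTriple

/-- Two agents approaching each other along an axis, and a third agent that is at distance at most
`1` from one of them exactly if `s = 1 / 2`. -/
noncomputable def planarTriple (s : ℝ) : Config 2 3 := fun i =>
  if i = 0 then !₂[s / 4, 0] else if i = 1 then !₂[-(s / 4), 0] else !₂[1 / 8, 1]

theorem norm_sq_eq_two (v : EuclideanSpace ℝ (Fin 2)) : ‖v‖ ^ 2 = v 0 ^ 2 + v 1 ^ 2 := by
  rw [EuclideanSpace.real_norm_sq_eq, Fin.sum_univ_two]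

theorem norm_planarTriple_sub_zero_one {s : ℝ} (hs : 0 ≤ s) :
    ‖planarTriple s 0 - planarTriple s 1‖ = s / 2 := by
  rw [← sq_eq_sq₀ (norm_nonneg _) (by positivity), norm_sq_eq_two]
  simp [planarTriple]
  ring

theorem norm_sq_planarTriple_sub_zero_two (s : ℝ) :
    ‖planarTriple s 0 - planarTriple s 2‖ ^ 2 = (s / 4 - 1 / 8) ^ 2 + 1 := by
  rw [norm_sq_eq_two]
  simp [planarTriple]

theorem one_lt_norm_planarTriple_sub_one_two {s : ℝ} (hs : 0 ≤ s) :
    1 < ‖planarTriple s 1 - planarTriple s 2‖ := by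
  rw [← one_lt_sq_iff₀ (norm_nonneg _), norm_sq_eq_two]
  simp [planarTriple]
  nlinarith

theorem hkClosed_planarTriple {s : ℝ} (hs : s ∈ Icc 0 1) (hs' : s ≠ 1 / 2) (h : ℝ) :
    planarTriple s + h • hkClosed 2 (unitCoupling 3) (planarTriple s) =
      planarTriple ((1 - 2 * h) * s) := by
  have h01 : ‖planarTriple s 0 - planarTriple s 1‖ ≤ 1 := by
    rw [norm_planarTriple_sub_zero_one hs.1]; linarith [hs.2]
  have h02 : ¬ ‖planarTriple s 0 - planarTriple s 2‖ ≤ 1 := by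
    rw [not_le, ← one_lt_sq_iff₀ (norm_nonneg _), norm_sq_planarTriple_sub_zero_two]
    have : s / 4 - 1 / 8 ≠ 0 := fun h => hs' (by linarith)
    linarith [sq_pos_of_ne_zero this]
  have h12 := (one_lt_norm_planarTriple_sub_one_two hs.1).not_ge
  have h10 := norm_sub_rev (planarTriple s 0) (planarTriple s 1) ▸ h01
  have h20 := norm_sub_rev (planarTriple s 0) (planarTriple s 2) ▸ h02
  have h21 := norm_sub_rev (planarTriple s 1) (planarTriple s 2) ▸ h12
  funext i
  simp only [Pi.add_apply, Pi.smul_apply, hkClosed, hkField, closedCutoff, unitCoupling,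
    Fin.sum_univ_three]
  fin_cases i
  · simp only [Fin.zero_eta, h01, h02]
    ext j
    fin_cases j <;> simp [planarTriple]
    ring
  · simp only [Fin.mk_one, h10, h12]
    ext j
    fin_cases j <;> simp [planarTriple]
    ring
  · simp only [Fin.reduceFinMk, h20, h21]
    ext j
    fin_cases j <;> simp [planarTriple]

theorem eulerPoint_planarTriple {h : ℝ} (h0 : 0 ≤ h) (h1 : 2 * h ≤ 1) (j : ℕ)
    (hne : ∀ i < j, (1 - 2 * h) ^ i ≠ 1 / 2) :
    eulerPoint (hkClosed 2 (unitCoupling 3)) h (planarTriple 1) j =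
      planarTriple ((1 - 2 * h) ^ j) := by
  induction j with
  | zero => simp [eulerPoint]
  | succ j ih =>
    rw [eulerPoint, ih fun i hi => hne i (hi.trans j.lt_succ_self), hkClosed_planarTriple
      ⟨pow_nonneg (by linarith) _, pow_le_one₀ (by linarith) (by linarith)⟩ (hne j j.lt_succ_self),
      pow_succ']

/-- For three agents with short enough steps, an Euler step preserves links. -/
theorem norm_euler_sub_le_one {n : ℕ} {x : Config n 3} {h : ℝ} (h0 : 0 ≤ h) (h1 : 3 * h ≤ 1)
    (hx : ‖x 0 - x 2‖ ≤ 1) :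
    ‖(x + h • hkClosed n (unitCoupling 3) x) 0 - (x + h • hkClosed n (unitCoupling 3) x) 2‖ ≤ 1 := by
  have hx' := norm_sub_rev (x 0) (x 2) ▸ hx
  simp only [Pi.add_apply, Pi.smul_apply, hkClosed, hkField, closedCutoff, unitCoupling,
    Fin.sum_univ_three, hx, hx']
  rw [norm_sub_rev (x 2) (x 1)]
  by_cases ha : ‖x 0 - x 1‖ ≤ 1 <;> by_cases hc : ‖x 1 - x 2‖ ≤ 1 <;> simp only [ha, hc]
  · calc _ = ‖(1 - 3 * h) • (x 0 - x 2)‖ := by congr 1; simp; module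
      _ ≤ 1 := by
        rw [norm_smul, Real.norm_of_nonneg (by linarith)]
        nlinarith [norm_nonneg (x 0 - x 2)]
  · calc _ = ‖(1 - 2 * h) • (x 0 - x 2) - h • (x 0 - x 1)‖ := by congr 1; simp; module
      _ ≤ _ := norm_sub_le _ _
      _ ≤ 1 := by
        rw [norm_smul, norm_smul, Real.norm_of_nonneg h0, Real.norm_of_nonneg (by linarith)]
        nlinarith [norm_nonneg (x 0 - x 2)]
  · calc _ = ‖(1 - 2 * h) • (x 0 - x 2) - h • (x 1 - x 2)‖ := by congr 1; simp; module
      _ ≤ _ := norm_sub_le _ _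
      _ ≤ 1 := by
        rw [norm_smul, norm_smul, Real.norm_of_nonneg h0, Real.norm_of_nonneg (by linarith)]
        nlinarith [norm_nonneg (x 0 - x 2)]
  · calc _ = ‖(1 - 2 * h) • (x 0 - x 2)‖ := by congr 1; simp; module
      _ ≤ 1 := by
        rw [norm_smul, Real.norm_of_nonneg (by linarith)]
        nlinarith [norm_nonneg (x 0 - x 2)]

/-- Euler points that eventually belong to a closed set yield a CLSS solution with limit in it. -/
theorem exists_clss_limit_mem {n N : ℕ} (x₀ : Config n N) {η : ℕ → ℝ} (hη : ∀ k, 0 < η k)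
    (hlim : Tendsto η atTop (𝓝 0)) {A : Set (Config n N)} (hA : IsClosed A) {t₀ : ℝ}
    (h : ∀ k t, t₀ ≤ t → eulerPoint (hkClosed n (unitCoupling N)) (η k) x₀ ⌊t / η k⌋₊ ∈ A) :
    ∃ (x : ℝ → Config n N) (l : Config n N), x 0 = x₀ ∧
      IsGlobal (IsCLSSSolution (hkClosed n (unitCoupling N))) x ∧ Tendsto x atTop (𝓝 l) ∧ l ∈ A ∧
      ∀ i j, l i = l j ∨ 1 ≤ ‖l i - l j‖ := by
  obtain ⟨c, C, L, hb⟩ := (isCoupling_unitCoupling (N := N)).exists_bounds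
  obtain ⟨U, x, hU, h0, hx, hxU⟩ := exists_clss_limit (hb.norm_hkClosed_le (n := n)) x₀ hη hlim
  obtain ⟨l, hl, hcl⟩ := hb.clustering_krasovskii x fun T hT =>
    (hx T hT).isKrasovskiiSolution hT.le hb.norm_hkClosed_le
  refine ⟨x, l, h0, hx, hl, hA.mem_of_tendsto hl ?_, hcl⟩
  filter_upwards [eventually_ge_atTop t₀, eventually_ge_atTop 0] with t ht ht0
  exact mem_of_eulerPoint_mem hb.norm_hkClosed_le hη hlim hU ht0 (hxU t ht0) hA fun k => h k t ht

theorem tendsto_zero_of_le_inv {η : ℕ → ℝ} (hη : ∀ k, 0 < η k)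
    (h : ∀ k, η k ≤ 1 / ((k : ℝ) + 1)) : Tendsto η atTop (𝓝 0) :=
  squeeze_zero (fun k => (hη k).le) h tendsto_one_div_add_atTop_nhds_zero_nat

/-- Here `1 - 2 * η k = (2 * k + 2) / (2 * k + 3)`, no power of which is `1 / 2` because the
denominators stay odd. The Euler points miss the contact and remain in the curve `planarTriple`, on
which clustering forces `s = 0`. -/
theorem exists_clss_norm_limit_gt : ∃ (x : ℝ → Config 2 3) (l : Config 2 3),
    x 0 = planarTriple 1 ∧ IsGlobal (IsCLSSSolution (hkClosed 2 (unitCoupling 3))) x ∧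
      Tendsto x atTop (𝓝 l) ∧ 1 < ‖l 0 - l 2‖ := by
  set η : ℕ → ℝ := fun k => 1 / (2 * (2 * k + 3)) with hη
  have hη0 : ∀ k, 0 < η k := fun k => by positivity
  have hηle : ∀ k, η k ≤ 1 / ((k : ℝ) + 1) := fun k =>
    one_div_le_one_div_of_le (by positivity) (by linarith [k.cast_nonneg (α := ℝ)])
  have hη1 : ∀ k, 2 * η k ≤ 1 := fun k => by
    simp only [η]
    rw [mul_one_div, div_le_one (by positivity)]
    linarith [k.cast_nonneg (α := ℝ)]
  have hcompact : IsCompact (planarTriple '' Icc 0 1) := by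
    refine isCompact_Icc.image (continuous_pi fun i => ?_)
    unfold planarTriple
    fin_cases i <;> simp <;> fun_prop
  obtain ⟨x, l, h0, hx, hl, ⟨s, hs, rfl⟩, hcl⟩ := exists_clss_limit_mem (planarTriple 1) hη0
    (tendsto_zero_of_le_inv hη0 hηle) hcompact.isClosed (t₀ := 0) fun k t _ => by
      rw [eulerPoint_planarTriple (hη0 k).le (hη1 k)]
      · exact ⟨_, ⟨pow_nonneg (by linarith [hη1 k]) _,
          pow_le_one₀ (by linarith [hη1 k]) (by linarith [hη0 k])⟩, rfl⟩
      · intro i _ hi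
        have h3 : (0 : ℝ) < 2 * k + 3 := by positivity
        have h1 : 1 - 2 * η k = ((2 * k + 2 : ℕ) : ℝ) / ((2 * k + 3 : ℕ) : ℝ) := by
          simp only [η]; push_cast; field_simp; ring
        rw [h1, div_pow, div_eq_div_iff (by positivity) two_ne_zero, one_mul] at hi
        have hi' : (2 * k + 2) ^ i * 2 = (2 * k + 3) ^ i := by exact_mod_cast hi
        have hodd : Odd ((2 * k + 3) ^ i) := Odd.pow ⟨k + 1, by ring⟩
        exact Nat.not_even_iff_odd.2 hodd ⟨(2 * k + 2) ^ i, by omega⟩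
  refine ⟨x, _, h0, hx, hl, ?_⟩
  have hs0 : s = 0 := by
    rcases hcl 0 1 with h | h
    · have := norm_planarTriple_sub_zero_one hs.1
      rw [h, sub_self, norm_zero] at this
      linarith
    · rw [norm_planarTriple_sub_zero_one hs.1] at h
      linarith [hs.2]
  rw [← one_lt_sq_iff₀ (norm_nonneg _), norm_sq_planarTriple_sub_zero_two, hs0]
  norm_num

/-- A step for which the Euler scheme reaches `planarTriple (1 / 2)`. -/
theorem exists_step_pow_eq_half (k : ℕ) :
    ∃ η : ℝ, 0 < η ∧ 2 * η * (k + 2) ≤ 1 ∧ (1 - 2 * η) ^ (k + 2) = 1 / 2 := by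
  obtain ⟨r, hr, hr2⟩ : ∃ r : ℝ, 0 ≤ r ∧ r ^ (k + 2) = 1 / 2 :=
    ⟨(1 / 2 : ℝ) ^ (((k + 2 : ℕ) : ℝ)⁻¹), by positivity,
      Real.rpow_inv_natCast_pow (by norm_num) (by omega)⟩
  have hr1 : r < 1 := by
    by_contra! h
    linarith [one_le_pow₀ h (n := k + 2)]
  refine ⟨(1 - r) / 2, by linarith, ?_, by rw [← hr2]; ring⟩
  have hr0 : 0 < r := hr.lt_of_ne (by rintro rfl; simp at hr2)
  -- Bernoulli's inequality for `r⁻¹`, whose power is 2, bounds the total time `(k + 2) * η`.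
  have h := one_add_mul_le_pow (a := r⁻¹ - 1) (by linarith [inv_pos.2 hr0]) (k + 2)
  rw [add_sub_cancel, inv_pow, hr2] at h
  have h2 : ((k + 2 : ℕ) : ℝ) * (1 - r) ≤ r := by
    have h3 : ((k + 2 : ℕ) : ℝ) * (r⁻¹ - 1) ≤ 1 := by linarith
    have := mul_le_mul_of_nonneg_right h3 hr
    have h4 : (r⁻¹ - 1) * r = 1 - r := by field_simp
    rwa [mul_assoc, h4, one_mul] at this
  push_cast at h2
  linarith

/-- Every scheme hits `s = 1 / 2` exactly, after time at most `1 / 2`. Then agents 0 and 2 are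
linked at distance one, and Euler steps preserve this link, which is a closed condition. -/
theorem exists_clss_norm_limit_le : ∃ (x : ℝ → Config 2 3) (l : Config 2 3),
    x 0 = planarTriple 1 ∧ IsGlobal (IsCLSSSolution (hkClosed 2 (unitCoupling 3))) x ∧
      Tendsto x atTop (𝓝 l) ∧ ‖l 0 - l 2‖ ≤ 1 := by
  choose η hη0 hη1 hη2 using exists_step_pow_eq_half
  have hk0 : ∀ k : ℕ, (0 : ℝ) ≤ k := fun k => k.cast_nonneg
  have hηle : ∀ k, η k ≤ 1 / ((k : ℝ) + 1) := fun k => by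
    rw [le_div_iff₀ (by linarith [hk0 k])]
    nlinarith [hη1 k, hη0 k, hk0 k]
  have hη4 : ∀ k, 4 * η k ≤ 1 := fun k => by nlinarith [hη1 k, hη0 k, hk0 k]
  have hclosed : IsClosed {y : Config 2 3 | ‖y 0 - y 2‖ ≤ 1} :=
    isClosed_le (by fun_prop) continuous_const
  obtain ⟨x, l, h0, hx, hl, hlA, -⟩ := exists_clss_limit_mem (planarTriple 1) hη0
    (tendsto_zero_of_le_inv hη0 hηle) hclosed (t₀ := 1) fun k t ht => by
      have hj : k + 2 ≤ ⌊t / η k⌋₊ := by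
        rw [Nat.le_floor_iff (div_nonneg (by linarith) (hη0 k).le), le_div_iff₀ (hη0 k)]
        push_cast
        nlinarith [hη1 k, hη0 k, hk0 k]
      generalize ⌊t / η k⌋₊ = j at hj
      induction j, hj using Nat.le_induction with
      | base =>
        rw [eulerPoint_planarTriple (hη0 k).le (by linarith [hη4 k, hη0 k]), hη2 k, mem_ofPred_eq,
          ← sq_le_one_iff₀ (norm_nonneg _), norm_sq_planarTriple_sub_zero_two]
        · norm_num
        · intro i hi
          rw [← hη2 k]
          exact (pow_lt_pow_right_of_lt_one₀ (by linarith [hη4 k, hη0 k]) (by linarith [hη0 k])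
            hi).ne'
      | succ j _ ih =>
        exact norm_euler_sub_le_one (hη0 k).le (by linarith [hη4 k, hη0 k]) ih
  exact ⟨x, l, h0, hx, hl, hlA⟩

theorem not_limitDetermined_clss :
    ¬ LimitDeterminedByInitial (IsCLSSSolution (hkClosed 2 (unitCoupling 3))) := by
  intro h
  obtain ⟨x, l, h0, hx, hl, hlt⟩ := exists_clss_norm_limit_gt
  obtain ⟨y, l', h0', hy, hl', hle⟩ := exists_clss_norm_limit_le
  rw [h x y l l' hx hy (h0.trans h0'.symm) hl hl'] at hlt
  exact hlt.not_ge hle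

end PlanarTriple

/-! ### Transfer of properties between solution concepts. -/

section SolutionConcepts

variable {E : Type*} {Sol Sol' : ℝ → (ℝ → E) → Prop} {x₀ : E}

theorem IsGlobal.mono (h : ∀ T x, 0 < T → Sol T x → Sol' T x) {x : ℝ → E} (hx : IsGlobal Sol x) :
    IsGlobal Sol' x :=
  fun T hT => h T x hT (hx T hT)

theorem ExistsFrom.mono (h : ∀ T x, 0 < T → Sol T x → Sol' T x) (hx : ExistsFrom Sol x₀) :
    ExistsFrom Sol' x₀ :=
  hx.imp fun _ hx => ⟨hx.1, hx.2.mono h⟩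

theorem UniqueFrom.mono (h : ∀ T x, 0 < T → Sol T x → Sol' T x) (hu : UniqueFrom Sol' x₀) :
    UniqueFrom Sol x₀ :=
  fun T x y hT hx hy => hu T x y hT (h T x hT hx) (h T y hT hy)

theorem BarycenterInvariant.mono {n N : ℕ} {Sol Sol' : ℝ → (ℝ → Config n N) → Prop}
    (h : ∀ T x, 0 < T → Sol T x → Sol' T x) (hb : BarycenterInvariant Sol') :
    BarycenterInvariant Sol :=
  fun T x hT hx => hb T x hT (h T x hT hx)

theorem Clustering.mono {n N : ℕ} {Sol Sol' : ℝ → (ℝ → Config n N) → Prop}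
    (h : ∀ T x, 0 < T → Sol T x → Sol' T x) (hc : Clustering Sol') : Clustering Sol :=
  fun x hx => hc x (hx.mono h)

theorem LimitDeterminedByInitial.mono [TopologicalSpace E]
    (h : ∀ T x, 0 < T → Sol T x → Sol' T x) (hl : LimitDeterminedByInitial Sol') :
    LimitDeterminedByInitial Sol :=
  fun x y l l' hx hy => hl x y l l' (hx.mono h) (hy.mono h)

theorem limitDeterminedByInitial_of_uniqueFrom [TopologicalSpace E] [T2Space E]
    (h : ∀ x₀, UniqueFrom Sol x₀) : LimitDeterminedByInitial Sol := by
  intro x y l l' hx hy h0 hl hl'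
  refine tendsto_nhds_unique_of_eventuallyEq hl hl' ?_
  filter_upwards [eventually_gt_atTop 0] with t ht
  exact h (x 0) t x y ht (hx t ht) (hy t ht) rfl h0.symm ⟨ht.le, le_rfl⟩

theorem exists_not_uniqueFrom [TopologicalSpace E] [T2Space E]
    (h : ¬ LimitDeterminedByInitial Sol) : ∃ x₀, ¬ UniqueFrom Sol x₀ := by
  by_contra! h'
  exact h (limitDeterminedByInitial_of_uniqueFrom h')

end SolutionConcepts

/-- Both stratified solutions from `(-1, 0, 1)` are Caratheodory solutions. -/
theorem not_limitDetermined_caratheodory :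
    ¬ LimitDeterminedByInitial (IsCaratheodorySolution (hkClosed 1 (unitCoupling 3))) := by
  intro h
  obtain ⟨c, C, L, hb⟩ := (isCoupling_unitCoupling (N := 3)).exists_bounds
  obtain ⟨S, S', x, y, l, l', h0, hx, hy, hl, hl', hne⟩ := exists_stratifications_different_limits
  exact hne (h x y l l'
    (hx.mono fun T _ hT hx => hx.isCaratheodorySolution hT.le hb.norm_hkClosed_le)
    (hy.mono fun T _ hT hy => hy.isCaratheodorySolution hT.le hb.norm_hkClosed_le) h0 hl hl')

end BoundedConfidence

theorem theorem3 :
    -- for all couplings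
    (∀ (n N : ℕ) (φ : Fin N → Fin N → ℝ → ℝ), IsCoupling φ →
      -- the Filippov and the Krasovskii solutions are unchanged
      (∀ T : ℝ, 0 < T →
        {x | IsFilippovSolution (hkClosed n φ) T x} =
          {x | IsFilippovSolution (hkOpen n φ) T x} ∧
        {x | IsKrasovskiiSolution (hkClosed n φ) T x} =
          {x | IsKrasovskiiSolution (hkOpen n φ) T x}) ∧
      -- the classical, Caratheodory and CLSS solutions change
      (1 ≤ n → 2 ≤ N → ∀ T : ℝ, 0 < T →
        {x | IsClassicalSolution (hkClosed n φ) T x} ≠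
          {x | IsClassicalSolution (hkOpen n φ) T x} ∧
        {x | IsCaratheodorySolution (hkClosed n φ) T x} ≠
          {x | IsCaratheodorySolution (hkOpen n φ) T x} ∧
        {x | IsCLSSSolution (hkClosed n φ) T x} ≠
          {x | IsCLSSSolution (hkOpen n φ) T x}) ∧
      -- existence for every initial datum
      (∀ x₀ : Config n N,
        ExistsFrom (IsCaratheodorySolution (hkClosed n φ)) x₀ ∧
        ExistsFrom (IsFilippovSolution (hkClosed n φ)) x₀ ∧
        ExistsFrom (IsKrasovskiiSolution (hkClosed n φ)) x₀ ∧
        ExistsFrom (IsCLSSSolution (hkClosed n φ)) x₀ ∧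
        ∀ S : Stratification (hkClosed n φ),
          NoAccumulationFrom S x₀ →
          ExistsFrom (IsStratifiedSolution S) x₀) ∧
      -- uniqueness for every initial datum
      (∀ x₀ : Config n N,
        UniqueFrom (IsClassicalSolution (hkClosed n φ)) x₀ ∧
        ∀ S : Stratification (hkClosed n φ),
          UniqueFrom (IsStratifiedSolution S) x₀) ∧
      -- uniqueness for almost every initial datum
      (∀ᵐ x₀ : Config n N,
        UniqueFrom (IsClassicalSolution (hkClosed n φ)) x₀ ∧
        UniqueFrom (IsCaratheodorySolution (hkClosed n φ)) x₀ ∧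
        UniqueFrom (IsFilippovSolution (hkClosed n φ)) x₀ ∧
        UniqueFrom (IsKrasovskiiSolution (hkClosed n φ)) x₀ ∧
        UniqueFrom (IsCLSSSolution (hkClosed n φ)) x₀ ∧
        UniqueFrom (IsSomeStratifiedSolution (hkClosed n φ)) x₀) ∧
      -- P1 and P2 for all concepts
      (∀ Sol ∈ ({IsClassicalSolution (hkClosed n φ),
            IsCaratheodorySolution (hkClosed n φ),
            IsFilippovSolution (hkClosed n φ),
            IsKrasovskiiSolution (hkClosed n φ),
            IsCLSSSolution (hkClosed n φ)} :
            Set (ℝ → (ℝ → Config n N) → Prop)),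
        BarycenterInvariant Sol ∧ Clustering Sol) ∧
      -- P3 for classical solutions
      LimitDeterminedByInitial
        (IsClassicalSolution (hkClosed n φ)) ∧
      -- P1, P2, P3 for stratified solutions of a fixed stratification
      (∀ S : Stratification (hkClosed n φ),
        BarycenterInvariant (IsStratifiedSolution S) ∧
        Clustering (IsStratifiedSolution S) ∧
        LimitDeterminedByInitial (IsStratifiedSolution S))) ∧
    -- from here on `φ_ij ≡ 1`; the stratified solutions change
    (∀ n : ℕ, 1 ≤ n → ∀ T : ℝ, 0 < T →
      {x | IsSomeStratifiedSolution
          (hkClosed n (unitCoupling 2)) T x} ≠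
        {x | IsSomeStratifiedSolution
          (hkOpen n (unitCoupling 2)) T x}) ∧
    -- classical solutions need not exist
    (∃ (n N : ℕ) (x₀ : Config n N) (T : ℝ), 0 < T ∧
      ¬ ∃ x : ℝ → Config n N, x 0 = x₀ ∧
        IsClassicalSolution
          (hkClosed n (unitCoupling N)) T x) ∧
    -- Caratheodory, Filippov, Krasovskii, CLSS: neither uniqueness nor P3 in general
    (∃ (n N : ℕ) (x₀ : Config n N),
      ¬ UniqueFrom (IsCaratheodorySolution
          (hkClosed n (unitCoupling N))) x₀) ∧
    (∃ (n N : ℕ) (x₀ : Config n N),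
      ¬ UniqueFrom (IsFilippovSolution
          (hkClosed n (unitCoupling N))) x₀) ∧
    (∃ (n N : ℕ) (x₀ : Config n N),
      ¬ UniqueFrom (IsKrasovskiiSolution
          (hkClosed n (unitCoupling N))) x₀) ∧
    (∃ (n N : ℕ) (x₀ : Config n N),
      ¬ UniqueFrom (IsCLSSSolution
          (hkClosed n (unitCoupling N))) x₀) ∧
    (∃ n N : ℕ, ¬ LimitDeterminedByInitial
      (IsCaratheodorySolution
        (hkClosed n (unitCoupling N)))) ∧
    (∃ n N : ℕ, ¬ LimitDeterminedByInitial
      (IsFilippovSolution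
        (hkClosed n (unitCoupling N)))) ∧
    (∃ n N : ℕ, ¬ LimitDeterminedByInitial
      (IsKrasovskiiSolution
        (hkClosed n (unitCoupling N)))) ∧
    (∃ n N : ℕ, ¬ LimitDeterminedByInitial
      (IsCLSSSolution
        (hkClosed n (unitCoupling N)))) ∧
    -- solutions of two stratifications from the same datum can have different limits
    (∃ (n N : ℕ)
      (S S' : Stratification
        (hkClosed n (unitCoupling N)))
      (x y : ℝ → Config n N) (l l' : Config n N),
      x 0 = y 0 ∧
      IsGlobal (IsStratifiedSolution S) x ∧
      IsGlobal (IsStratifiedSolution S') y ∧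
      Tendsto x atTop (𝓝 l) ∧ Tendsto y atTop (𝓝 l') ∧ l ≠ l') := by
  have hnk : ¬ LimitDeterminedByInitial (IsKrasovskiiSolution (hkClosed 1 (unitCoupling 3))) :=
    fun h => not_limitDetermined_caratheodory (h.mono fun _ _ _ hx => hx.isKrasovskiiSolution)
  have hnf : ¬ LimitDeterminedByInitial (IsFilippovSolution (hkClosed 1 (unitCoupling 3))) := by
    obtain ⟨c, C, L, hb⟩ := (isCoupling_unitCoupling (N := 3)).exists_bounds
    exact fun h => hnk (h.mono fun _ _ _ hx => hb.isFilippovSolution_iff.2 hx)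
  refine ⟨fun n N φ hφ => ?_, fun n hn T hT => stratified_ne hn hT,
    ⟨1, 5, not_exists_classicalSolution.imp fun x₀ h => ⟨1, one_pos, h⟩⟩,
    ⟨1, 3, exists_not_uniqueFrom not_limitDetermined_caratheodory⟩,
    ⟨1, 3, exists_not_uniqueFrom hnf⟩, ⟨1, 3, exists_not_uniqueFrom hnk⟩,
    ⟨2, 3, exists_not_uniqueFrom not_limitDetermined_clss⟩,
    ⟨1, 3, not_limitDetermined_caratheodory⟩, ⟨1, 3, hnf⟩, ⟨1, 3, hnk⟩,
    ⟨2, 3, not_limitDetermined_clss⟩, ⟨1, 3, exists_stratifications_different_limits⟩⟩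
  obtain ⟨c, C, L, hb⟩ := hφ.exists_bounds
  have hM := hb.norm_hkClosed_le (n := n)
  -- All concepts are embedded into Krasovskii solutions, from which P1, P2 and uniqueness for
  -- almost every datum are inherited.
  have hca : ∀ (T : ℝ) (x : ℝ → Config n N), 0 < T → IsCaratheodorySolution (hkClosed n φ) T x →
      IsKrasovskiiSolution (hkClosed n φ) T x := fun _ _ _ hx => hx.isKrasovskiiSolution
  have hcl : ∀ (T : ℝ) (x : ℝ → Config n N), 0 < T → IsClassicalSolution (hkClosed n φ) T x →
      IsKrasovskiiSolution (hkClosed n φ) T x := fun T x hT hx =>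
    hca T x hT (hx.isCaratheodorySolution hT.le hM)
  have hfi : ∀ (T : ℝ) (x : ℝ → Config n N), 0 < T → IsFilippovSolution (hkClosed n φ) T x →
      IsKrasovskiiSolution (hkClosed n φ) T x := fun _ _ _ hx => hb.isFilippovSolution_iff.1 hx
  have hkf : ∀ (T : ℝ) (x : ℝ → Config n N), 0 < T → IsKrasovskiiSolution (hkClosed n φ) T x →
      IsFilippovSolution (hkClosed n φ) T x := fun _ _ _ hx => hb.isFilippovSolution_iff.2 hx
  have hcs : ∀ (T : ℝ) (x : ℝ → Config n N), 0 < T → IsCLSSSolution (hkClosed n φ) T x →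
      IsKrasovskiiSolution (hkClosed n φ) T x := fun _ _ hT hx =>
    hx.isKrasovskiiSolution hT.le hM
  have hst : ∀ (S : Stratification (hkClosed n φ)) (T : ℝ) (x : ℝ → Config n N), 0 < T →
      IsStratifiedSolution S T x → IsKrasovskiiSolution (hkClosed n φ) T x := fun _ T x hT hx =>
    hca T x hT (hx.isCaratheodorySolution hT.le hM)
  have hex := hb.existsFrom_caratheodory (n := n)
  have hP1 := hb.barycenterInvariant_krasovskii (n := n)
  have hP2 := hb.clustering_krasovskii (n := n)
  refine ⟨fun T _ => ⟨?_, ?_⟩, fun hn hN T hT => classical_ne hφ hn hN hT,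
    fun x₀ => ⟨hex x₀, ((hex x₀).mono hca).mono hkf, (hex x₀).mono hca, existsFrom_clss hM x₀,
      fun S hS => existsFrom_stratified hM hS⟩,
    fun x₀ => ⟨hb.uniqueFrom_classical x₀, fun S => uniqueFrom_stratified hM S x₀⟩, ?_, ?_,
    limitDeterminedByInitial_of_uniqueFrom hb.uniqueFrom_classical,
    fun S => ⟨hP1.mono (hst S), hP2.mono (hst S),
      limitDeterminedByInitial_of_uniqueFrom (uniqueFrom_stratified hM S)⟩⟩
  · simp only [IsFilippovSolution, hb.filippovMap_hkClosed, hb.filippovMap_hkOpen,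
      hb.krasovskiiMap_hkClosed_eq_hkOpen]
  · simp only [IsKrasovskiiSolution, hb.krasovskiiMap_hkClosed_eq_hkOpen]
  · filter_upwards [hb.ae_uniqueFrom_krasovskii (n := n)] with x₀ h
    exact ⟨h.mono hcl, h.mono hca, h.mono hfi, h, h.mono hcs,
      h.mono fun T x hT hx => hx.elim fun S hS => hst S T x hT hS⟩
  · rintro Sol (rfl | rfl | rfl | rfl | rfl)
    · exact ⟨hP1.mono hcl, hP2.mono hcl⟩
    · exact ⟨hP1.mono hca, hP2.mono hca⟩
    · exact ⟨hP1.mono hfi, hP2.mono hfi⟩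
    · exact ⟨hP1, hP2⟩
    · exact ⟨hP1.mono hcs, hP2.mono hcs⟩
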